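/- **Planar graphs.** A *graph* is a finite set $H$ of half-edges with a partition of $H$ into vertices and an involution $\sigma$ of $H$, whose orbits are the edges. A one-element edge is a real leg; a two-element edge contained in one vertex is a virtual edge, and it is required that a vertex which contains a virtual edge is equal to it (a virtual vertex; all other vertices are real). A *directed graph* is a graph with an orientation $\mathrm{sgn}:H\to\{+,-\}$ which takes both values on every two-element edge and on every vertex. For a vertex $v$ let $In(v)$ and $Out(v)$ be its half-edges of sign $+$ and of sign $-$. The inputs (outputs) of the graph are the half-edges of sign $+$ (of sign $-$) that are real legs or belong to virtual edges. Each edge runs from the vertex of its half-edge of sign $-$ to the vertex of its half-edge of sign $+$ (where these exist), and $e\to e'$ means that there is a directed path which starts with the edge $e$ and ends with the edge $e'$. A *planar graph* is a directed graph with a linear order $\prec$ on its edges such that (P1) $e_1\to e_2$ implies $e_1\prec e_2$ for all $e_1\neq e_2$, and (P2) $e_1\to e_2$ and $e_1\prec e_3\prec e_2$ imply $e_3\to e_2$ or $e_1\to e_3$. It is *unitary* if it consists of two half-edges which form one virtual vertex, and *prime* if it has exactly one vertex and is not unitary. **Planar diagrams.** Let $\mathcal V$ be a strict tensor category. A *planar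 diagram* $[\Gamma,\gamma]$ in $\mathcal V$ is a planar graph $\Gamma$ with an object $\gamma_o(h)$ for every half-edge such that $\gamma_o(\sigma h)=\gamma_o(h)$, and a morphism $\gamma_m(v):\gamma_o(h_1)\otimes\cdots\otimes\gamma_o(h_m)\to\gamma_o(h_1')\otimes\cdots\otimes\gamma_o(h_n')$ for every real vertex $v$, where $h_1\prec\cdots\prec h_m$ and $h_1'\prec\cdots\prec h_n'$ are the elements of $In(v)$ and $Out(v)$. Its domain and its codomain are the words of the objects of its inputs and of its outputs, ordered by $\prec$. An isomorphism of diagrams is a bijection of the half-edges which is compatible with the vertices, $\sigma$, $\mathrm{sgn}$, $\prec$ and $\gamma$; let $\mathsf{Diag}(\mathcal V)$ be the set of isomorphism classes. The tensor product $[\Gamma_1,\gamma_1]\otimes[\Gamma_2,\gamma_2]$ is the disjoint union, with all edges of $\Gamma_1$ before all edges of $\Gamma_2$. If $cod[\Gamma_1,\gamma_1]=dom[\Gamma_2,\gamma_2]$, the composition $[\Gamma_2,\gamma_2]\circ[\Gamma_1,\gamma_1]$ is obtained by grafting, for every $k$, the $k$-th output $o_k$ of $\Gamma_1$ to the $k$-th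 input $i_k$ of $\Gamma_2$: two real legs form one edge $\{o_k,i_k\}$; a virtual edge grafted to a real leg is removed; two virtual edges grafted to each other are replaced by one virtual edge, formed by their halves other than $o_k$ and $i_k$. Let $\bar e_k$ be the edge made in this way, let $Q_k$ be the sequence of edges of $\Gamma_1$ strictly between the $(k-1)$-st and the $k$-th output edge, and $P_k$ the sequence of edges of $\Gamma_2$ strictly between the $k$-th and the $(k+1)$-st input edge ($Q_1$: all before the first output edge; $P_n$: all after the last input edge). The order of the edges of the composite is $Q_1\,\bar e_1\,P_1\,Q_2\,\bar e_2\,P_2\cdots Q_n\,\bar e_n\,P_n$. **Theorem.** For every strict tensor category $\mathcal V$ there is a unique map $\varepsilon:\mathsf{Diag}(\mathcal V)\to Mor(\mathcal V)$ such that 1. $\varepsilon(\varnothing)=Id_{1_{\mathcal V}}$ for the empty diagram $\varnothing$; 2. $\varepsilon([\Gamma,\gamma])=\gamma_m(v)$ if $\Gamma$ is prime with real vertex $v$; 3. $\varepsilon([\Gamma,\gamma])=Id_{\gamma_o(e)}$ if $\Gamma$ is unitary with virtual edge $e$; 4. for any diagrams with $cod[\Gamma_1,\gamma_1]=dom[\Gamma_2,\gamma_2]$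 the morphisms $\varepsilon([\Gamma_2,\gamma_2])$ and $\varepsilon([\Gamma_1,\gamma_1])$ are composable, and $\varepsilon([\Gamma_2,\gamma_2]\circ[\Gamma_1,\gamma_1])=\varepsilon([\Gamma_2,\gamma_2])\circ\varepsilon([\Gamma_1,\gamma_1])$; 5. on elementary diagrams, $\varepsilon([\Gamma_1,\gamma_1]\otimes\cdots\otimes[\Gamma_n,\gamma_n])=\varepsilon([\Gamma_1,\gamma_1])\otimes\cdots\otimes\varepsilon([\Gamma_n,\gamma_n])$ whenever every $\Gamma_i$ is prime or unitary. Moreover this map is monoidal, $\varepsilon([\Gamma_1,\gamma_1]\otimes[\Gamma_2,\gamma_2])=\varepsilon([\Gamma_1,\gamma_1])\otimes\varepsilon([\Gamma_2,\gamma_2])$ for all diagrams, and the source and the target of $\varepsilon([\Gamma,\gamma])$ are the tensor products of the words $dom[\Gamma,\gamma]$ and $cod[\Gamma,\gamma]$. -/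

import Mathlib

open CategoryTheory

universe v u

namespace TensorCalculus

/-! ### Strict tensor categories -/

/-- A strict tensor category: a monoidal category in which `(X ⊗ Y) ⊗ Z = X ⊗ (Y ⊗ Z)`,
`𝟙 ⊗ X = X` and `X ⊗ 𝟙 = X` hold as equalities of objects and the associator and the unitors are
the corresponding identity morphisms. -/
class StrictTensorCategory (V : Type u) [Category.{v} V] [MonoidalCategory V] : Prop where
  tensor_assoc : ∀ X Y Z : V,
    MonoidalCategoryStruct.tensorObj (MonoidalCategoryStruct.tensorObj X Y) Z =
      MonoidalCategoryStruct.tensorObj X (MonoidalCategoryStruct.tensorObj Y Z)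
  unit_tensor : ∀ X : V, MonoidalCategoryStruct.tensorObj (MonoidalCategoryStruct.tensorUnit V) X = X
  tensor_unit : ∀ X : V, MonoidalCategoryStruct.tensorObj X (MonoidalCategoryStruct.tensorUnit V) = X
  associator_eq : ∀ X Y Z : V,
    MonoidalCategoryStruct.associator X Y Z = eqToIso (tensor_assoc X Y Z)
  leftUnitor_eq : ∀ X : V, MonoidalCategoryStruct.leftUnitor X = eqToIso (unit_tensor X)
  rightUnitor_eq : ∀ X : V, MonoidalCategoryStruct.rightUnitor X = eqToIso (tensor_unit X)

section Morphisms

variable {V : Type u} [Category.{v} V] [MonoidalCategory V]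

/-- The tensor product `x₁ ⊗ ⋯ ⊗ xₙ` of a word of objects; the unit object for the empty word. -/
def tensorWord : List V → V
  | [] => MonoidalCategoryStruct.tensorUnit V
  | x :: w => MonoidalCategoryStruct.tensorObj x (tensorWord w)

/-- The tensor product of two elements of the set `Mor(V)` of all morphisms of `V`. -/
def tensorMor (f g : Arrow V) : Arrow V :=
  Arrow.mk (MonoidalCategoryStruct.tensorHom f.hom g.hom)

/-- The tensor product of a finite sequence of morphisms; the identity of the unit object for the
empty sequence. -/
def tensorMors : List (Arrow V) → Arrow V
  | [] => Arrow.mk (𝟙 (MonoidalCategoryStruct.tensorUnit V))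
  | f :: w => tensorMor f (tensorMors w)

/-- In the set `Mor(V)` of all morphisms: `g` and `f` are composable, and `g ∘ f = k`. -/
def IsCompositeMor (g f k : Arrow V) : Prop :=
  ∃ p : f.right = g.left, k = Arrow.mk (f.hom ≫ eqToHom p ≫ g.hom)

end Morphisms

/-! ### Graphs -/

/-- A pre-graph: a finite set `H` of half-edges, a partition of `H` into vertices (the classes of
`vtx`), and an involution `σ` of `H`, whose orbits are the edges. -/
structure PreGraph where
  H : Type
  finite : Finite H
  vtx : Setoid H
  σ : H → H
  σ_σ : ∀ h, σ (σ h) = h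

namespace PreGraph

variable (Γ : PreGraph)

instance : Finite Γ.H := Γ.finite

/-- The half-edges `h` and `k` belong to the same edge. -/
def SameEdge (h k : Γ.H) : Prop := k = h ∨ k = Γ.σ h

/-- `h` belongs to a virtual edge, i.e. to a two-element edge contained in a single vertex. -/
def Virt (h : Γ.H) : Prop := Γ.σ h ≠ h ∧ Γ.vtx h (Γ.σ h)

/-- `h` is a leg: it is an edge by itself (real leg) or belongs to a virtual edge (virtual leg). -/
def Leg (h : Γ.H) : Prop := Γ.σ h = h ∨ Γ.Virt h

end PreGraph

/-- A directed graph: a pre-graph without virtual vertices of degree at least three (so that a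
vertex which contains a virtual edge is equal to that edge), with an orientation
`sgn : H → {+, -}` (`true` is `+`, `false` is `-`) taking both values on every two-element edge,
such that every vertex has an incoming (`+`) and an outgoing (`-`) half-edge. -/
structure DirectedGraph extends PreGraph where
  virt_deg : ∀ h k, toPreGraph.Virt h → vtx h k → toPreGraph.SameEdge h k
  sgn : H → Bool
  sgn_σ : ∀ h, σ h ≠ h → sgn (σ h) ≠ sgn h
  exists_in : ∀ h, ∃ k, vtx h k ∧ sgn k = true
  exists_out : ∀ h, ∃ k, vtx h k ∧ sgn k = false

namespace DirectedGraph

variable (Γ : DirectedGraph)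

/-- For the edges `e₁ ∋ h` and `e₂ ∋ k`: `e₁ e₂` is a directed path, i.e. the target of `e₁`
(the vertex of its half-edge of sign `+`) is the source of `e₂` (the vertex of its half-edge of
sign `-`). -/
def Step (h k : Γ.H) : Prop :=
  ∃ a b, Γ.SameEdge h a ∧ Γ.SameEdge k b ∧ Γ.sgn a = true ∧ Γ.sgn b = false ∧ Γ.vtx a b

/-- For the edges `e₁ ∋ h` and `e₂ ∋ k`: there is a directed path which starts with `e₁` and ends
with `e₂`. -/
def Leads : Γ.H → Γ.H → Prop := Relation.TransGen Γ.Step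

/-- The inputs of the graph: the legs of sign `+`. -/
def inLegs : Set Γ.H := {h | Γ.Leg h ∧ Γ.sgn h = true}

/-- The outputs of the graph: the legs of sign `-`. -/
def outLegs : Set Γ.H := {h | Γ.Leg h ∧ Γ.sgn h = false}

/-- `In(v)` for the vertex `v` of `h`. -/
def inAt (h : Γ.H) : Set Γ.H := {k | Γ.vtx h k ∧ Γ.sgn k = true}

/-- `Out(v)` for the vertex `v` of `h`. -/
def outAt (h : Γ.H) : Set Γ.H := {k | Γ.vtx h k ∧ Γ.sgn k = false}

end DirectedGraph

/-- A (progressive) planar graph: a directed graph with a planar structure, i.e. a linear order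
`≼` on the set of edges subject to the two conditions `P1` and `P2`. The order is written on
half-edges, `le h k` meaning that the edge of `h` is `≼` the edge of `k`; antisymmetry on edges is
`le_antisymm_iff`. -/
structure PlanarGraph extends DirectedGraph where
  le : H → H → Prop
  le_total : ∀ h k, le h k ∨ le k h
  le_trans : ∀ h k l, le h k → le k l → le h l
  le_antisymm_iff : ∀ h k, (le h k ∧ le k h) ↔ toPreGraph.SameEdge h k
  P1 : ∀ h k, toDirectedGraph.Leads h k → ¬ toPreGraph.SameEdge h k → ¬ le k h
  P2 : ∀ h k l, toDirectedGraph.Leads h k → ¬ le l h → ¬ le k l →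
    toDirectedGraph.Leads l k ∨ toDirectedGraph.Leads h l

namespace PlanarGraph

variable (Γ : PlanarGraph)

/-- The strict order `≺` on edges. -/
def lt (h k : Γ.H) : Prop := ¬ Γ.le k h

/-- The linear order `≼` on half-edges: compare the edges; in a two-element edge the half-edge of
sign `-` comes first. -/
def leH (h k : Γ.H) : Prop := h = k ∨ Γ.lt h k ∨ (Γ.SameEdge h k ∧ Γ.sgn h = false)

end PlanarGraph

namespace PreGraph

variable {Γ : PreGraph}

theorem SameEdge.refl (h : Γ.H) : Γ.SameEdge h h := Or.inl rfl

theorem SameEdge.symm {h k : Γ.H} (e : Γ.SameEdge h k) : Γ.SameEdge k h := by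
  rcases e with rfl | rfl
  · exact Or.inl rfl
  · exact Or.inr (Γ.σ_σ _).symm

theorem SameEdge.trans {h k l : Γ.H} (e : Γ.SameEdge h k) (f : Γ.SameEdge k l) :
    Γ.SameEdge h l := by
  rcases e with rfl | rfl <;> rcases f with rfl | rfl
  · exact Or.inl rfl
  · exact Or.inr rfl
  · exact Or.inr rfl
  · exact Or.inl (Γ.σ_σ _)

theorem Virt.σ {h : Γ.H} (p : Γ.Virt h) : Γ.Virt (Γ.σ h) :=
  ⟨by rw [Γ.σ_σ]; exact p.1.symm, by rw [Γ.σ_σ]; exact Γ.vtx.symm p.2⟩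

theorem Virt.sameEdge {h k : Γ.H} (p : Γ.Virt h) (e : Γ.SameEdge h k) : Γ.Virt k := by
  rcases e with rfl | rfl
  exacts [p, p.σ]

theorem Virt.vtx {h k : Γ.H} (p : Γ.Virt h) (e : Γ.SameEdge h k) : Γ.vtx h k := by
  rcases e with rfl | rfl
  exacts [Γ.vtx.refl _, p.2]

end PreGraph

namespace DirectedGraph

variable {Γ : DirectedGraph}

open PreGraph

theorem Virt_vtx {h k : Γ.H} (p : Γ.Virt h) (e : Γ.vtx h k) : Γ.Virt k :=
  p.sameEdge (Γ.virt_deg h k p e)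

theorem not_virt_of_vtx {h k : Γ.H} (e : Γ.vtx h k) (p : ¬ Γ.Virt h) : ¬ Γ.Virt k :=
  fun q => p (Virt_vtx q (Γ.vtx.symm e))

/-- The vertex of `h` is real, i.e. contains no virtual edge, if and only if `h` itself does not
belong to a virtual edge. -/
theorem real_iff (h : Γ.H) : (∀ k, Γ.vtx h k → ¬ Γ.Virt k) ↔ ¬ Γ.Virt h :=
  ⟨fun p => p h (Γ.vtx.refl h), fun p _ e => not_virt_of_vtx e p⟩

theorem eq_of_sameEdge {h k : Γ.H} (e : Γ.SameEdge h k) (s : Γ.sgn h = Γ.sgn k) : h = k := by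
  rcases e with rfl | rfl
  · rfl
  · by_contra hne
    exact Γ.sgn_σ h (Ne.symm hne) s.symm

theorem step_congr {h h' k k' : Γ.H} (e : Γ.SameEdge h h') (f : Γ.SameEdge k k')
    (s : Γ.Step h k) : Γ.Step h' k' := by
  obtain ⟨a, b, ea, eb, r⟩ := s
  exact ⟨a, b, e.symm.trans ea, f.symm.trans eb, r⟩

theorem leads_congr {h h' k k' : Γ.H} (e : Γ.SameEdge h h') (f : Γ.SameEdge k k')
    (s : Γ.Leads h k) : Γ.Leads h' k' := by
  have left : ∀ {x}, Γ.Leads h x → Γ.Leads h' x := by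
    intro x s
    induction s with
    | single s => exact .single (step_congr e (.refl _) s)
    | tail _ s ih => exact ih.tail s
  have s' := left s
  cases s' with
  | single s => exact .single (step_congr (.refl _) f s)
  | tail s t => exact s.tail (step_congr (.refl _) f t)

/-- A directed path between distinct edges runs through real vertices. -/
theorem step_real {h k : Γ.H} (s : Γ.Step h k) (ne : ¬ Γ.SameEdge h k) :
    ∃ a b, Γ.SameEdge h a ∧ Γ.SameEdge k b ∧ Γ.sgn a = true ∧ Γ.sgn b = false ∧ Γ.vtx a b ∧
      ¬ Γ.Virt a ∧ ¬ Γ.Virt b := by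
  obtain ⟨a, b, ea, eb, sa, sb, ab⟩ := s
  have na : ¬ Γ.Virt a := fun p => ne ((ea.trans (Γ.virt_deg a b p ab)).trans eb.symm)
  exact ⟨a, b, ea, eb, sa, sb, ab, na, not_virt_of_vtx ab na⟩

/-- No directed path from another edge ends in an input edge. -/
theorem sameEdge_of_leads_in {h k i : Γ.H} (s : Γ.Leads h k) (hi : i ∈ Γ.inLegs)
    (e : Γ.SameEdge k i) : Γ.SameEdge h k := by
  have key : ∀ {x y}, Γ.Step x y → Γ.SameEdge y i → Γ.SameEdge x y := by
    intro x y s e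
    by_contra ne
    obtain ⟨a, b, ea, eb, sa, sb, ab, na, nb⟩ := step_real s ne
    have hb : Γ.SameEdge i b := e.symm.trans eb
    rcases hb with rfl | rfl
    · simp [hi.2] at sb
    · rcases hi.1 with h | h
      · rw [h, hi.2] at sb; simp at sb
      · exact nb h.σ
  induction s with
  | single s => exact key s e
  | tail _ s ih =>
    have := key s e
    exact (ih (this.trans e)).trans this

/-- No directed path to another edge starts in an output edge. -/
theorem sameEdge_of_leads_out {h k o : Γ.H} (s : Γ.Leads h k) (ho : o ∈ Γ.outLegs)
    (e : Γ.SameEdge h o) : Γ.SameEdge h k := by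
  have key : ∀ {x y}, Γ.Step x y → Γ.SameEdge x o → Γ.SameEdge x y := by
    intro x y s e
    by_contra ne
    obtain ⟨a, b, ea, eb, sa, sb, ab, na, nb⟩ := step_real s ne
    have hb : Γ.SameEdge o a := e.symm.trans ea
    rcases hb with rfl | rfl
    · simp [ho.2] at sa
    · rcases ho.1 with h | h
      · rw [h, ho.2] at sa; simp at sa
      · exact na h.σ
  induction s with
  | single s => exact key s e
  | tail _ s ih => exact ih.trans (key s (ih.symm.trans e))

end DirectedGraph

namespace PlanarGraph

open PreGraph DirectedGraph

variable {Γ : PlanarGraph}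

theorem le_refl (h : Γ.H) : Γ.le h h := by
  rcases Γ.le_total h h with p | p <;> exact p

theorem le_of_sameEdge {h k : Γ.H} (e : Γ.SameEdge h k) : Γ.le h k :=
  ((Γ.le_antisymm_iff h k).2 e).1

theorem le_of_not_le {h k : Γ.H} (p : ¬ Γ.le h k) : Γ.le k h :=
  (Γ.le_total h k).resolve_left p

theorem le_of_leads {h k : Γ.H} (s : Γ.Leads h k) : Γ.le h k := by
  by_cases e : Γ.SameEdge h k
  · exact le_of_sameEdge e
  · exact le_of_not_le (Γ.P1 h k s e)

/-- A linear order on the edges which satisfies the two conditions for directed paths of length two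
is a planar structure. -/
theorem P1_of_step {Γ : DirectedGraph} {le : Γ.H → Γ.H → Prop}
    (le_trans : ∀ h k l, le h k → le k l → le h l)
    (le_antisymm_iff : ∀ h k, (le h k ∧ le k h) ↔ Γ.SameEdge h k)
    (step : ∀ h k, Γ.Step h k → le h k) (h k : Γ.H) (s : Γ.Leads h k)
    (ne : ¬ Γ.SameEdge h k) : ¬ le k h := by
  have : le h k := by
    clear ne
    induction s with
    | single s => exact step _ _ s
    | tail _ s ih => exact le_trans _ _ _ ih (step _ _ s)
  exact fun q => ne ((le_antisymm_iff h k).1 ⟨this, q⟩)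

theorem P2_of_step {Γ : DirectedGraph} {le : Γ.H → Γ.H → Prop}
    (le_antisymm_iff : ∀ h k, (le h k ∧ le k h) ↔ Γ.SameEdge h k)
    (step : ∀ h k l, Γ.Step h k → ¬ le l h → ¬ le k l → Γ.Leads l k ∨ Γ.Leads h l)
    (h k l : Γ.H) (s : Γ.Leads h k) (p : ¬ le l h) (q : ¬ le k l) :
    Γ.Leads l k ∨ Γ.Leads h l := by
  induction s with
  | single s => exact step _ _ _ s p q
  | @tail m k s t ih =>
    by_cases c : le m l
    · by_cases d : le l m
      · exact Or.inr (leads_congr (.refl _) ((le_antisymm_iff _ _).1 ⟨c, d⟩) s)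
      · rcases step _ _ _ t d q with r | r
        · exact Or.inl r
        · exact Or.inr (s.trans r)
    · rcases ih c with r | r
      · exact Or.inl (r.tail t)
      · exact Or.inr r

/-! #### Ordered lists of half-edges -/

instance : Std.Total Γ.leH := ⟨fun h k => by
  by_cases c : Γ.le k h
  · by_cases d : Γ.le h k
    · have e := (Γ.le_antisymm_iff h k).1 ⟨d, c⟩
      rcases hs : Γ.sgn h with _ | _
      · exact Or.inl (Or.inr (Or.inr ⟨e, hs⟩))
      · by_cases ek : k = h
        · exact Or.inl (Or.inl ek.symm)
        · have e' := e.symm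
          refine Or.inr (Or.inr (Or.inr ⟨e', ?_⟩))
          rcases hk : Γ.sgn k with _ | _
          · rfl
          · exact absurd (eq_of_sameEdge e' (hk.trans hs.symm)) ek
    · exact Or.inr (Or.inr (Or.inl d))
  · exact Or.inl (Or.inr (Or.inl c))⟩

theorem le_of_leH {h k : Γ.H} (p : Γ.leH h k) : Γ.le h k := by
  rcases p with rfl | p | p
  exacts [le_refl _, le_of_not_le p, le_of_sameEdge p.1]

instance : Std.Antisymm Γ.leH := ⟨fun h k p q => by
  have e := (Γ.le_antisymm_iff h k).1 ⟨le_of_leH p, le_of_leH q⟩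
  rcases p with p | p | p
  · exact p
  · exact absurd (le_of_leH q) p
  · rcases q with q | q | q
    · exact q.symm
    · exact absurd (le_of_sameEdge e) q
    · exact eq_of_sameEdge e (p.2.trans q.2.symm)⟩

instance : IsTrans Γ.H Γ.leH := ⟨fun h k l p q => by
  have hl := Γ.le_trans _ _ _ (le_of_leH p) (le_of_leH q)
  by_cases c : Γ.le l h
  · have ehk := (Γ.le_antisymm_iff h k).1 ⟨le_of_leH p, Γ.le_trans _ _ _ (le_of_leH q) c⟩
    have ehl := (Γ.le_antisymm_iff h l).1 ⟨hl, c⟩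
    rcases p with rfl | p | p
    · exact q
    · exact absurd (le_of_sameEdge ehk.symm) p
    · exact Or.inr (Or.inr ⟨ehl, p.2⟩)
  · exact Or.inr (Or.inl c)⟩

variable (Γ) in
open Classical in
/-- The list of the elements of a set of half-edges in increasing order. -/
noncomputable def ordList (S : Set Γ.H) : List Γ.H := S.toFinite.toFinset.sort Γ.leH

theorem mem_ordList {S : Set Γ.H} {h : Γ.H} : h ∈ Γ.ordList S ↔ h ∈ S := by
  classical
  simp [ordList]

theorem pairwise_ordList (S : Set Γ.H) : (Γ.ordList S).Pairwise Γ.leH := by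
  classical
  exact Finset.pairwise_sort _ _

theorem nodup_ordList (S : Set Γ.H) : (Γ.ordList S).Nodup := by
  classical
  exact Finset.sort_nodup _ _

theorem eq_ordList {S : Set Γ.H} {l : List Γ.H} (p : l.Pairwise Γ.leH) (n : l.Nodup)
    (m : ∀ h, h ∈ l ↔ h ∈ S) : l = Γ.ordList S :=
  ((List.perm_ext_iff_of_nodup n (nodup_ordList S)).2 fun h => by
    rw [m, mem_ordList]).eq_of_pairwise' p (pairwise_ordList S)

variable (Γ)

/-- The inputs `i₁ ≺ ⋯ ≺ iₘ` of the graph. -/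
noncomputable def ins : List Γ.H := Γ.ordList Γ.inLegs

/-- The outputs `o₁ ≺ ⋯ ≺ oₙ` of the graph. -/
noncomputable def outs : List Γ.H := Γ.ordList Γ.outLegs

variable {Γ}

/-- Every edge is an input edge or is reached from one by a directed path. -/
theorem exists_in_leads (h : Γ.H) :
    ∃ i ∈ Γ.inLegs, Γ.SameEdge i h ∨ Γ.Leads i h := by
  have wf : WellFounded (fun a b : Γ.H => ¬ Γ.le b a) := by
    have : IsTrans Γ.H (fun a b : Γ.H => ¬ Γ.le b a) := ⟨fun a b c p q r =>
      p (Γ.le_trans _ _ _ (le_of_not_le q) r)⟩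
    have : Std.Irrefl (fun a b : Γ.H => ¬ Γ.le b a) := ⟨fun a p => p (le_refl a)⟩
    exact Finite.wellFounded_of_trans_of_irrefl _
  induction h using wf.induction with
  | _ h ih =>
    by_cases c : ∃ b, Γ.SameEdge h b ∧ Γ.sgn b = false ∧ ¬ Γ.Virt b
    · obtain ⟨b, eb, sb, nb⟩ := c
      obtain ⟨a, ba, sa⟩ := Γ.exists_in b
      have st : Γ.Step a h := ⟨a, b, .refl _, eb, sa, sb, Γ.vtx.symm ba⟩
      have ne : ¬ Γ.SameEdge a h := by
        intro e
        have e' := (eb.symm.trans e.symm)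
        have : b ≠ a := by rintro rfl; simp [sa] at sb
        rcases e' with e' | e'
        · exact this e'.symm
        · exact nb ⟨by rw [← e']; exact this.symm, by rw [← e']; exact ba⟩
      obtain ⟨i, hi, r⟩ := ih a (Γ.P1 _ _ (.single st) ne)
      refine ⟨i, hi, Or.inr ?_⟩
      rcases r with r | r
      · exact leads_congr r.symm (.refl _) (.single st)
      · exact r.tail st
    · push Not at c
      rcases sh : Γ.sgn h with _ | _
      · have v := c h (.refl _) sh
        refine ⟨Γ.σ h, ⟨Or.inr v.σ, ?_⟩, Or.inl (Or.inr (Γ.σ_σ h).symm)⟩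
        have := Γ.sgn_σ h v.1
        rw [sh] at this
        simpa using this
      · by_cases e : Γ.σ h = h
        · exact ⟨h, ⟨Or.inl e, sh⟩, Or.inl (.refl _)⟩
        · have := Γ.sgn_σ h e
          rw [sh] at this
          have v := c (Γ.σ h) (Or.inr rfl) (by simpa using this)
          exact ⟨h, ⟨Or.inr (by simpa [Γ.σ_σ] using v.σ), sh⟩, Or.inl (.refl _)⟩

/-- Every edge is an output edge or leads to one by a directed path. -/
theorem exists_out_leads (h : Γ.H) :
    ∃ o ∈ Γ.outLegs, Γ.SameEdge h o ∨ Γ.Leads h o := by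
  have wf : WellFounded (fun a b : Γ.H => ¬ Γ.le a b) := by
    have : IsTrans Γ.H (fun a b : Γ.H => ¬ Γ.le a b) := ⟨fun a b c p q r =>
      p (Γ.le_trans _ _ _ r (le_of_not_le q))⟩
    have : Std.Irrefl (fun a b : Γ.H => ¬ Γ.le a b) := ⟨fun a p => p (le_refl a)⟩
    exact Finite.wellFounded_of_trans_of_irrefl _
  induction h using wf.induction with
  | _ h ih =>
    by_cases c : ∃ b, Γ.SameEdge h b ∧ Γ.sgn b = true ∧ ¬ Γ.Virt b
    · obtain ⟨b, eb, sb, nb⟩ := c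
      obtain ⟨a, ba, sa⟩ := Γ.exists_out b
      have st : Γ.Step h a := ⟨b, a, eb, .refl _, sb, sa, ba⟩
      have ne : ¬ Γ.SameEdge h a := by
        intro e
        have e' := (eb.symm.trans e)
        have : b ≠ a := by rintro rfl; simp [sa] at sb
        rcases e' with e' | e'
        · exact this e'.symm
        · exact nb ⟨by rw [← e']; exact this.symm, by rw [← e']; exact ba⟩
      obtain ⟨o, ho, r⟩ := ih a (Γ.P1 _ _ (.single st) ne)
      refine ⟨o, ho, Or.inr ?_⟩
      rcases r with r | r
      · exact leads_congr (.refl _) r (.single st)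
      · exact r.head st
    · push Not at c
      rcases sh : Γ.sgn h with _ | _
      · by_cases e : Γ.σ h = h
        · exact ⟨h, ⟨Or.inl e, sh⟩, Or.inl (.refl _)⟩
        · have := Γ.sgn_σ h e
          rw [sh] at this
          have v := c (Γ.σ h) (Or.inr rfl) (by simpa using this)
          exact ⟨h, ⟨Or.inr (by simpa [Γ.σ_σ] using v.σ), sh⟩, Or.inl (.refl _)⟩
      · have v := c h (.refl _) sh
        refine ⟨Γ.σ h, ⟨Or.inr v.σ, ?_⟩, Or.inl (Or.inr rfl)⟩
        have := Γ.sgn_σ h v.1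
        rw [sh] at this
        simpa using this

end PlanarGraph

/-! ### Composition of planar graphs -/

namespace Grafting

open PreGraph DirectedGraph PlanarGraph

variable (Γ₁ Γ₂ : PlanarGraph)

/-- `o = oₖ` and `i = iₖ` for some `k`, where `o₁ ≺ ⋯ ≺ oₙ` are the outputs of the first graph
and `i₁ ≺ ⋯ ≺ iₙ` are the inputs of the second graph. -/
def Matched (o : Γ₁.H) (i : Γ₂.H) : Prop := (o, i) ∈ Γ₁.outs.zip Γ₂.ins

/-- The half-edges which survive in the composite. Where the real legs `oₖ` and `iₖ` meet nothing
is removed; a virtual edge grafted to a real leg is removed; two virtual edges grafted to each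
other lose the half-edges `oₖ` and `iₖ`. -/
def Keep : Γ₁.H ⊕ Γ₂.H → Prop
  | .inl h => ¬ ∃ o i, Matched Γ₁ Γ₂ o i ∧ Γ₁.Virt o ∧ (h = o ∨ (h = Γ₁.σ o ∧ ¬ Γ₂.Virt i))
  | .inr h => ¬ ∃ o i, Matched Γ₁ Γ₂ o i ∧ Γ₂.Virt i ∧ (h = i ∨ (h = Γ₂.σ i ∧ ¬ Γ₁.Virt o))

/-- Belonging to the same edge of the composite: the edges of the two graphs, the edges of `oₖ`
and `iₖ` being made into one edge. -/
def EdgeRel : Γ₁.H ⊕ Γ₂.H → Γ₁.H ⊕ Γ₂.H → Prop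
  | .inl h, .inl k => Γ₁.SameEdge h k
  | .inr h, .inr k => Γ₂.SameEdge h k
  | .inl h, .inr k => ∃ o i, Matched Γ₁ Γ₂ o i ∧ Γ₁.SameEdge h o ∧ Γ₂.SameEdge i k
  | .inr k, .inl h => ∃ o i, Matched Γ₁ Γ₂ o i ∧ Γ₁.SameEdge h o ∧ Γ₂.SameEdge i k

/-- Belonging to the same vertex of the composite: the vertices of the two graphs, and for two
virtual edges grafted to each other the new virtual vertex formed by the two other halves. -/
def VtxRel : Γ₁.H ⊕ Γ₂.H → Γ₁.H ⊕ Γ₂.H → Prop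
  | .inl h, .inl k => Γ₁.vtx h k
  | .inr h, .inr k => Γ₂.vtx h k
  | .inl h, .inr k =>
    ∃ o i, Matched Γ₁ Γ₂ o i ∧ Γ₁.Virt o ∧ Γ₂.Virt i ∧ h = Γ₁.σ o ∧ k = Γ₂.σ i
  | .inr k, .inl h =>
    ∃ o i, Matched Γ₁ Γ₂ o i ∧ Γ₁.Virt o ∧ Γ₂.Virt i ∧ h = Γ₁.σ o ∧ k = Γ₂.σ i

/-- The order on the edges of the composite. Let `ēₖ` be the edge made from the edges of `oₖ` and
`iₖ`, let `Qₖ` be the segment of the edges of the first graph strictly between `oₖ₋₁` and `oₖ`, and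
`Pₖ` the segment of the edges of the second graph strictly between `iₖ` and `iₖ₊₁`. The order is
the shuffle `Q₁ ē₁ P₁ Q₂ ē₂ P₂ ⋯ Qₙ ēₙ Pₙ`: inside each of the two graphs it is the given order, and
`e ∈ Qₐ` precedes `e' ∈ P_b` if and only if `a ≤ b`. -/
def Le : Γ₁.H ⊕ Γ₂.H → Γ₁.H ⊕ Γ₂.H → Prop
  | .inl h, .inl k => Γ₁.le h k
  | .inr h, .inr k => Γ₂.le h k
  | .inl h, .inr k => ∃ o i, Matched Γ₁ Γ₂ o i ∧ Γ₁.le h o ∧ Γ₂.le i k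
  | .inr k, .inl h => ∀ o i, Matched Γ₁ Γ₂ o i →
      (Γ₂.le i k → Γ₁.le o h) ∧ (Γ₁.le h o → Γ₂.le k i)

/-- The orientation of the composite. -/
def Sgn : Γ₁.H ⊕ Γ₂.H → Bool
  | .inl h => Γ₁.sgn h
  | .inr h => Γ₂.sgn h

variable {Γ₁ Γ₂}

theorem Matched.out {o : Γ₁.H} {i : Γ₂.H} (m : Matched Γ₁ Γ₂ o i) : o ∈ Γ₁.outLegs :=
  mem_ordList.1 (List.of_mem_zip m).1

theorem Matched.inp {o : Γ₁.H} {i : Γ₂.H} (m : Matched Γ₁ Γ₂ o i) : i ∈ Γ₂.inLegs :=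
  mem_ordList.1 (List.of_mem_zip m).2

theorem le_getElem {Γ : PlanarGraph} {S : Set Γ.H} {b : Bool} (hS : ∀ h ∈ S, Γ.sgn h = b)
    {j k : ℕ} (hj : j < (Γ.ordList S).length) (hk : k < (Γ.ordList S).length) :
    Γ.le (Γ.ordList S)[j] (Γ.ordList S)[k] ↔ j ≤ k := by
  have pw := pairwise_ordList (Γ := Γ) S
  have nd := nodup_ordList (Γ := Γ) S
  have mono : ∀ {j k : ℕ} (hj : j < (Γ.ordList S).length) (hk : k < (Γ.ordList S).length),
      j ≤ k → Γ.le (Γ.ordList S)[j] (Γ.ordList S)[k] := by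
    intro j k hj hk h
    rcases h.lt_or_eq with h | rfl
    · exact le_of_leH (List.pairwise_iff_getElem.1 pw j k hj hk h)
    · exact le_refl _
  refine ⟨fun h => ?_, mono hj hk⟩
  by_contra c
  have h' := mono hk hj (by omega)
  have e := (Γ.le_antisymm_iff _ _).1 ⟨h, h'⟩
  have := eq_of_sameEdge e (by
    rw [hS _ (mem_ordList.1 (List.getElem_mem hj)), hS _ (mem_ordList.1 (List.getElem_mem hk))])
  have := (List.Nodup.getElem_inj_iff nd).1 this
  omega

theorem Matched.exists_getElem {o : Γ₁.H} {i : Γ₂.H} (m : Matched Γ₁ Γ₂ o i) :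
    ∃ (k : ℕ) (h₁ : k < Γ₁.outs.length) (h₂ : k < Γ₂.ins.length),
      Γ₁.outs[k] = o ∧ Γ₂.ins[k] = i := by
  obtain ⟨k, hk, e⟩ := List.mem_iff_getElem.1 m
  have hk' : k < Γ₁.outs.length ∧ k < Γ₂.ins.length := by simpa using hk
  rw [List.getElem_zip] at e
  exact ⟨k, hk'.1, hk'.2, congrArg Prod.fst e, congrArg Prod.snd e⟩

theorem Matched.le_iff {o o' : Γ₁.H} {i i' : Γ₂.H} (m : Matched Γ₁ Γ₂ o i)
    (m' : Matched Γ₁ Γ₂ o' i') : Γ₁.le o o' ↔ Γ₂.le i i' := by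
  obtain ⟨k, h₁, h₂, rfl, rfl⟩ := m.exists_getElem
  obtain ⟨k', h₁', h₂', rfl, rfl⟩ := m'.exists_getElem
  exact (le_getElem (fun h (p : h ∈ Γ₁.outLegs) => p.2) h₁ h₁').trans
    (le_getElem (fun h (p : h ∈ Γ₂.inLegs) => p.2) h₂ h₂').symm

theorem Matched.sameEdge_iff {o o' : Γ₁.H} {i i' : Γ₂.H} (m : Matched Γ₁ Γ₂ o i)
    (m' : Matched Γ₁ Γ₂ o' i') : Γ₁.SameEdge o o' ↔ Γ₂.SameEdge i i' := by
  rw [← Γ₁.le_antisymm_iff, ← Γ₂.le_antisymm_iff, m.le_iff m', m'.le_iff m]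

theorem Matched.eq_iff {o o' : Γ₁.H} {i i' : Γ₂.H} (m : Matched Γ₁ Γ₂ o i)
    (m' : Matched Γ₁ Γ₂ o' i') : o = o' ↔ i = i' := by
  constructor
  · rintro rfl
    exact eq_of_sameEdge ((m.sameEdge_iff m').1 (.refl _)) (m.inp.2.trans m'.inp.2.symm)
  · rintro rfl
    exact eq_of_sameEdge ((m.sameEdge_iff m').2 (.refl _)) (m.out.2.trans m'.out.2.symm)

theorem exists_matched_out (hl : Γ₁.outs.length = Γ₂.ins.length) {o : Γ₁.H} (ho : o ∈ Γ₁.outLegs) : ∃ i, Matched Γ₁ Γ₂ o i := by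
  obtain ⟨k, hk, rfl⟩ := List.mem_iff_getElem.1 (mem_ordList.2 ho)
  have hk' : k < Γ₁.outs.length := hk
  exact ⟨Γ₂.ins[k], List.mem_iff_getElem.2 ⟨k, by simp; omega, by rw [List.getElem_zip]; rfl⟩⟩

theorem exists_matched_in (hl : Γ₁.outs.length = Γ₂.ins.length) {i : Γ₂.H} (hi : i ∈ Γ₂.inLegs) : ∃ o, Matched Γ₁ Γ₂ o i := by
  obtain ⟨k, hk, rfl⟩ := List.mem_iff_getElem.1 (mem_ordList.2 hi)
  have hk' : k < Γ₂.ins.length := hk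
  exact ⟨Γ₁.outs[k], List.mem_iff_getElem.2 ⟨k, by simp; omega, by rw [List.getElem_zip]; rfl⟩⟩

theorem keep_virt_inl (hl : Γ₁.outs.length = Γ₂.ins.length) {h : Γ₁.H} (p : Keep Γ₁ Γ₂ (.inl h)) (v : Γ₁.Virt h) :
    ∃ o i, Matched Γ₁ Γ₂ o i ∧ Γ₁.Virt o ∧ Γ₂.Virt i ∧ h = Γ₁.σ o := by
  rcases sh : Γ₁.sgn h with _ | _
  · obtain ⟨i, m⟩ := exists_matched_out hl (o := h) ⟨Or.inr v, sh⟩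
    exact absurd ⟨h, i, m, v, Or.inl rfl⟩ p
  · have := Γ₁.sgn_σ h v.1
    rw [sh] at this
    obtain ⟨i, m⟩ := exists_matched_out hl (o := Γ₁.σ h) ⟨Or.inr v.σ, by simpa using this⟩
    by_cases vi : Γ₂.Virt i
    · exact ⟨_, i, m, v.σ, vi, (Γ₁.σ_σ h).symm⟩
    · exact absurd ⟨_, i, m, v.σ, Or.inr ⟨(Γ₁.σ_σ h).symm, vi⟩⟩ p

theorem keep_virt_inr (hl : Γ₁.outs.length = Γ₂.ins.length) {h : Γ₂.H} (p : Keep Γ₁ Γ₂ (.inr h)) (v : Γ₂.Virt h) :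
    ∃ o i, Matched Γ₁ Γ₂ o i ∧ Γ₁.Virt o ∧ Γ₂.Virt i ∧ h = Γ₂.σ i := by
  rcases sh : Γ₂.sgn h with _ | _
  · have := Γ₂.sgn_σ h v.1
    rw [sh] at this
    obtain ⟨o, m⟩ := exists_matched_in hl (i := Γ₂.σ h) ⟨Or.inr v.σ, by simpa using this⟩
    by_cases vo : Γ₁.Virt o
    · exact ⟨o, _, m, vo, v.σ, (Γ₂.σ_σ h).symm⟩
    · exact absurd ⟨o, _, m, v.σ, Or.inr ⟨(Γ₂.σ_σ h).symm, vo⟩⟩ p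
  · obtain ⟨o, m⟩ := exists_matched_in hl (i := h) ⟨Or.inr v, sh⟩
    exact absurd ⟨o, h, m, v, Or.inl rfl⟩ p

theorem sgn_flip {Γ : DirectedGraph} {h : Γ.H} (v : Γ.Virt h) {b : Bool} (s : Γ.sgn h = b) :
    Γ.sgn (Γ.σ h) = !b := by
  have := Γ.sgn_σ h v.1
  rw [s] at this
  cases b <;> simpa using this

theorem keep_inl_of_not_virt {h : Γ₁.H} (p : ¬ Γ₁.Virt h) : Keep Γ₁ Γ₂ (.inl h) := by
  rintro ⟨o, i, -, v, rfl | ⟨rfl, -⟩⟩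
  exacts [p v, p v.σ]

theorem keep_inr_of_not_virt {h : Γ₂.H} (p : ¬ Γ₂.Virt h) : Keep Γ₁ Γ₂ (.inr h) := by
  rintro ⟨o, i, -, v, rfl | ⟨rfl, -⟩⟩
  exacts [p v, p v.σ]

theorem keep_inl_of_virt {o : Γ₁.H} {i : Γ₂.H} (m : Matched Γ₁ Γ₂ o i) (vo : Γ₁.Virt o)
    (vi : Γ₂.Virt i) : Keep Γ₁ Γ₂ (.inl (Γ₁.σ o)) := by
  rintro ⟨o', i', m', v, e | ⟨e, n⟩⟩
  · have := sgn_flip vo m.out.2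
    rw [e, m'.out.2] at this
    simp at this
  · have : o = o' := by rw [← Γ₁.σ_σ o, e, Γ₁.σ_σ]
    exact n ((m.eq_iff m').1 this ▸ vi)

theorem keep_inr_of_virt {o : Γ₁.H} {i : Γ₂.H} (m : Matched Γ₁ Γ₂ o i) (vo : Γ₁.Virt o)
    (vi : Γ₂.Virt i) : Keep Γ₁ Γ₂ (.inr (Γ₂.σ i)) := by
  rintro ⟨o', i', m', v, e | ⟨e, n⟩⟩
  · have := sgn_flip vi m.inp.2
    rw [e, m'.inp.2] at this
    simp at this
  · have : i = i' := by rw [← Γ₂.σ_σ i, e, Γ₂.σ_σ]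
    exact n ((m.eq_iff m').2 this ▸ vo)

/-! #### The order -/

theorem Le.total (x y : Γ₁.H ⊕ Γ₂.H) : Le Γ₁ Γ₂ x y ∨ Le Γ₁ Γ₂ y x := by
  have key : ∀ h k, Le Γ₁ Γ₂ (.inl h) (.inr k) ∨ Le Γ₁ Γ₂ (.inr k) (.inl h) := by
    intro h k
    by_cases c : ∃ o i, Matched Γ₁ Γ₂ o i ∧ Γ₁.le h o ∧ Γ₂.le i k
    · exact Or.inl c
    · refine Or.inr fun o i m => ⟨fun p => ?_, fun p => ?_⟩
      · exact le_of_not_le fun q => c ⟨o, i, m, q, p⟩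
      · exact le_of_not_le fun q => c ⟨o, i, m, p, q⟩
  rcases x with h | h <;> rcases y with k | k
  exacts [Γ₁.le_total h k, key h k, (key k h).symm, Γ₂.le_total h k]

theorem Le.trans {x y z : Γ₁.H ⊕ Γ₂.H} (p : Le Γ₁ Γ₂ x y) (q : Le Γ₁ Γ₂ y z) :
    Le Γ₁ Γ₂ x z := by
  rcases x with h | h <;> rcases y with k | k <;> rcases z with l | l
  · exact Γ₁.le_trans _ _ _ p q
  · obtain ⟨o, i, m, a, b⟩ := q
    exact ⟨o, i, m, Γ₁.le_trans _ _ _ p a, b⟩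
  · obtain ⟨o, i, m, a, b⟩ := p
    exact Γ₁.le_trans _ _ _ a ((q o i m).1 b)
  · obtain ⟨o, i, m, a, b⟩ := p
    exact ⟨o, i, m, a, Γ₂.le_trans _ _ _ b q⟩
  · intro o i m
    exact ⟨fun r => Γ₁.le_trans _ _ _ ((p o i m).1 r) q,
      fun r => (p o i m).2 (Γ₁.le_trans _ _ _ q r)⟩
  · obtain ⟨o, i, m, a, b⟩ := q
    exact Γ₂.le_trans _ _ _ ((p o i m).2 a) b
  · intro o i m
    exact ⟨fun r => (q o i m).1 (Γ₂.le_trans _ _ _ r p),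
      fun r => Γ₂.le_trans _ _ _ p ((q o i m).2 r)⟩
  · exact Γ₂.le_trans _ _ _ p q

theorem Le.antisymm_iff (x y : Γ₁.H ⊕ Γ₂.H) :
    (Le Γ₁ Γ₂ x y ∧ Le Γ₁ Γ₂ y x) ↔ EdgeRel Γ₁ Γ₂ x y := by
  have key : ∀ h k, (Le Γ₁ Γ₂ (.inl h) (.inr k) ∧ Le Γ₁ Γ₂ (.inr k) (.inl h)) ↔
      ∃ o i, Matched Γ₁ Γ₂ o i ∧ Γ₁.SameEdge h o ∧ Γ₂.SameEdge i k := by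
    intro h k
    constructor
    · rintro ⟨⟨o, i, m, a, b⟩, q⟩
      exact ⟨o, i, m, (Γ₁.le_antisymm_iff _ _).1 ⟨a, (q o i m).1 b⟩,
        (Γ₂.le_antisymm_iff _ _).1 ⟨b, (q o i m).2 a⟩⟩
    · rintro ⟨o, i, m, a, b⟩
      refine ⟨⟨o, i, m, le_of_sameEdge a, le_of_sameEdge b⟩, fun o' i' m' => ⟨fun r => ?_,
        fun r => ?_⟩⟩
      · have := (m'.le_iff m).2 (Γ₂.le_trans _ _ _ r (le_of_sameEdge b.symm))
        exact Γ₁.le_trans _ _ _ this (le_of_sameEdge a.symm)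
      · have := (m.le_iff m').1 (Γ₁.le_trans _ _ _ (le_of_sameEdge a.symm) r)
        exact Γ₂.le_trans _ _ _ (le_of_sameEdge b.symm) this
  rcases x with h | h <;> rcases y with k | k
  · exact Γ₁.le_antisymm_iff h k
  · exact key h k
  · rw [and_comm]; exact key k h
  · exact Γ₂.le_antisymm_iff h k

theorem EdgeRel.refl (x : Γ₁.H ⊕ Γ₂.H) : EdgeRel Γ₁ Γ₂ x x := by
  rcases x with h | h <;> exact SameEdge.refl h

theorem EdgeRel.symm {x y : Γ₁.H ⊕ Γ₂.H} (e : EdgeRel Γ₁ Γ₂ x y) : EdgeRel Γ₁ Γ₂ y x :=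
  (Le.antisymm_iff _ _).1 ((Le.antisymm_iff _ _).2 e).symm

theorem EdgeRel.trans {x y z : Γ₁.H ⊕ Γ₂.H} (e : EdgeRel Γ₁ Γ₂ x y) (f : EdgeRel Γ₁ Γ₂ y z) :
    EdgeRel Γ₁ Γ₂ x z := by
  rw [← Le.antisymm_iff] at *
  exact ⟨e.1.trans f.1, f.2.trans e.2⟩

/-! #### The half-edges of an edge -/

theorem EdgeRel.eq_of_sgn {x y : Γ₁.H ⊕ Γ₂.H} (kx : Keep Γ₁ Γ₂ x) (ky : Keep Γ₁ Γ₂ y)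
    (e : EdgeRel Γ₁ Γ₂ x y) (s : Sgn Γ₁ Γ₂ x = Sgn Γ₁ Γ₂ y) : x = y := by
  have key : ∀ h k, Keep Γ₁ Γ₂ (.inl h) → Keep Γ₁ Γ₂ (.inr k) →
      EdgeRel Γ₁ Γ₂ (.inl h) (.inr k) → Γ₁.sgn h = Γ₂.sgn k → False := by
    rintro h k kh kk ⟨o, i, m, a, b⟩ s
    by_cases vo : Γ₁.Virt o
    · by_cases vi : Γ₂.Virt i
      · rcases a.symm with rfl | rfl
        · exact kh ⟨_, i, m, vo, Or.inl rfl⟩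
        · rcases b with rfl | rfl
          · exact kk ⟨o, _, m, vi, Or.inl rfl⟩
          · rw [sgn_flip vo m.out.2, sgn_flip vi m.inp.2] at s
            simp at s
      · rcases a.symm with rfl | rfl
        · exact kh ⟨_, i, m, vo, Or.inl rfl⟩
        · exact kh ⟨_, i, m, vo, Or.inr ⟨rfl, vi⟩⟩
    · have ho : Γ₁.σ o = o := m.out.1.resolve_right vo
      have : h = o := by
        rcases a.symm with a | a
        · exact a
        · rw [a, ho]
      subst this
      by_cases vi : Γ₂.Virt i
      · rcases b with rfl | rfl
        · exact kk ⟨h, _, m, vi, Or.inl rfl⟩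
        · exact kk ⟨h, i, m, vi, Or.inr ⟨rfl, vo⟩⟩
      · have hi : Γ₂.σ i = i := m.inp.1.resolve_right vi
        have : k = i := by
          rcases b with b | b
          · exact b
          · rw [b, hi]
        subst this
        rw [m.out.2, m.inp.2] at s
        simp at s
  rcases x with h | h <;> rcases y with k | k
  · rw [eq_of_sameEdge (Γ := Γ₁.toDirectedGraph) e s]
  · exact (key h k kx ky e s).elim
  · exact (key k h ky kx e.symm s.symm).elim
  · rw [eq_of_sameEdge (Γ := Γ₂.toDirectedGraph) e s]

variable (Γ₁ Γ₂) in
/-- The half-edges of the composite. -/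
abbrev Half : Type := {x : Γ₁.H ⊕ Γ₂.H // Keep Γ₁ Γ₂ x}

open Classical in
variable (Γ₁ Γ₂) in
/-- The involution of the composite: it exchanges the two half-edges of every two-element edge. -/
noncomputable def invol (x : Half Γ₁ Γ₂) : Half Γ₁ Γ₂ :=
  if h : ∃ y : Half Γ₁ Γ₂, y ≠ x ∧ EdgeRel Γ₁ Γ₂ x.1 y.1 then h.choose else x

theorem half_eq {x y : Half Γ₁ Γ₂} (e : EdgeRel Γ₁ Γ₂ x.1 y.1)
    (s : Sgn Γ₁ Γ₂ x.1 = Sgn Γ₁ Γ₂ y.1) : x = y :=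
  Subtype.ext (e.eq_of_sgn x.2 y.2 s)

theorem edgeRel_invol (x : Half Γ₁ Γ₂) : EdgeRel Γ₁ Γ₂ x.1 (invol Γ₁ Γ₂ x).1 := by
  unfold invol
  split_ifs with h
  · exact h.choose_spec.2
  · exact EdgeRel.refl _

theorem sameEdge_iff (x y : Half Γ₁ Γ₂) :
    (y = x ∨ y = invol Γ₁ Γ₂ x) ↔ EdgeRel Γ₁ Γ₂ x.1 y.1 := by
  constructor
  · rintro (rfl | rfl)
    exacts [.refl _, edgeRel_invol x]
  · intro e
    by_cases h : y = x
    · exact Or.inl h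
    · right
      have hy : ∃ y : Half Γ₁ Γ₂, y ≠ x ∧ EdgeRel Γ₁ Γ₂ x.1 y.1 := ⟨y, h, e⟩
      have hx : invol Γ₁ Γ₂ x = hy.choose := by rw [invol, dif_pos hy]
      have h1 := hy.choose_spec
      rw [← hx] at h1
      have s1 : Sgn Γ₁ Γ₂ x.1 ≠ Sgn Γ₁ Γ₂ y.1 := fun s => h (half_eq e s).symm
      have s2 : Sgn Γ₁ Γ₂ x.1 ≠ Sgn Γ₁ Γ₂ (invol Γ₁ Γ₂ x).1 := fun s => h1.1 (half_eq h1.2 s).symm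
      refine half_eq (e.symm.trans h1.2) ?_
      revert s1 s2
      cases Sgn Γ₁ Γ₂ x.1 <;> cases Sgn Γ₁ Γ₂ y.1 <;> cases Sgn Γ₁ Γ₂ (invol Γ₁ Γ₂ x).1 <;> simp

theorem invol_invol (x : Half Γ₁ Γ₂) : invol Γ₁ Γ₂ (invol Γ₁ Γ₂ x) = x := by
  have e := (edgeRel_invol x).symm
  rcases (sameEdge_iff _ _).2 e with h | h
  · rw [← h, ← h]
  · exact h.symm

theorem sgn_invol (x : Half Γ₁ Γ₂) (h : invol Γ₁ Γ₂ x ≠ x) :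
    Sgn Γ₁ Γ₂ (invol Γ₁ Γ₂ x).1 ≠ Sgn Γ₁ Γ₂ x.1 :=
  fun s => h (half_eq (edgeRel_invol x).symm s)

/-! #### The vertices -/

theorem eq_of_virt_inl (hl : Γ₁.outs.length = Γ₂.ins.length) {h k : Γ₁.H}
    (kh : Keep Γ₁ Γ₂ (.inl h)) (kk : Keep Γ₁ Γ₂ (.inl k)) (v : Γ₁.Virt h)
    (e : Γ₁.SameEdge h k) : h = k := by
  obtain ⟨o, i, m, vo, vi, rfl⟩ := keep_virt_inl hl kh v
  rcases e with rfl | rfl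
  · rfl
  · rw [Γ₁.σ_σ] at kk
    exact absurd ⟨o, i, m, vo, Or.inl rfl⟩ kk

theorem eq_of_virt_inr (hl : Γ₁.outs.length = Γ₂.ins.length) {h k : Γ₂.H}
    (kh : Keep Γ₁ Γ₂ (.inr h)) (kk : Keep Γ₁ Γ₂ (.inr k)) (v : Γ₂.Virt h)
    (e : Γ₂.SameEdge h k) : h = k := by
  obtain ⟨o, i, m, vo, vi, rfl⟩ := keep_virt_inr hl kh v
  rcases e with rfl | rfl
  · rfl
  · rw [Γ₂.σ_σ] at kk
    exact absurd ⟨o, i, m, vi, Or.inl rfl⟩ kk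

theorem VtxRel.symm {x y : Γ₁.H ⊕ Γ₂.H} (e : VtxRel Γ₁ Γ₂ x y) : VtxRel Γ₁ Γ₂ y x := by
  rcases x with h | h <;> rcases y with k | k
  exacts [Γ₁.vtx.symm e, e, e, Γ₂.vtx.symm e]

theorem VtxRel.trans (hl : Γ₁.outs.length = Γ₂.ins.length) {x y z : Γ₁.H ⊕ Γ₂.H}
    (kx : Keep Γ₁ Γ₂ x) (ky : Keep Γ₁ Γ₂ y) (kz : Keep Γ₁ Γ₂ z)
    (e : VtxRel Γ₁ Γ₂ x y) (f : VtxRel Γ₁ Γ₂ y z) : VtxRel Γ₁ Γ₂ x z := by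
  rcases x with h | h <;> rcases y with k | k <;> rcases z with l | l
  · exact Γ₁.vtx.trans e f
  · obtain ⟨o, i, m, vo, vi, rfl, rfl⟩ := f
    have := eq_of_virt_inl hl ky kx vo.σ (Γ₁.virt_deg _ _ vo.σ (Γ₁.vtx.symm e))
    subst this
    exact ⟨o, i, m, vo, vi, rfl, rfl⟩
  · obtain ⟨o, i, m, vo, vi, rfl, rfl⟩ := e
    obtain ⟨o', i', m', vo', vi', rfl, e'⟩ := f
    have : i = i' := by rw [← Γ₂.σ_σ i, e', Γ₂.σ_σ]
    rw [(m.eq_iff m').2 this]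
    exact Γ₁.vtx.refl _
  · obtain ⟨o, i, m, vo, vi, rfl, rfl⟩ := e
    have := eq_of_virt_inr hl ky kz vi.σ (Γ₂.virt_deg _ _ vi.σ f)
    subst this
    exact ⟨o, i, m, vo, vi, rfl, rfl⟩
  · obtain ⟨o, i, m, vo, vi, rfl, rfl⟩ := e
    have := eq_of_virt_inl hl ky kz vo.σ (Γ₁.virt_deg _ _ vo.σ f)
    subst this
    exact ⟨o, i, m, vo, vi, rfl, rfl⟩
  · obtain ⟨o, i, m, vo, vi, rfl, rfl⟩ := e
    obtain ⟨o', i', m', vo', vi', e', rfl⟩ := f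
    have : o = o' := by rw [← Γ₁.σ_σ o, e', Γ₁.σ_σ]
    rw [(m.eq_iff m').1 this]
    exact Γ₂.vtx.refl _
  · obtain ⟨o, i, m, vo, vi, rfl, rfl⟩ := f
    have := eq_of_virt_inr hl ky kx vi.σ (Γ₂.virt_deg _ _ vi.σ (Γ₂.vtx.symm e))
    subst this
    exact ⟨o, i, m, vo, vi, rfl, rfl⟩
  · exact Γ₂.vtx.trans e f

/-- The composite as a directed graph. -/
noncomputable def compDirected (hl : Γ₁.outs.length = Γ₂.ins.length) : DirectedGraph where
  H := Half Γ₁ Γ₂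
  finite := inferInstance
  vtx :=
    { r := fun x y => VtxRel Γ₁ Γ₂ x.1 y.1
      iseqv := ⟨fun x => by
          rcases x with ⟨h | h, _⟩
          exacts [Γ₁.vtx.refl h, Γ₂.vtx.refl h],
        fun e => e.symm, fun {x y z} e f => e.trans hl x.2 y.2 z.2 f⟩ }
  σ := invol Γ₁ Γ₂
  σ_σ := invol_invol
  virt_deg := by
    rintro x y ⟨v, w⟩ e
    refine (sameEdge_iff x y).2 ?_
    have E := edgeRel_invol x
    change invol Γ₁ Γ₂ x ≠ x at v
    change VtxRel Γ₁ Γ₂ x.1 (invol Γ₁ Γ₂ x).1 at w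
    generalize invol Γ₁ Γ₂ x = z at v w E
    change VtxRel Γ₁ Γ₂ x.1 y.1 at e
    obtain ⟨x | x, kx⟩ := x <;> obtain ⟨y | y, ky⟩ := y
    · by_cases vx : Γ₁.Virt x
      · exact Γ₁.virt_deg _ _ vx e
      · obtain ⟨z | z, kz⟩ := z
        · rcases E with rfl | rfl
          · exact absurd rfl v
          · exact absurd ⟨fun h => v (Subtype.ext (congrArg Sum.inl h)), w⟩ vx
        · obtain ⟨o, i, m, vo, vi, rfl, rfl⟩ := w
          exact absurd vo.σ vx
    · obtain ⟨o, i, m, vo, vi, rfl, rfl⟩ := e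
      exact ⟨o, i, m, (SameEdge.symm (Or.inr rfl)), Or.inr rfl⟩
    · obtain ⟨o, i, m, vo, vi, rfl, rfl⟩ := e
      exact ⟨o, i, m, (SameEdge.symm (Or.inr rfl)), Or.inr rfl⟩
    · by_cases vx : Γ₂.Virt x
      · exact Γ₂.virt_deg _ _ vx e
      · obtain ⟨z | z, kz⟩ := z
        · obtain ⟨o, i, m, vo, vi, rfl, rfl⟩ := w
          exact absurd vi.σ vx
        · rcases E with rfl | rfl
          · exact absurd rfl v
          · exact absurd ⟨fun h => v (Subtype.ext (congrArg Sum.inr h)), w⟩ vx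
  sgn := fun x => Sgn Γ₁ Γ₂ x.1
  sgn_σ := sgn_invol
  exists_in := by
    rintro ⟨x | x, kx⟩
    · by_cases v : Γ₁.Virt x
      · obtain ⟨o, i, m, vo, vi, rfl⟩ := keep_virt_inl hl kx v
        exact ⟨⟨_, kx⟩, Γ₁.vtx.refl _, sgn_flip vo m.out.2⟩
      · obtain ⟨k, e, s⟩ := Γ₁.exists_in x
        exact ⟨⟨.inl k, keep_inl_of_not_virt (not_virt_of_vtx e v)⟩, e, s⟩
    · by_cases v : Γ₂.Virt x
      · obtain ⟨o, i, m, vo, vi, rfl⟩ := keep_virt_inr hl kx v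
        exact ⟨⟨.inl (Γ₁.σ o), keep_inl_of_virt m vo vi⟩, ⟨o, i, m, vo, vi, rfl, rfl⟩,
          sgn_flip vo m.out.2⟩
      · obtain ⟨k, e, s⟩ := Γ₂.exists_in x
        exact ⟨⟨.inr k, keep_inr_of_not_virt (not_virt_of_vtx e v)⟩, e, s⟩
  exists_out := by
    rintro ⟨x | x, kx⟩
    · by_cases v : Γ₁.Virt x
      · obtain ⟨o, i, m, vo, vi, rfl⟩ := keep_virt_inl hl kx v
        exact ⟨⟨.inr (Γ₂.σ i), keep_inr_of_virt m vo vi⟩, ⟨o, i, m, vo, vi, rfl, rfl⟩,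
          sgn_flip vi m.inp.2⟩
      · obtain ⟨k, e, s⟩ := Γ₁.exists_out x
        exact ⟨⟨.inl k, keep_inl_of_not_virt (not_virt_of_vtx e v)⟩, e, s⟩
    · by_cases v : Γ₂.Virt x
      · obtain ⟨o, i, m, vo, vi, rfl⟩ := keep_virt_inr hl kx v
        exact ⟨⟨_, kx⟩, Γ₂.vtx.refl _, sgn_flip vi m.inp.2⟩
      · obtain ⟨k, e, s⟩ := Γ₂.exists_out x
        exact ⟨⟨.inr k, keep_inr_of_not_virt (not_virt_of_vtx e v)⟩, e, s⟩


section

variable (hl : Γ₁.outs.length = Γ₂.ins.length)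

theorem comp_sameEdge (x y : Half Γ₁ Γ₂) :
    (compDirected hl).SameEdge x y ↔ EdgeRel Γ₁ Γ₂ x.1 y.1 := sameEdge_iff x y

theorem comp_inl {h k : Γ₁.H} {kh : Keep Γ₁ Γ₂ (.inl h)} {kk : Keep Γ₁ Γ₂ (.inl k)}
    (e : Γ₁.SameEdge h k) : (compDirected hl).SameEdge ⟨.inl h, kh⟩ ⟨.inl k, kk⟩ :=
  (comp_sameEdge hl ⟨.inl h, kh⟩ ⟨.inl k, kk⟩).2 e

theorem comp_inr {h k : Γ₂.H} {kh : Keep Γ₁ Γ₂ (.inr h)} {kk : Keep Γ₁ Γ₂ (.inr k)}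
    (e : Γ₂.SameEdge h k) : (compDirected hl).SameEdge ⟨.inr h, kh⟩ ⟨.inr k, kk⟩ :=
  (comp_sameEdge hl ⟨.inr h, kh⟩ ⟨.inr k, kk⟩).2 e

theorem comp_inl_inr {h o : Γ₁.H} {i k : Γ₂.H} {kh : Keep Γ₁ Γ₂ (.inl h)}
    {kk : Keep Γ₁ Γ₂ (.inr k)} (m : Matched Γ₁ Γ₂ o i) (e : Γ₁.SameEdge h o)
    (f : Γ₂.SameEdge i k) : (compDirected hl).SameEdge ⟨.inl h, kh⟩ ⟨.inr k, kk⟩ :=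
  (comp_sameEdge hl ⟨.inl h, kh⟩ ⟨.inr k, kk⟩).2 ⟨o, i, m, e, f⟩

/-- A half-edge of the composite belongs to a virtual edge if and only if it did so before. -/
theorem comp_virt_inl (h : Γ₁.H) (kh : Keep Γ₁ Γ₂ (.inl h)) :
    (compDirected hl).Virt ⟨.inl h, kh⟩ ↔ Γ₁.Virt h := by
  constructor
  · rintro ⟨v, w⟩
    have E := edgeRel_invol (⟨.inl h, kh⟩ : Half Γ₁ Γ₂)
    change invol Γ₁ Γ₂ _ ≠ _ at v
    change VtxRel Γ₁ Γ₂ (.inl h) (invol Γ₁ Γ₂ _).1 at w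
    generalize invol Γ₁ Γ₂ _ = z at v w E
    obtain ⟨z | z, kz⟩ := z
    · rcases E with rfl | rfl
      · exact absurd rfl v
      · exact ⟨fun h => v (Subtype.ext (congrArg Sum.inl h)), w⟩
    · obtain ⟨o, i, m, vo, vi, rfl, rfl⟩ := w
      exact vo.σ
  · intro v
    obtain ⟨o, i, m, vo, vi, rfl⟩ := keep_virt_inl hl kh v
    have e : EdgeRel Γ₁ Γ₂ (.inl (Γ₁.σ o)) (.inr (Γ₂.σ i)) :=
      ⟨o, i, m, SameEdge.symm (Or.inr rfl), Or.inr rfl⟩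
    have e' := ((sameEdge_iff ⟨_, kh⟩ ⟨_, keep_inr_of_virt m vo vi⟩).2 e).resolve_left
      (fun h => by simp at h)
    refine ⟨?_, ?_⟩
    · change invol Γ₁ Γ₂ _ ≠ _
      rw [← e']
      intro h
      simp at h
    · change VtxRel Γ₁ Γ₂ _ (invol Γ₁ Γ₂ _).1
      rw [← e']
      exact ⟨o, i, m, vo, vi, rfl, rfl⟩

theorem comp_virt_inr (h : Γ₂.H) (kh : Keep Γ₁ Γ₂ (.inr h)) :
    (compDirected hl).Virt ⟨.inr h, kh⟩ ↔ Γ₂.Virt h := by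
  constructor
  · rintro ⟨v, w⟩
    have E := edgeRel_invol (⟨.inr h, kh⟩ : Half Γ₁ Γ₂)
    change invol Γ₁ Γ₂ _ ≠ _ at v
    change VtxRel Γ₁ Γ₂ (.inr h) (invol Γ₁ Γ₂ _).1 at w
    generalize invol Γ₁ Γ₂ _ = z at v w E
    obtain ⟨z | z, kz⟩ := z
    · obtain ⟨o, i, m, vo, vi, rfl, rfl⟩ := w
      exact vi.σ
    · rcases E with rfl | rfl
      · exact absurd rfl v
      · exact ⟨fun h => v (Subtype.ext (congrArg Sum.inr h)), w⟩
  · intro v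
    obtain ⟨o, i, m, vo, vi, rfl⟩ := keep_virt_inr hl kh v
    have e : EdgeRel Γ₁ Γ₂ (.inr (Γ₂.σ i)) (.inl (Γ₁.σ o)) :=
      ⟨o, i, m, SameEdge.symm (Or.inr rfl), Or.inr rfl⟩
    have e' := ((sameEdge_iff ⟨_, kh⟩ ⟨_, keep_inl_of_virt m vo vi⟩).2 e).resolve_left
      (fun h => by simp at h)
    refine ⟨?_, ?_⟩
    · change invol Γ₁ Γ₂ _ ≠ _
      rw [← e']
      intro h
      simp at h
    · change VtxRel Γ₁ Γ₂ _ (invol Γ₁ Γ₂ _).1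
      rw [← e']
      exact ⟨o, i, m, vo, vi, rfl, rfl⟩

/-- Directed paths of the first graph between distinct edges are paths of the composite. -/
theorem leads_inl {h k : Γ₁.H} (s : Γ₁.Leads h k) (ne : ¬ Γ₁.SameEdge h k) :
    ∃ a b, ∃ (va : ¬ Γ₁.Virt a) (vb : ¬ Γ₁.Virt b), Γ₁.SameEdge h a ∧ Γ₁.SameEdge k b ∧
      (compDirected hl).Leads ⟨.inl a, keep_inl_of_not_virt va⟩
        ⟨.inl b, keep_inl_of_not_virt vb⟩ := by
  have one : ∀ {h k}, Γ₁.Step h k → ¬ Γ₁.SameEdge h k →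
      ∃ a b, ∃ (va : ¬ Γ₁.Virt a) (vb : ¬ Γ₁.Virt b), Γ₁.SameEdge h a ∧ Γ₁.SameEdge k b ∧
      (compDirected hl).Step ⟨.inl a, keep_inl_of_not_virt va⟩
        ⟨.inl b, keep_inl_of_not_virt vb⟩ := by
    intro h k s ne
    obtain ⟨a, b, ea, eb, sa, sb, ab, va, vb⟩ := step_real s ne
    exact ⟨a, b, va, vb, ea, eb, _, _, .refl _, .refl _, sa, sb, ab⟩
  induction s with
  | single s =>
    obtain ⟨a, b, va, vb, ea, eb, r⟩ := one s ne
    exact ⟨a, b, va, vb, ea, eb, .single r⟩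
  | @tail m k s t ih =>
    by_cases c : Γ₁.SameEdge m k
    · obtain ⟨a, b, va, vb, ea, eb, r⟩ := ih fun d => ne (d.trans c)
      exact ⟨a, b, va, vb, ea, c.symm.trans eb, r⟩
    · obtain ⟨a', b', va', vb', ea', eb', r'⟩ := one t c
      by_cases d : Γ₁.SameEdge h m
      · exact ⟨a', b', va', vb', d.trans ea', eb', .single r'⟩
      · obtain ⟨a, b, va, vb, ea, eb, r⟩ := ih d
        exact ⟨a, b', va, vb', ea, eb', r.tail (step_congr
          (comp_inl hl (ea'.symm.trans eb)) (.refl _) r')⟩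

theorem leads_inr {h k : Γ₂.H} (s : Γ₂.Leads h k) (ne : ¬ Γ₂.SameEdge h k) :
    ∃ a b, ∃ (va : ¬ Γ₂.Virt a) (vb : ¬ Γ₂.Virt b), Γ₂.SameEdge h a ∧ Γ₂.SameEdge k b ∧
      (compDirected hl).Leads ⟨.inr a, keep_inr_of_not_virt va⟩
        ⟨.inr b, keep_inr_of_not_virt vb⟩ := by
  have one : ∀ {h k}, Γ₂.Step h k → ¬ Γ₂.SameEdge h k →
      ∃ a b, ∃ (va : ¬ Γ₂.Virt a) (vb : ¬ Γ₂.Virt b), Γ₂.SameEdge h a ∧ Γ₂.SameEdge k b ∧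
      (compDirected hl).Step ⟨.inr a, keep_inr_of_not_virt va⟩
        ⟨.inr b, keep_inr_of_not_virt vb⟩ := by
    intro h k s ne
    obtain ⟨a, b, ea, eb, sa, sb, ab, va, vb⟩ := step_real s ne
    exact ⟨a, b, va, vb, ea, eb, _, _, .refl _, .refl _, sa, sb, ab⟩
  induction s with
  | single s =>
    obtain ⟨a, b, va, vb, ea, eb, r⟩ := one s ne
    exact ⟨a, b, va, vb, ea, eb, .single r⟩
  | @tail m k s t ih =>
    by_cases c : Γ₂.SameEdge m k
    · obtain ⟨a, b, va, vb, ea, eb, r⟩ := ih fun d => ne (d.trans c)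
      exact ⟨a, b, va, vb, ea, c.symm.trans eb, r⟩
    · obtain ⟨a', b', va', vb', ea', eb', r'⟩ := one t c
      by_cases d : Γ₂.SameEdge h m
      · exact ⟨a', b', va', vb', d.trans ea', eb', .single r'⟩
      · obtain ⟨a, b, va, vb, ea, eb, r⟩ := ih d
        exact ⟨a, b', va, vb', ea, eb', r.tail (step_congr
          (comp_inr hl (ea'.symm.trans eb)) (.refl _) r')⟩

theorem comp_step_le (x y : Half Γ₁ Γ₂) (s : (compDirected hl).Step x y) :
    Le Γ₁ Γ₂ x.1 y.1 := by
  obtain ⟨a, b, ea, eb, sa, sb, ab⟩ := s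
  replace ea := (comp_sameEdge hl _ _).1 ea
  replace eb := (comp_sameEdge hl _ _).1 eb
  have h₁ := ((Le.antisymm_iff _ _).2 ea).1
  have h₂ := ((Le.antisymm_iff _ _).2 eb).2
  refine h₁.trans (Le.trans ?_ h₂)
  obtain ⟨a | a, ka⟩ := a <;> obtain ⟨b | b, kb⟩ := b
  · exact le_of_leads (Γ := Γ₁) (.single ⟨a, b, .refl _, .refl _, sa, sb, ab⟩)
  · obtain ⟨o, i, m, vo, vi, rfl, rfl⟩ := ab
    exact ⟨o, i, m, le_of_sameEdge (SameEdge.symm (Or.inr rfl)), le_of_sameEdge (Or.inr rfl)⟩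
  · obtain ⟨o, i, m, vo, vi, rfl, rfl⟩ := ab
    have := sgn_flip vo m.out.2
    change Γ₁.sgn _ = _ at sb
    rw [this] at sb
    simp at sb
  · exact le_of_leads (Γ := Γ₂) (.single ⟨a, b, .refl _, .refl _, sa, sb, ab⟩)

/-- The condition `P2` for a directed path of two edges which meet in a vertex of the first graph,
and for a third edge from the second graph. -/
theorem comp_P2_inl {a b : Γ₁.H} {c : Γ₂.H} (va : ¬ Γ₁.Virt a)
    (kc : Keep Γ₁ Γ₂ (.inr c)) (sa : Γ₁.sgn a = true) (sb : Γ₁.sgn b = false) (ab : Γ₁.vtx a b)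
    (p : ¬ Le Γ₁ Γ₂ (.inr c) (.inl a)) (q : ¬ Le Γ₁ Γ₂ (.inl b) (.inr c)) :
    (compDirected hl).Leads ⟨.inl a, keep_inl_of_not_virt va⟩ ⟨.inr c, kc⟩ := by
  have st : Γ₁.Leads a b := .single ⟨a, b, .refl _, .refl _, sa, sb, ab⟩
  have q' := (Le.total _ _).resolve_left q
  obtain ⟨o, i, m, ao, ic, ri⟩ : ∃ o i, Matched Γ₁ Γ₂ o i ∧ Γ₁.le a o ∧ Γ₂.le i c ∧
      (Γ₂.SameEdge i c ∨ Γ₂.Leads i c) := by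
    obtain ⟨o, i, m, ao, ic⟩ := (Le.total _ _).resolve_left p
    obtain ⟨i₀, h₀, r₀⟩ := exists_in_leads c
    by_cases d : Γ₂.le i i₀
    · obtain ⟨o₀, m₀⟩ := exists_matched_in hl h₀
      refine ⟨o₀, i₀, m₀, Γ₁.le_trans _ _ _ ao ((m.le_iff m₀).2 d), ?_, r₀⟩
      rcases r₀ with r | r
      exacts [le_of_sameEdge r, le_of_leads r]
    · refine ⟨o, i, m, ao, ic, ?_⟩
      rcases r₀ with r | r
      · exact absurd (Γ₂.le_trans _ _ _ ic (le_of_sameEdge r.symm)) d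
      · by_cases f : Γ₂.le c i
        · exact Or.inl ((Γ₂.le_antisymm_iff _ _).1 ⟨ic, f⟩)
        · rcases Γ₂.P2 _ _ _ r d f with g | g
          · exact Or.inr g
          · exact absurd (le_of_sameEdge (sameEdge_of_leads_in g m.inp (.refl _)).symm) d
  have ob : Γ₁.le o b := (q' o i m).1 ic
  have nbo : ¬ Γ₁.le b o := fun h => q ⟨o, i, m, h, ic⟩
  have noa : ¬ Γ₁.SameEdge a o := by
    rintro (rfl | e)
    · rw [m.out.2] at sa
      simp at sa
    · rcases m.out.1 with h | h
      · have : o = a := by rw [← h, e, Γ₁.σ_σ]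
        rw [← this, m.out.2] at sa
        simp at sa
      · rw [e] at h
        exact va (by simpa [Γ₁.σ_σ] using h.σ)
  have noa' : ¬ Γ₁.le o a := fun h => noa ((Γ₁.le_antisymm_iff _ _).1 ⟨ao, h⟩)
  rcases Γ₁.P2 _ _ _ st noa' nbo with g | g
  · exact absurd (le_of_sameEdge (sameEdge_of_leads_out g m.out (.refl _)).symm) nbo
  · obtain ⟨a', o', va', vo', ea, eo, r⟩ := leads_inl hl g noa
    have ea' : (compDirected hl).SameEdge ⟨.inl a', keep_inl_of_not_virt va'⟩
        ⟨.inl a, keep_inl_of_not_virt va⟩ := comp_inl hl ea.symm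
    by_cases f : Γ₂.SameEdge i c
    · exact leads_congr ea' (comp_inl_inr hl m eo.symm f) r
    · obtain ⟨i', c', vi', vc', ei, ec, r'⟩ := leads_inr hl (ri.resolve_left f) f
      exact leads_congr ea' (comp_inr hl ec.symm) (Relation.TransGen.trans r
        (leads_congr (comp_inl_inr hl m eo.symm ei).symm (.refl _) r'))

theorem comp_P2_inr {a b : Γ₂.H} {c : Γ₁.H} (vb : ¬ Γ₂.Virt b)
    (kc : Keep Γ₁ Γ₂ (.inl c)) (sa : Γ₂.sgn a = true) (sb : Γ₂.sgn b = false) (ab : Γ₂.vtx a b)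
    (p : ¬ Le Γ₁ Γ₂ (.inl c) (.inr a)) (q : ¬ Le Γ₁ Γ₂ (.inr b) (.inl c)) :
    (compDirected hl).Leads ⟨.inl c, kc⟩ ⟨.inr b, keep_inr_of_not_virt vb⟩ := by
  have st : Γ₂.Leads a b := .single ⟨a, b, .refl _, .refl _, sa, sb, ab⟩
  have p' := (Le.total _ _).resolve_left p
  obtain ⟨o, i, m, co, ib, ro⟩ : ∃ o i, Matched Γ₁ Γ₂ o i ∧ Γ₁.le c o ∧ Γ₂.le i b ∧
      (Γ₁.SameEdge c o ∨ Γ₁.Leads c o) := by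
    obtain ⟨o, i, m, co, ib⟩ := (Le.total _ _).resolve_left q
    obtain ⟨o₀, h₀, r₀⟩ := exists_out_leads c
    by_cases d : Γ₁.le o₀ o
    · obtain ⟨i₀, m₀⟩ := exists_matched_out hl h₀
      refine ⟨o₀, i₀, m₀, ?_, Γ₂.le_trans _ _ _ ((m₀.le_iff m).1 d) ib, r₀⟩
      rcases r₀ with r | r
      exacts [le_of_sameEdge r, le_of_leads r]
    · refine ⟨o, i, m, co, ib, ?_⟩
      rcases r₀ with r | r
      · exact absurd (Γ₁.le_trans _ _ _ (le_of_sameEdge r.symm) co) d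
      · by_cases f : Γ₁.le o c
        · exact Or.inl ((Γ₁.le_antisymm_iff _ _).1 ⟨co, f⟩)
        · rcases Γ₁.P2 _ _ _ r f d with g | g
          · exact absurd (le_of_sameEdge (sameEdge_of_leads_out g m.out (.refl _)).symm) d
          · exact Or.inr g
  have ai : Γ₂.le a i := (p' o i m).2 co
  have nia : ¬ Γ₂.le i a := fun h => p ⟨o, i, m, co, h⟩
  have nib : ¬ Γ₂.SameEdge b i := by
    rintro (rfl | e)
    · rw [m.inp.2] at sb
      simp at sb
    · rcases m.inp.1 with h | h
      · have : i = b := by rw [← h, e, Γ₂.σ_σ]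
        rw [← this, m.inp.2] at sb
        simp at sb
      · rw [e] at h
        exact vb (by simpa [Γ₂.σ_σ] using h.σ)
  have nib' : ¬ Γ₂.le b i := fun h => nib ((Γ₂.le_antisymm_iff _ _).1 ⟨h, ib⟩)
  rcases Γ₂.P2 _ _ _ st nia nib' with g | g
  · obtain ⟨i', b', vi', vb', ei, eb, r⟩ := leads_inr hl g fun e => nib e.symm
    have eb' : (compDirected hl).SameEdge ⟨.inr b', keep_inr_of_not_virt vb'⟩
        ⟨.inr b, keep_inr_of_not_virt vb⟩ := comp_inr hl eb.symm
    by_cases f : Γ₁.SameEdge c o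
    · exact leads_congr (comp_inl_inr hl m f ei).symm eb' r
    · obtain ⟨c', o', vc', vo', ec, eo, r'⟩ := leads_inl hl (ro.resolve_left f) f
      exact leads_congr (comp_inl hl ec.symm) eb'
        (Relation.TransGen.trans r' (leads_congr (comp_inl_inr hl m eo.symm ei).symm (.refl _) r))
  · exact absurd (le_of_sameEdge (sameEdge_of_leads_in g m.inp (.refl _)).symm) nia

theorem comp_P2 (x y z : Half Γ₁ Γ₂) (s : (compDirected hl).Step x y)
    (p : ¬ Le Γ₁ Γ₂ z.1 x.1) (q : ¬ Le Γ₁ Γ₂ y.1 z.1) :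
    (compDirected hl).Leads z y ∨ (compDirected hl).Leads x z := by
  have ne : ¬ (compDirected hl).SameEdge x y := by
    intro e
    replace e := (Le.antisymm_iff _ _).2 ((comp_sameEdge hl _ _).1 e)
    exact q (e.2.trans ((Le.total _ _).resolve_left p))
  obtain ⟨a, b, ea, eb, sa, sb, ab, va, vb⟩ := step_real s ne
  have p' : ¬ Le Γ₁ Γ₂ z.1 a.1 := fun h =>
    p (h.trans ((Le.antisymm_iff _ _).2 ((comp_sameEdge hl _ _).1 ea)).2)
  have q' : ¬ Le Γ₁ Γ₂ b.1 z.1 := fun h =>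
    q (((Le.antisymm_iff _ _).2 ((comp_sameEdge hl _ _).1 eb)).1.trans h)
  suffices (compDirected hl).Leads z b ∨ (compDirected hl).Leads a z by
    rcases this with h | h
    · exact Or.inl (leads_congr (.refl _) eb.symm h)
    · exact Or.inr (leads_congr ea.symm (.refl _) h)
  clear p q s ne ea eb
  obtain ⟨a | a, ka⟩ := a <;> obtain ⟨b | b, kb⟩ := b
  · rw [comp_virt_inl] at va vb
    obtain ⟨c | c, kc⟩ := z
    · have st : Γ₁.Leads a b := .single ⟨a, b, .refl _, .refl _, sa, sb, ab⟩
      rcases Γ₁.P2 a b c st p' q' with g | g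
      · obtain ⟨c', b', _, _, ec, eb, r⟩ := leads_inl hl g fun e => q' (le_of_sameEdge e.symm)
        exact Or.inl (leads_congr (comp_inl hl ec.symm)
          (comp_inl hl eb.symm) r)
      · obtain ⟨a', c', _, _, ea, ec, r⟩ := leads_inl hl g fun e => p' (le_of_sameEdge e.symm)
        exact Or.inr (leads_congr (comp_inl hl ea.symm)
          (comp_inl hl ec.symm) r)
    · exact Or.inr (comp_P2_inl hl va kc sa sb ab p' q')
  · obtain ⟨o, i, m, vo, vi, rfl, rfl⟩ := ab
    exact absurd ((comp_virt_inl hl _ _).2 vo.σ) va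
  · obtain ⟨o, i, m, vo, vi, rfl, rfl⟩ := ab
    exact absurd ((comp_virt_inr hl _ _).2 vi.σ) va
  · rw [comp_virt_inr] at va vb
    obtain ⟨c | c, kc⟩ := z
    · exact Or.inl (comp_P2_inr hl vb kc sa sb ab p' q')
    · have st : Γ₂.Leads a b := .single ⟨a, b, .refl _, .refl _, sa, sb, ab⟩
      rcases Γ₂.P2 a b c st p' q' with g | g
      · obtain ⟨c', b', _, _, ec, eb, r⟩ := leads_inr hl g fun e => q' (le_of_sameEdge e.symm)
        exact Or.inl (leads_congr (comp_inr hl ec.symm)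
          (comp_inr hl eb.symm) r)
      · obtain ⟨a', c', _, _, ea, ec, r⟩ := leads_inr hl g fun e => p' (le_of_sameEdge e.symm)
        exact Or.inr (leads_congr (comp_inr hl ea.symm)
          (comp_inr hl ec.symm) r)

end

end Grafting

/-- The composition `Γ₂ ∘ Γ₁` of planar graphs, for `Γ₁` with as many outputs as `Γ₂` has inputs:
the `k`-th output of `Γ₁` is grafted to the `k`-th input of `Γ₂`. -/
noncomputable def PlanarGraph.comp (Γ₂ Γ₁ : PlanarGraph)
    (hl : Γ₁.outs.length = Γ₂.ins.length) : PlanarGraph where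
  toDirectedGraph := Grafting.compDirected hl
  le := fun x y => Grafting.Le Γ₁ Γ₂ x.1 y.1
  le_total := fun x y => Grafting.Le.total x.1 y.1
  le_trans := fun _ _ _ p q => Grafting.Le.trans p q
  le_antisymm_iff := fun x y =>
    (Grafting.Le.antisymm_iff x.1 y.1).trans (Grafting.sameEdge_iff x y).symm
  P1 := PlanarGraph.P1_of_step (Γ := Grafting.compDirected hl) (le := fun (x y : Grafting.Half Γ₁ Γ₂) => Grafting.Le Γ₁ Γ₂ x.1 y.1)
    (fun _ _ _ p q => Grafting.Le.trans p q)
    (fun x y => (Grafting.Le.antisymm_iff x.1 y.1).trans (Grafting.sameEdge_iff x y).symm)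
    (Grafting.comp_step_le hl)
  P2 := PlanarGraph.P2_of_step (Γ := Grafting.compDirected hl) (le := fun (x y : Grafting.Half Γ₁ Γ₂) => Grafting.Le Γ₁ Γ₂ x.1 y.1)
    (fun x y => (Grafting.Le.antisymm_iff x.1 y.1).trans (Grafting.sameEdge_iff x y).symm)
    (Grafting.comp_P2 hl)

/-! ### The tensor product of planar graphs -/

namespace Juxtaposition

open PreGraph DirectedGraph PlanarGraph

variable (Γ₁ Γ₂ : PlanarGraph)

/-- The disjoint union of two directed graphs. -/
def tensorDirected : DirectedGraph where
  H := Γ₁.H ⊕ Γ₂.H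
  finite := inferInstance
  vtx :=
    { r := Sum.LiftRel Γ₁.vtx Γ₂.vtx
      iseqv := ⟨by
          rintro (h | h)
          exacts [.inl (Γ₁.vtx.refl h), .inr (Γ₂.vtx.refl h)], by
          rintro _ _ (e | e)
          exacts [.inl (Γ₁.vtx.symm e), .inr (Γ₂.vtx.symm e)], by
          rintro _ _ _ (e | e) (f | f)
          exacts [.inl (Γ₁.vtx.trans e f), .inr (Γ₂.vtx.trans e f)]⟩ }
  σ := Sum.map Γ₁.σ Γ₂.σ
  σ_σ := by
    rintro (h | h)
    exacts [congrArg Sum.inl (Γ₁.σ_σ h), congrArg Sum.inr (Γ₂.σ_σ h)]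
  virt_deg := by
    rintro _ _ ⟨v, w⟩ (@⟨h, k, e⟩ | @⟨h, k, e⟩)
    · rcases Γ₁.virt_deg h k ⟨fun p => v (congrArg Sum.inl p), Sum.liftRel_inl_inl.1 w⟩ e with
        rfl | rfl
      exacts [Or.inl rfl, Or.inr rfl]
    · rcases Γ₂.virt_deg h k ⟨fun p => v (congrArg Sum.inr p), Sum.liftRel_inr_inr.1 w⟩ e with
        rfl | rfl
      exacts [Or.inl rfl, Or.inr rfl]
  sgn := Sum.elim Γ₁.sgn Γ₂.sgn
  sgn_σ := by
    rintro (h | h) p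
    · exact Γ₁.sgn_σ h fun e => p (congrArg Sum.inl e)
    · exact Γ₂.sgn_σ h fun e => p (congrArg Sum.inr e)
  exists_in := by
    rintro (h | h)
    · obtain ⟨k, e, s⟩ := Γ₁.exists_in h
      exact ⟨.inl k, .inl e, s⟩
    · obtain ⟨k, e, s⟩ := Γ₂.exists_in h
      exact ⟨.inr k, .inr e, s⟩
  exists_out := by
    rintro (h | h)
    · obtain ⟨k, e, s⟩ := Γ₁.exists_out h
      exact ⟨.inl k, .inl e, s⟩
    · obtain ⟨k, e, s⟩ := Γ₂.exists_out h
      exact ⟨.inr k, .inr e, s⟩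

variable {Γ₁ Γ₂}

theorem sameEdge_inl (h k : Γ₁.H) :
    (tensorDirected Γ₁ Γ₂).SameEdge (.inl h) (.inl k) ↔ Γ₁.SameEdge h k :=
  or_congr Sum.inl_injective.eq_iff Sum.inl_injective.eq_iff

theorem sameEdge_inr (h k : Γ₂.H) :
    (tensorDirected Γ₁ Γ₂).SameEdge (.inr h) (.inr k) ↔ Γ₂.SameEdge h k :=
  or_congr Sum.inr_injective.eq_iff Sum.inr_injective.eq_iff

theorem not_sameEdge_inl_inr (h : Γ₁.H) (k : Γ₂.H) :
    ¬ (tensorDirected Γ₁ Γ₂).SameEdge (.inl h) (.inr k) := by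
  rintro (e | e)
  · exact Sum.inr_ne_inl e
  · exact Sum.inr_ne_inl (e : (Sum.inr k : Γ₁.H ⊕ Γ₂.H) = Sum.inl (Γ₁.σ h))

theorem virt_inl (h : Γ₁.H) : (tensorDirected Γ₁ Γ₂).Virt (.inl h) ↔ Γ₁.Virt h :=
  and_congr (not_congr Sum.inl_injective.eq_iff) Sum.liftRel_inl_inl

theorem virt_inr (h : Γ₂.H) : (tensorDirected Γ₁ Γ₂).Virt (.inr h) ↔ Γ₂.Virt h :=
  and_congr (not_congr Sum.inr_injective.eq_iff) Sum.liftRel_inr_inr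

theorem step_inl (h k : Γ₁.H) :
    (tensorDirected Γ₁ Γ₂).Step (.inl h) (.inl k) ↔ Γ₁.Step h k := by
  constructor
  · rintro ⟨a | a, b | b, ea, eb, sa, sb, ab⟩
    · exact ⟨a, b, (sameEdge_inl _ _).1 ea, (sameEdge_inl _ _).1 eb, sa, sb,
        Sum.liftRel_inl_inl.1 ab⟩
    · exact (not_sameEdge_inl_inr _ _ eb).elim
    · exact (not_sameEdge_inl_inr _ _ ea).elim
    · exact (not_sameEdge_inl_inr _ _ ea).elim
  · rintro ⟨a, b, ea, eb, sa, sb, ab⟩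
    exact ⟨.inl a, .inl b, (sameEdge_inl _ _).2 ea, (sameEdge_inl _ _).2 eb, sa, sb, .inl ab⟩

theorem step_inr (h k : Γ₂.H) :
    (tensorDirected Γ₁ Γ₂).Step (.inr h) (.inr k) ↔ Γ₂.Step h k := by
  constructor
  · rintro ⟨a | a, b | b, ea, eb, sa, sb, ab⟩
    · exact (not_sameEdge_inl_inr _ _ eb.symm).elim
    · exact (not_sameEdge_inl_inr _ _ ea.symm).elim
    · exact (not_sameEdge_inl_inr _ _ eb.symm).elim
    · exact ⟨a, b, (sameEdge_inr _ _).1 ea, (sameEdge_inr _ _).1 eb, sa, sb,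
        Sum.liftRel_inr_inr.1 ab⟩
  · rintro ⟨a, b, ea, eb, sa, sb, ab⟩
    exact ⟨.inr a, .inr b, (sameEdge_inr _ _).2 ea, (sameEdge_inr _ _).2 eb, sa, sb, .inr ab⟩

theorem not_step_inl_inr (h : Γ₁.H) (k : Γ₂.H) :
    ¬ (tensorDirected Γ₁ Γ₂).Step (.inl h) (.inr k) := by
  rintro ⟨a | a, b | b, ea, eb, sa, sb, ab⟩
  · exact not_sameEdge_inl_inr _ _ eb.symm
  · cases ab
  · exact not_sameEdge_inl_inr _ _ ea
  · exact not_sameEdge_inl_inr _ _ ea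

theorem not_step_inr_inl (h : Γ₁.H) (k : Γ₂.H) :
    ¬ (tensorDirected Γ₁ Γ₂).Step (.inr k) (.inl h) := by
  rintro ⟨a | a, b | b, ea, eb, sa, sb, ab⟩
  · exact not_sameEdge_inl_inr _ _ ea.symm
  · exact not_sameEdge_inl_inr _ _ eb
  · cases ab
  · exact not_sameEdge_inl_inr _ _ eb

theorem lex_trans (x y z : Γ₁.H ⊕ Γ₂.H) (p : Sum.Lex Γ₁.le Γ₂.le x y)
    (q : Sum.Lex Γ₁.le Γ₂.le y z) : Sum.Lex Γ₁.le Γ₂.le x z := by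
  rcases p with p | p | _ <;> rcases q with q | q | _
  exacts [.inl (Γ₁.le_trans _ _ _ p q), .sep _ _, .inr (Γ₂.le_trans _ _ _ p q), .sep _ _]

theorem lex_antisymm_iff (x y : Γ₁.H ⊕ Γ₂.H) :
    (Sum.Lex Γ₁.le Γ₂.le x y ∧ Sum.Lex Γ₁.le Γ₂.le y x) ↔
      (tensorDirected Γ₁ Γ₂).SameEdge x y := by
  rcases x with h | h <;> rcases y with k | k
  · rw [Sum.lex_inl_inl, Sum.lex_inl_inl, sameEdge_inl]
    exact Γ₁.le_antisymm_iff h k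
  · exact iff_of_false (fun p => Sum.lex_inr_inl p.2) (not_sameEdge_inl_inr _ _)
  · exact iff_of_false (fun p => Sum.lex_inr_inl p.1) fun e => not_sameEdge_inl_inr _ _ e.symm
  · rw [Sum.lex_inr_inr, Sum.lex_inr_inr, sameEdge_inr]
    exact Γ₂.le_antisymm_iff h k

theorem leads_inl {h k : Γ₁.H} (s : Γ₁.Leads h k) :
    (tensorDirected Γ₁ Γ₂).Leads (.inl h) (.inl k) :=
  Relation.TransGen.lift (r := Γ₁.Step) (p := (tensorDirected Γ₁ Γ₂).Step) Sum.inl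
    (fun a b s => (step_inl a b).2 s) h k s

theorem leads_inr {h k : Γ₂.H} (s : Γ₂.Leads h k) :
    (tensorDirected Γ₁ Γ₂).Leads (.inr h) (.inr k) :=
  Relation.TransGen.lift (r := Γ₂.Step) (p := (tensorDirected Γ₁ Γ₂).Step) Sum.inr
    (fun a b s => (step_inr a b).2 s) h k s

end Juxtaposition

open Juxtaposition in
/-- The tensor product `Γ₁ ⊗ Γ₂` of planar graphs: the disjoint union, in which all the edges of
`Γ₁` precede all the edges of `Γ₂`. -/
def PlanarGraph.tensor (Γ₁ Γ₂ : PlanarGraph) : PlanarGraph where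
  toDirectedGraph := tensorDirected Γ₁ Γ₂
  le := Sum.Lex Γ₁.le Γ₂.le
  le_total := by
    rintro (h | h) (k | k)
    · rcases Γ₁.le_total h k with p | p
      exacts [Or.inl (.inl p), Or.inr (.inl p)]
    · exact Or.inl (.sep _ _)
    · exact Or.inr (.sep _ _)
    · rcases Γ₂.le_total h k with p | p
      exacts [Or.inl (.inr p), Or.inr (.inr p)]
  le_trans := lex_trans
  le_antisymm_iff := lex_antisymm_iff
  P1 := PlanarGraph.P1_of_step (Γ := tensorDirected Γ₁ Γ₂) lex_trans lex_antisymm_iff (by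
    rintro (h | h) (k | k) s
    · exact .inl (PlanarGraph.le_of_leads (.single ((step_inl _ _).1 s)))
    · exact (not_step_inl_inr _ _ s).elim
    · exact (not_step_inr_inl _ _ s).elim
    · exact .inr (PlanarGraph.le_of_leads (.single ((step_inr _ _).1 s))))
  P2 := PlanarGraph.P2_of_step (Γ := tensorDirected Γ₁ Γ₂) lex_antisymm_iff (by
    rintro (h | h) (k | k) (l | l) s p q
    · rcases Γ₁.P2 h k l (.single ((step_inl _ _).1 s)) (fun c => p (.inl c))
        (fun c => q (.inl c)) with r | r
      exacts [Or.inl (leads_inl r), Or.inr (leads_inl r)]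
    · exact absurd (.sep _ _) q
    · exact (not_step_inl_inr _ _ s).elim
    · exact (not_step_inl_inr _ _ s).elim
    · exact (not_step_inr_inl _ _ s).elim
    · exact (not_step_inr_inl _ _ s).elim
    · exact absurd (.sep _ _) p
    · rcases Γ₂.P2 h k l (.single ((step_inr _ _).1 s)) (fun c => p (.inr c))
        (fun c => q (.inr c)) with r | r
      exacts [Or.inl (leads_inr r), Or.inr (leads_inr r)])

namespace PlanarGraph

/-- The empty planar graph. -/
def empty : PlanarGraph where
  H := Empty
  finite := inferInstance
  vtx := ⊥
  σ := id
  σ_σ := nofun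
  virt_deg := nofun
  sgn := nofun
  sgn_σ := nofun
  exists_in := nofun
  exists_out := nofun
  le := nofun
  le_total := nofun
  le_trans := nofun
  le_antisymm_iff := nofun
  P1 := nofun
  P2 := nofun

variable (Γ : PlanarGraph)

/-- A unitary graph: two half-edges, which form one virtual vertex. -/
def IsUnitary : Prop := Nat.card Γ.H = 2 ∧ (∀ h k, Γ.vtx h k) ∧ ∀ h, Γ.Virt h

/-- A prime graph: a graph with exactly one vertex which is not unitary. -/
def IsPrime : Prop := Nonempty Γ.H ∧ (∀ h k, Γ.vtx h k) ∧ ¬ Γ.IsUnitary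

variable {Γ}

/-- The vertex of a prime graph is real. -/
theorem IsPrime.not_virt (p : Γ.IsPrime) (h : Γ.H) : ¬ Γ.Virt h := by
  intro v
  have key : ∀ k, k = h ∨ k = Γ.σ h := fun k => Γ.virt_deg h k v (p.2.1 h k)
  refine p.2.2 ⟨Nat.card_eq_two_iff.2 ⟨h, Γ.σ h, v.1.symm, ?_⟩, p.2.1, fun k =>
    DirectedGraph.Virt_vtx v (p.2.1 h k)⟩
  exact Set.eq_univ_of_forall fun k => key k

/-- Transport of ordered lists along an order preserving bijection between sets of half-edges. -/
theorem ordList_pmap {Γ Δ : PlanarGraph} {S : Set Γ.H} {T : Set Δ.H} (f : ∀ h, h ∈ S → Δ.H)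
    (inj : ∀ h p k q, f h p = f k q → h = k)
    (mono : ∀ h p k q, Γ.leH h k → Δ.leH (f h p) (f k q))
    (mem : ∀ x, (∃ h p, f h p = x) ↔ x ∈ T) :
    (Γ.ordList S).pmap f (fun _ => mem_ordList.1) = Δ.ordList T := by
  refine eq_ordList ?_ ?_ ?_
  · exact List.Pairwise.pmap (pairwise_ordList S) _ fun _ p _ q r => mono _ p _ q r
  · exact List.Nodup.pmap (fun h p k q => inj h p k q) (nodup_ordList S)
  · intro x
    rw [← mem, List.mem_pmap]
    exact ⟨fun ⟨h, p, e⟩ => ⟨h, mem_ordList.1 p, e⟩, fun ⟨h, p, e⟩ => ⟨h, mem_ordList.2 p, e⟩⟩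

theorem map_ordList {α : Type*} {Γ Δ : PlanarGraph} {S : Set Γ.H} {T : Set Δ.H}
    (f : ∀ h, h ∈ S → Δ.H) (inj : ∀ h p k q, f h p = f k q → h = k)
    (mono : ∀ h p k q, Γ.leH h k → Δ.leH (f h p) (f k q))
    (mem : ∀ x, (∃ h p, f h p = x) ↔ x ∈ T) (a : Γ.H → α) (b : Δ.H → α)
    (ab : ∀ h p, b (f h p) = a h) : (Δ.ordList T).map b = (Γ.ordList S).map a := by
  rw [← ordList_pmap f inj mono mem, List.map_pmap, ← List.pmap_eq_map (p := fun h => h ∈ S)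
    (H := fun _ => mem_ordList.1)]
  exact List.pmap_congr_left _ fun h _ p _ => ab h p

end PlanarGraph

/-! ### Planar diagrams -/

/-- A planar diagram in a strict tensor category `V`: a planar graph with a valuation, which gives
every edge an object (`obj` is a function on half-edges invariant under `σ`), and gives every real
vertex `v` a morphism from the tensor product of the objects of `In(v)` to the tensor product of the
objects of `Out(v)`, in the order of `≼`. The function on real vertices is written as a function
`mor` on the half-edges of real vertices, constant on each vertex. -/
structure PlanarDiagram (V : Type u) [Category.{v} V] [MonoidalCategory V]
    extends PlanarGraph where
  obj : H → V
  obj_σ : ∀ h, obj (σ h) = obj h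
  mor : ∀ h, ¬ toPreGraph.Virt h → Arrow V
  mor_vtx : ∀ h k (p : ¬ toPreGraph.Virt h) (q : ¬ toPreGraph.Virt k), vtx h k → mor h p = mor k q
  mor_left : ∀ h (p : ¬ toPreGraph.Virt h),
    (mor h p).left = tensorWord ((toPlanarGraph.ordList (toDirectedGraph.inAt h)).map obj)
  mor_right : ∀ h (p : ¬ toPreGraph.Virt h),
    (mor h p).right = tensorWord ((toPlanarGraph.ordList (toDirectedGraph.outAt h)).map obj)

namespace PlanarDiagram

open PreGraph DirectedGraph PlanarGraph

variable {V : Type u} [Category.{v} V] [MonoidalCategory V]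

/-- The domain of a diagram, a word of objects. -/
noncomputable def dom (D : PlanarDiagram V) : List V := D.ins.map D.obj

/-- The codomain of a diagram, a word of objects. -/
noncomputable def cod (D : PlanarDiagram V) : List V := D.outs.map D.obj

theorem obj_sameEdge (D : PlanarDiagram V) {h k : D.H} (e : D.SameEdge h k) :
    D.obj h = D.obj k := by
  rcases e with rfl | rfl
  · rfl
  · exact (D.obj_σ h).symm

/-- An isomorphism of diagrams: a bijection of the half-edges which is compatible with all of the
structure. -/
structure Iso (D₁ D₂ : PlanarDiagram V) where
  toEquiv : D₁.H ≃ D₂.H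
  map_vtx : ∀ h k, D₂.vtx (toEquiv h) (toEquiv k) ↔ D₁.vtx h k
  map_σ : ∀ h, toEquiv (D₁.σ h) = D₂.σ (toEquiv h)
  map_sgn : ∀ h, D₂.sgn (toEquiv h) = D₁.sgn h
  map_le : ∀ h k, D₂.le (toEquiv h) (toEquiv k) ↔ D₁.le h k
  map_obj : ∀ h, D₂.obj (toEquiv h) = D₁.obj h
  map_mor : ∀ h (p : ¬ D₁.Virt h) (q : ¬ D₂.Virt (toEquiv h)), D₂.mor (toEquiv h) q = D₁.mor h p

theorem Iso.virt_iff {D₁ D₂ : PlanarDiagram V} (φ : Iso D₁ D₂) (h : D₁.H) :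
    D₂.Virt (φ.toEquiv h) ↔ D₁.Virt h := by
  unfold Virt
  rw [← φ.map_σ, φ.map_vtx, φ.toEquiv.injective.ne_iff]

/-- The identity isomorphism. -/
def Iso.refl (D : PlanarDiagram V) : Iso D D :=
  ⟨.refl _, fun _ _ => .rfl, fun _ => rfl, fun _ => rfl, fun _ _ => .rfl, fun _ => rfl,
    fun _ _ _ => rfl⟩

/-- The inverse isomorphism. -/
def Iso.symm {D₁ D₂ : PlanarDiagram V} (φ : Iso D₁ D₂) : Iso D₂ D₁ where
  toEquiv := φ.toEquiv.symm
  map_vtx := fun _ _ => by rw [← φ.map_vtx]; simp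
  map_σ := fun h => by rw [Equiv.symm_apply_eq, φ.map_σ]; simp
  map_sgn := fun _ => by rw [← φ.map_sgn]; simp
  map_le := fun _ _ => by rw [← φ.map_le]; simp
  map_obj := fun _ => by rw [← φ.map_obj]; simp
  map_mor := fun h p q => by
    obtain ⟨k, rfl⟩ := φ.toEquiv.surjective h
    have e : φ.toEquiv.symm (φ.toEquiv k) = k := by simp
    have q' : ¬ D₁.Virt k := e ▸ q
    rw [φ.map_mor k q' p]
    congr 1

/-- The composite of two isomorphisms. -/
def Iso.trans {D₁ D₂ D₃ : PlanarDiagram V} (φ : Iso D₁ D₂) (ψ : Iso D₂ D₃) : Iso D₁ D₃ where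
  toEquiv := φ.toEquiv.trans ψ.toEquiv
  map_vtx := fun _ _ => (ψ.map_vtx _ _).trans (φ.map_vtx _ _)
  map_σ := fun h => (congrArg ψ.toEquiv (φ.map_σ h)).trans (ψ.map_σ _)
  map_sgn := fun _ => (ψ.map_sgn _).trans (φ.map_sgn _)
  map_le := fun _ _ => (ψ.map_le _ _).trans (φ.map_le _ _)
  map_obj := fun _ => (ψ.map_obj _).trans (φ.map_obj _)
  map_mor := fun h p q =>
    (ψ.map_mor _ (fun v => p ((φ.virt_iff h).1 v)) q).trans (φ.map_mor _ _ _)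

/-- Isomorphism of diagrams, an equivalence relation. -/
instance isoSetoid (V : Type u) [Category.{v} V] [MonoidalCategory V] :
    Setoid (PlanarDiagram V) where
  r := fun D₁ D₂ => Nonempty (Iso D₁ D₂)
  iseqv := ⟨fun D => ⟨.refl D⟩, fun ⟨φ⟩ => ⟨φ.symm⟩, fun ⟨φ⟩ ⟨ψ⟩ => ⟨φ.trans ψ⟩⟩

/-! #### Composition of diagrams -/

section

open Grafting

variable {α : Type*} {Γ₁ Γ₂ : PlanarGraph} (f : Γ₁.H → α) (g : Γ₂.H → α) (b : Bool)

theorem map_comp_inl (hl : Γ₁.outs.length = Γ₂.ins.length) (h : Γ₁.H)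
    (kh : Keep Γ₁ Γ₂ (.inl h)) (nv : ¬ Γ₁.Virt h) :
    (((PlanarGraph.comp Γ₂ Γ₁ hl).ordList {k | (PlanarGraph.comp Γ₂ Γ₁ hl).vtx ⟨.inl h, kh⟩ k ∧
      (PlanarGraph.comp Γ₂ Γ₁ hl).sgn k = b}).map fun x => Sum.elim f g x.1) =
      (Γ₁.ordList {k | Γ₁.vtx h k ∧ Γ₁.sgn k = b}).map f := by
  refine map_ordList (Δ := PlanarGraph.comp Γ₂ Γ₁ hl)
    (fun k m => ⟨.inl k, keep_inl_of_not_virt (not_virt_of_vtx m.1 nv)⟩)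
    (fun _ _ _ _ e => Sum.inl_injective (congrArg Subtype.val e)) ?_ ?_ _ _ fun _ _ => rfl
  · rintro k _ l _ (rfl | r | ⟨r, s⟩)
    exacts [Or.inl rfl, Or.inr (Or.inl r), Or.inr (Or.inr ⟨comp_inl hl r, s⟩)]
  · rintro ⟨x | x, kx⟩
    · exact ⟨fun ⟨k, m, e⟩ => by cases e; exact m, fun m => ⟨x, m, rfl⟩⟩
    · refine ⟨fun ⟨k, m, e⟩ => (by cases e), ?_⟩
      rintro ⟨⟨o, i, m, vo, vi, rfl, rfl⟩, -⟩
      exact absurd vo.σ nv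

theorem map_comp_inr (hl : Γ₁.outs.length = Γ₂.ins.length) (h : Γ₂.H)
    (kh : Keep Γ₁ Γ₂ (.inr h)) (nv : ¬ Γ₂.Virt h) :
    (((PlanarGraph.comp Γ₂ Γ₁ hl).ordList {k | (PlanarGraph.comp Γ₂ Γ₁ hl).vtx ⟨.inr h, kh⟩ k ∧
      (PlanarGraph.comp Γ₂ Γ₁ hl).sgn k = b}).map fun x => Sum.elim f g x.1) =
      (Γ₂.ordList {k | Γ₂.vtx h k ∧ Γ₂.sgn k = b}).map g := by
  refine map_ordList (Δ := PlanarGraph.comp Γ₂ Γ₁ hl)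
    (fun k m => ⟨.inr k, keep_inr_of_not_virt (not_virt_of_vtx m.1 nv)⟩)
    (fun _ _ _ _ e => Sum.inr_injective (congrArg Subtype.val e)) ?_ ?_ _ _ fun _ _ => rfl
  · rintro k _ l _ (rfl | r | ⟨r, s⟩)
    exacts [Or.inl rfl, Or.inr (Or.inl r), Or.inr (Or.inr ⟨comp_inr hl r, s⟩)]
  · rintro ⟨x | x, kx⟩
    · refine ⟨fun ⟨k, m, e⟩ => (by cases e), ?_⟩
      rintro ⟨⟨o, i, m, vo, vi, rfl, rfl⟩, -⟩
      exact absurd vi.σ nv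
    · exact ⟨fun ⟨k, m, e⟩ => by cases e; exact m, fun m => ⟨x, m, rfl⟩⟩

end

section

open Juxtaposition

variable {α : Type*} {Γ₁ Γ₂ : PlanarGraph} (f : Γ₁.H → α) (g : Γ₂.H → α) (b : Bool)

theorem map_tensor_inl (h : Γ₁.H) :
    ((PlanarGraph.tensor Γ₁ Γ₂).ordList {k | (PlanarGraph.tensor Γ₁ Γ₂).vtx (.inl h) k ∧
      (PlanarGraph.tensor Γ₁ Γ₂).sgn k = b}).map (Sum.elim f g) =
      (Γ₁.ordList {k | Γ₁.vtx h k ∧ Γ₁.sgn k = b}).map f := by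
  refine map_ordList (Δ := PlanarGraph.tensor Γ₁ Γ₂) (fun k _ => .inl k) (fun _ _ _ _ e => Sum.inl_injective e) ?_ ?_ _ _
    fun _ _ => rfl
  · rintro k _ l _ (rfl | r | ⟨r, s⟩)
    exacts [Or.inl rfl, Or.inr (Or.inl fun c => r (Sum.lex_inl_inl.1 c)),
      Or.inr (Or.inr ⟨(sameEdge_inl _ _).2 r, s⟩)]
  · rintro (x | x)
    · exact ⟨fun ⟨k, m, e⟩ => by cases e; exact ⟨.inl m.1, m.2⟩,
        fun m => ⟨x, ⟨Sum.liftRel_inl_inl.1 m.1, m.2⟩, rfl⟩⟩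
    · exact ⟨fun ⟨k, m, e⟩ => (by cases e), fun m => by cases m.1⟩

theorem map_tensor_inr (h : Γ₂.H) :
    ((PlanarGraph.tensor Γ₁ Γ₂).ordList {k | (PlanarGraph.tensor Γ₁ Γ₂).vtx (.inr h) k ∧
      (PlanarGraph.tensor Γ₁ Γ₂).sgn k = b}).map (Sum.elim f g) =
      (Γ₂.ordList {k | Γ₂.vtx h k ∧ Γ₂.sgn k = b}).map g := by
  refine map_ordList (Δ := PlanarGraph.tensor Γ₁ Γ₂) (fun k _ => .inr k) (fun _ _ _ _ e => Sum.inr_injective e) ?_ ?_ _ _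
    fun _ _ => rfl
  · rintro k _ l _ (rfl | r | ⟨r, s⟩)
    exacts [Or.inl rfl, Or.inr (Or.inl fun c => r (Sum.lex_inr_inr.1 c)),
      Or.inr (Or.inr ⟨(sameEdge_inr _ _).2 r, s⟩)]
  · rintro (x | x)
    · exact ⟨fun ⟨k, m, e⟩ => (by cases e), fun m => by cases m.1⟩
    · exact ⟨fun ⟨k, m, e⟩ => by cases e; exact ⟨.inr m.1, m.2⟩,
        fun m => ⟨x, ⟨Sum.liftRel_inr_inr.1 m.1, m.2⟩, rfl⟩⟩

end

theorem length_eq {D₁ D₂ : PlanarDiagram V} (hc : D₁.cod = D₂.dom) :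
    D₁.outs.length = D₂.ins.length := by
  simpa [cod, dom] using congrArg List.length hc

open Grafting in
/-- The composition `D₂ ∘ D₁` of two composable diagrams. -/
noncomputable def comp (D₂ D₁ : PlanarDiagram V) (hc : D₁.cod = D₂.dom) : PlanarDiagram V where
  toPlanarGraph := PlanarGraph.comp D₂.toPlanarGraph D₁.toPlanarGraph (length_eq hc)
  obj := fun x => Sum.elim D₁.obj D₂.obj x.1
  obj_σ := fun x => by
    have key : ∀ o i, Matched D₁.toPlanarGraph D₂.toPlanarGraph o i → D₁.obj o = D₂.obj i := by
      intro o i m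
      obtain ⟨k, h₁, h₂, rfl, rfl⟩ := m.exists_getElem
      have h₁' : k < D₁.cod.length := by simpa [cod] using h₁
      have h₂' : k < D₂.dom.length := by simpa [dom] using h₂
      have : D₁.cod[k] = D₂.dom[k] := by simp only [hc]
      simpa [cod, dom] using this
    have E := (edgeRel_invol x).symm
    change Sum.elim D₁.obj D₂.obj (invol _ _ x).1 = _
    generalize invol _ _ x = y at E
    obtain ⟨x | x, kx⟩ := x <;> obtain ⟨y | y, ky⟩ := y
    · exact D₁.obj_sameEdge E
    · obtain ⟨o, i, m, e, f⟩ := E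
      exact (D₂.obj_sameEdge f).symm.trans ((key o i m).symm.trans (D₁.obj_sameEdge e).symm)
    · obtain ⟨o, i, m, e, f⟩ := E
      exact (D₁.obj_sameEdge e).trans ((key o i m).trans (D₂.obj_sameEdge f))
    · exact D₂.obj_sameEdge E
  mor := fun x => match x with
    | ⟨.inl h, kh⟩ => fun p => D₁.mor h fun v => p ((comp_virt_inl (length_eq hc) h kh).2 v)
    | ⟨.inr h, kh⟩ => fun p => D₂.mor h fun v => p ((comp_virt_inr (length_eq hc) h kh).2 v)
  mor_vtx := by
    rintro ⟨h | h, kh⟩ ⟨k | k, kk⟩ p q e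
    · exact D₁.mor_vtx h k _ _ e
    · obtain ⟨o, i, m, vo, vi, rfl, rfl⟩ := e
      exact absurd ((comp_virt_inl (length_eq hc) _ kh).2 vo.σ) p
    · obtain ⟨o, i, m, vo, vi, rfl, rfl⟩ := e
      exact absurd ((comp_virt_inl (length_eq hc) _ kk).2 vo.σ) q
    · exact D₂.mor_vtx h k _ _ e
  mor_left := by
    rintro ⟨h | h, kh⟩ p
    · exact (D₁.mor_left h _).trans (congrArg tensorWord (map_comp_inl _ _ _ _ h kh
        fun v => p ((comp_virt_inl (length_eq hc) h kh).2 v)).symm)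
    · exact (D₂.mor_left h _).trans (congrArg tensorWord (map_comp_inr _ _ _ _ h kh
        fun v => p ((comp_virt_inr (length_eq hc) h kh).2 v)).symm)
  mor_right := by
    rintro ⟨h | h, kh⟩ p
    · exact (D₁.mor_right h _).trans (congrArg tensorWord (map_comp_inl _ _ _ _ h kh
        fun v => p ((comp_virt_inl (length_eq hc) h kh).2 v)).symm)
    · exact (D₂.mor_right h _).trans (congrArg tensorWord (map_comp_inr _ _ _ _ h kh
        fun v => p ((comp_virt_inr (length_eq hc) h kh).2 v)).symm)

/-! #### Tensor product of diagrams -/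

open Juxtaposition in
/-- The tensor product `D₁ ⊗ D₂` of two diagrams. -/
def tensor (D₁ D₂ : PlanarDiagram V) : PlanarDiagram V where
  toPlanarGraph := PlanarGraph.tensor D₁.toPlanarGraph D₂.toPlanarGraph
  obj := Sum.elim D₁.obj D₂.obj
  obj_σ := by
    rintro (h | h)
    exacts [D₁.obj_σ h, D₂.obj_σ h]
  mor := fun x => match x with
    | .inl h => fun p => D₁.mor h fun v => p ((virt_inl h).2 v)
    | .inr h => fun p => D₂.mor h fun v => p ((virt_inr h).2 v)
  mor_vtx := by
    rintro (h | h) (k | k) p q e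
    · exact D₁.mor_vtx h k _ _ (Sum.liftRel_inl_inl.1 e)
    · cases e
    · cases e
    · exact D₂.mor_vtx h k _ _ (Sum.liftRel_inr_inr.1 e)
  mor_left := by
    rintro (h | h) p
    · exact (D₁.mor_left h _).trans (congrArg tensorWord (map_tensor_inl _ _ _ h).symm)
    · exact (D₂.mor_left h _).trans (congrArg tensorWord (map_tensor_inr _ _ _ h).symm)
  mor_right := by
    rintro (h | h) p
    · exact (D₁.mor_right h _).trans (congrArg tensorWord (map_tensor_inl _ _ _ h).symm)
    · exact (D₂.mor_right h _).trans (congrArg tensorWord (map_tensor_inr _ _ _ h).symm)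

variable (V) in
/-- The empty diagram. -/
def empty : PlanarDiagram V where
  toPlanarGraph := PlanarGraph.empty
  obj := nofun
  obj_σ := nofun
  mor := nofun
  mor_vtx := nofun
  mor_left := nofun
  mor_right := nofun

/-- The tensor product `D₁ ⊗ ⋯ ⊗ Dₙ` of a finite sequence of diagrams; the empty diagram for the
empty sequence. -/
def tensorAll : List (PlanarDiagram V) → PlanarDiagram V
  | [] => empty V
  | D :: L => tensor D (tensorAll L)

end PlanarDiagram

/-! ### Evaluations -/

section Evaluation

variable (V : Type u) [Category.{v} V] [MonoidalCategory V]

/-- The isomorphism classes of planar diagrams in `V`. -/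
def Diag : Type (max u v 1) := Quotient (PlanarDiagram.isoSetoid V)

variable {V}

/-- The isomorphism class of a planar diagram. -/
def PlanarDiagram.cls (D : PlanarDiagram V) : Diag V := Quotient.mk _ D

/-- The defining properties of the evaluation of diagrams, for a map from isomorphism classes of
planar diagrams to the set of all morphisms. -/
structure IsEvaluation (ε : Diag V → Arrow V) : Prop where
  /-- The empty diagram goes to the identity of the unit object. -/
  empty : ε (PlanarDiagram.empty V).cls = Arrow.mk (𝟙 (MonoidalCategoryStruct.tensorUnit V))
  /-- A prime diagram goes to the label of its vertex. -/
  prime : ∀ D : PlanarDiagram V, D.IsPrime → ∀ h (p : ¬ D.Virt h), ε D.cls = D.mor h p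
  /-- A unitary diagram goes to the identity of the label of its edge. -/
  unitary : ∀ D : PlanarDiagram V, D.IsUnitary → ∀ h, ε D.cls = Arrow.mk (𝟙 (D.obj h))
  /-- A composition of diagrams goes to the composition of the values. -/
  comp : ∀ (D₁ D₂ : PlanarDiagram V) (hc : D₁.cod = D₂.dom),
    IsCompositeMor (ε D₂.cls) (ε D₁.cls) (ε (D₂.comp D₁ hc).cls)
  /-- An elementary diagram, i.e. a tensor product of prime and unitary diagrams, goes to the tensor
  product of their values. -/
  elementary : ∀ L : List (PlanarDiagram V), (∀ D ∈ L, D.IsPrime ∨ D.IsUnitary) →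
    ε (PlanarDiagram.tensorAll L).cls = tensorMors (L.map fun D => ε D.cls)

end Evaluation

end TensorCalculus

open TensorCalculus

/-! A planar diagram is a recipe for rewriting words. Label its edges, compatibly with their order,
by elements of a linearly ordered set (`IsLayout`). Each real vertex becomes a rule: it replaces the
subword of its incoming edges by the word of its outgoing edges, and it carries the morphism of the
vertex, tensored with identities on the untouched letters. The value of the diagram is the composite
morphism of a run which starts at the word of inputs and uses every rule once.

A run exists (`IsLayout.exists_run`). Let `S` be a set of real vertices closed under predecessors
(`Closed`), and write the edges leading out of `S` (`cut`) as an increasing word. If `S` is not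
everything, P1 provides a vertex outside `S` all of whose incoming edges lie in the cut. By P2 no
other edge of the cut lies between an incoming and an outgoing edge of this vertex
(`Enabled.not_between`). So its incoming edges form a segment of the word, and replacing them by the
outgoing edges gives the increasing word of the next cut. The cut thus moves from the inputs to the
outputs.

The value does not depend on the run (`Run.unique`). Different vertices consume disjoint sets of
edges and produce disjoint sets of edges, so a rule which can be applied stays applicable until it
is used. By the interchange law (`pad_swap`) it may be moved to the front of a run without changing
the value (`Run.move_front`), and two runs are compared rule by rule.

Runs can be juxtaposed and concatenated. This gives `PlanarDiagram.value_tensor` and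
`PlanarDiagram.value_comp`, hence existence and monoidality. For a composite, the shuffle order on
edges says exactly that both diagrams are labelled in one ordered set, with the outputs of the first
and the inputs of the second as a common word (`Glued`).

For uniqueness the same induction over closed sets is run with diagrams in place of morphisms: each
step grafts one elementary layer, a prime diagram between unitary ones
(`IsLayout.exists_constructible`). The composite so obtained has the same edge labels and the same
rules as the given diagram, and these determine a diagram up to isomorphism
(`IsLayout.nonempty_iso`). The defining properties of an evaluation fix its values on composites of
elementary diagrams. -/

namespace TensorCalculus

set_option linter.unusedSectionVars false

/-! ### The algebra of all morphisms of a strict tensor category -/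

section Algebra

variable {V : Type u} [Category.{v} V]

/-- Values are compared in `Arrow V`, where a composition with an `eqToHom` is invisible. Equations
between morphisms with propositionally equal sources and targets then need no transport. -/
theorem arrow_mk_eqToHom_comp {X Y Z : V} (p : X = Y) (f : Y ⟶ Z) :
    Arrow.mk (eqToHom p ≫ f) = Arrow.mk f := by
  subst p; simp

theorem arrow_mk_comp_eqToHom {X Y Z : V} (f : X ⟶ Y) (p : Y = Z) :
    Arrow.mk (f ≫ eqToHom p) = Arrow.mk f := by
  subst p; simp

open Classical in
/-- The composite `g ∘ f` of two elements of `Mor(V)`; if `f` and `g` are not composable, the value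
is `f`. -/
noncomputable def compArr (f g : Arrow V) : Arrow V :=
  if p : f.right = g.left then Arrow.mk (f.hom ≫ eqToHom p ≫ g.hom) else f

theorem compArr_mk {X Y Z : V} (f : X ⟶ Y) (g : Y ⟶ Z) :
    compArr (Arrow.mk f) (Arrow.mk g) = Arrow.mk (f ≫ g) := by
  simp [compArr]

theorem compArr_of {f g : Arrow V} (p : f.right = g.left) :
    compArr f g = Arrow.mk (f.hom ≫ eqToHom p ≫ g.hom) := dif_pos p

theorem exists_mk_mk {f g : Arrow V} (p : f.right = g.left) :
    ∃ (X Y Z : V) (a : X ⟶ Y) (b : Y ⟶ Z), f = Arrow.mk a ∧ g = Arrow.mk b := by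
  obtain ⟨X, Y, a⟩ := f
  obtain ⟨Y', Z, b⟩ := g
  obtain rfl : Y = Y' := p
  exact ⟨X, Y, Z, a, b, rfl, rfl⟩

theorem compArr_left {f g : Arrow V} (p : f.right = g.left) : (compArr f g).left = f.left := by
  rw [compArr_of p]; rfl

theorem compArr_right {f g : Arrow V} (p : f.right = g.left) : (compArr f g).right = g.right := by
  rw [compArr_of p]; rfl

theorem compArr_assoc {f g h : Arrow V} (p : f.right = g.left) (q : g.right = h.left) :
    compArr (compArr f g) h = compArr f (compArr g h) := by
  obtain ⟨X, Y, a⟩ := f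
  obtain ⟨Y', Z, b⟩ := g
  obtain ⟨Z', T, c⟩ := h
  obtain rfl : Y = Y' := p
  obtain rfl : Z = Z' := q
  change compArr (compArr (Arrow.mk a) (Arrow.mk b)) (Arrow.mk c) =
    compArr (Arrow.mk a) (compArr (Arrow.mk b) (Arrow.mk c))
  simp only [compArr_mk, Category.assoc]

theorem id_compArr {X : V} {f : Arrow V} (p : f.left = X) : compArr (Arrow.mk (𝟙 X)) f = f := by
  subst p
  exact (compArr_mk (𝟙 _) f.hom).trans (by simp)

theorem compArr_id {X : V} {f : Arrow V} (p : f.right = X) : compArr f (Arrow.mk (𝟙 X)) = f := by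
  subst p
  exact (compArr_mk f.hom (𝟙 _)).trans (by simp)

variable [MonoidalCategory V]

theorem isCompositeMor_iff {f g k : Arrow V} :
    IsCompositeMor g f k ↔ f.right = g.left ∧ k = compArr f g := by
  constructor
  · rintro ⟨p, e⟩
    exact ⟨p, e.trans (compArr_of p).symm⟩
  · rintro ⟨p, e⟩
    exact ⟨p, e.trans (compArr_of p)⟩

theorem tensorMor_mk {X Y X' Y' : V} (f : X ⟶ Y) (g : X' ⟶ Y') :
    tensorMor (Arrow.mk f) (Arrow.mk g) = Arrow.mk (MonoidalCategoryStruct.tensorHom f g) := rfl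

theorem tensorMor_left (f g : Arrow V) :
    (tensorMor f g).left = MonoidalCategoryStruct.tensorObj f.left g.left := rfl

theorem tensorMor_right (f g : Arrow V) :
    (tensorMor f g).right = MonoidalCategoryStruct.tensorObj f.right g.right := rfl

theorem tensorMor_id (X Y : V) : tensorMor (Arrow.mk (𝟙 X)) (Arrow.mk (𝟙 Y)) =
    Arrow.mk (𝟙 (MonoidalCategoryStruct.tensorObj X Y)) := by
  rw [tensorMor_mk]; simp

/-- The interchange law. -/
theorem tensorMor_compArr {f g f' g' : Arrow V} (p : f.right = g.left) (p' : f'.right = g'.left) :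
    tensorMor (compArr f g) (compArr f' g') = compArr (tensorMor f f') (tensorMor g g') := by
  obtain ⟨X, Y, Z, a, b, rfl, rfl⟩ := exists_mk_mk p
  obtain ⟨X', Y', Z', a', b', rfl, rfl⟩ := exists_mk_mk p'
  simp only [compArr_mk, tensorMor_mk, MonoidalCategory.tensorHom_comp_tensorHom]

variable [StrictTensorCategory V]

/-- The associators of a strict category are `eqToHom`s, so naturality of the associator becomes an
honest equation in `Arrow V`. The unit laws below follow from the unitors in the same way. -/
theorem tensorMor_assoc (f g h : Arrow V) :
    tensorMor (tensorMor f g) h = tensorMor f (tensorMor g h) := by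
  have e := MonoidalCategory.associator_naturality f.hom g.hom h.hom
  rw [StrictTensorCategory.associator_eq, StrictTensorCategory.associator_eq] at e
  have := congrArg Arrow.mk e
  rwa [eqToIso.hom, eqToIso.hom, arrow_mk_eqToHom_comp, arrow_mk_comp_eqToHom] at this

theorem unit_tensorMor (f : Arrow V) :
    tensorMor (Arrow.mk (𝟙 (MonoidalCategoryStruct.tensorUnit V))) f = f := by
  have e := MonoidalCategory.leftUnitor_naturality f.hom
  rw [StrictTensorCategory.leftUnitor_eq, StrictTensorCategory.leftUnitor_eq] at e
  have := congrArg Arrow.mk e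
  rw [eqToIso.hom, eqToIso.hom, arrow_mk_eqToHom_comp, arrow_mk_comp_eqToHom] at this
  rw [← MonoidalCategory.id_tensorHom] at this
  exact this

theorem tensorMor_unit (f : Arrow V) :
    tensorMor f (Arrow.mk (𝟙 (MonoidalCategoryStruct.tensorUnit V))) = f := by
  have e := MonoidalCategory.rightUnitor_naturality f.hom
  rw [StrictTensorCategory.rightUnitor_eq, StrictTensorCategory.rightUnitor_eq] at e
  have := congrArg Arrow.mk e
  rw [eqToIso.hom, eqToIso.hom, arrow_mk_eqToHom_comp, arrow_mk_comp_eqToHom] at this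
  rw [← MonoidalCategory.tensorHom_id] at this
  exact this

theorem tensorWord_append (a b : List V) : tensorWord (a ++ b) =
    MonoidalCategoryStruct.tensorObj (tensorWord a) (tensorWord b) := by
  induction a with
  | nil => exact (StrictTensorCategory.unit_tensor _).symm
  | cons x a ih =>
    change MonoidalCategoryStruct.tensorObj x (tensorWord (a ++ b)) = _
    rw [ih]
    exact (StrictTensorCategory.tensor_assoc _ _ _).symm

end Algebra

/-! ### Rewriting of words of edges -/

section Rewriting

variable {E E' : Type} {V : Type u} [Category.{v} V] [MonoidalCategory V]

/-- A rule, which replaces the subword `ins` of a word of edges by `outs`, with a morphism. -/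
@[ext] structure Rule (E : Type) (V : Type u) [Category.{v} V] where
  ins : List E
  outs : List E
  mor : Arrow V

/-- The image of a rule under a map of edges. -/
def Rule.map (φ : E → E') (p : Rule E V) : Rule E' V := ⟨p.ins.map φ, p.outs.map φ, p.mor⟩

/-- The identity of the tensor product of the objects of a word of edges. -/
def idW (ob : E → V) (w : List E) : Arrow V := Arrow.mk (𝟙 (tensorWord (w.map ob)))

/-- The tensor product of `f` with the identities of two words of edges. -/
def pad (ob : E → V) (L : List E) (f : Arrow V) (M : List E) : Arrow V :=
  tensorMor (idW ob L) (tensorMor f (idW ob M))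

/-- `Run ob w l w' f`: the rules of the list `l`, applied one after the other, rewrite the word `w`
to the word `w'`, and `f` is the composite of the corresponding morphisms. -/
inductive Run (ob : E → V) : List E → List (Rule E V) → List E → Arrow V → Prop
  | nil (w : List E) : Run ob w [] w (idW ob w)
  | step (L : List E) (p : Rule E V) (M : List E) {l : List (Rule E V)} {w : List E} {f : Arrow V} :
      -- `compArr` returns its first argument when the two morphisms do not compose. These two
      -- equations guarantee that every composite in a run is a genuine one.
      p.mor.left = tensorWord (p.ins.map ob) → p.mor.right = tensorWord (p.outs.map ob) →
      Run ob (L ++ (p.outs ++ M)) l w f →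
      Run ob (L ++ (p.ins ++ M)) (p :: l) w (compArr (pad ob L p.mor M) f)

variable {ob : E → V}

/-! ### Padding by identities, interchange, and the calculus of runs. -/

section

variable [StrictTensorCategory V]

theorem idW_append (a b : List E) : idW ob (a ++ b) = tensorMor (idW ob a) (idW ob b) := by
  unfold idW
  rw [tensorMor_id, List.map_append, tensorWord_append]

theorem idW_nil_tensor (f : Arrow V) : tensorMor (idW ob []) f = f := unit_tensorMor f

theorem tensor_idW_nil (f : Arrow V) : tensorMor f (idW ob []) = f := tensorMor_unit f

theorem pad_left {L M w : List E} {f : Arrow V} (h : f.left = tensorWord (w.map ob)) :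
    (pad ob L f M).left = tensorWord ((L ++ (w ++ M)).map ob) := by
  simp only [pad, tensorMor_left, List.map_append, tensorWord_append, h]; rfl

theorem pad_right {L M w : List E} {f : Arrow V} (h : f.right = tensorWord (w.map ob)) :
    (pad ob L f M).right = tensorWord ((L ++ (w ++ M)).map ob) := by
  simp only [pad, tensorMor_right, List.map_append, tensorWord_append, h]; rfl

theorem pad_pad (L L' M M' : List E) (f : Arrow V) :
    pad ob L (pad ob L' f M') M = pad ob (L ++ L') f (M' ++ M) := by
  simp only [pad, idW_append, tensorMor_assoc]

theorem pad_idW (L w M : List E) : pad ob L (idW ob w) M = idW ob (L ++ (w ++ M)) := by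
  simp only [pad, idW_append]

theorem pad_nil_nil (f : Arrow V) : pad ob [] f [] = f := by
  rw [pad, tensor_idW_nil, idW_nil_tensor]

theorem idW_comp_idW (w : List E) : compArr (idW ob w) (idW ob w) = idW ob w := id_compArr rfl

theorem pad_compArr (L M : List E) {f g : Arrow V} (p : f.right = g.left) :
    pad ob L (compArr f g) M = compArr (pad ob L f M) (pad ob L g M) := by
  unfold pad
  rw [← tensorMor_compArr rfl (by rw [tensorMor_left, tensorMor_right, p]; rfl),
    ← tensorMor_compArr p rfl, idW_comp_idW, idW_comp_idW]

/-- Interchange, with one identity in each factor: act by `f` first. `tensor_eq_right` acts by `g`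
first; the agreement of the two is why rules on disjoint subwords commute. -/
theorem tensor_eq_left {f g : Arrow V} {b c : List E}
    (fr : f.right = tensorWord (b.map ob)) (gl : g.left = tensorWord (c.map ob)) :
    compArr (tensorMor f (idW ob c)) (tensorMor (idW ob b) g) = tensorMor f g := by
  rw [← tensorMor_compArr fr gl.symm]
  congr 1
  · exact compArr_id fr
  · exact id_compArr gl

theorem tensor_eq_right {f g : Arrow V} {a d : List E}
    (fl : f.left = tensorWord (a.map ob)) (gr : g.right = tensorWord (d.map ob)) :
    compArr (tensorMor (idW ob a) g) (tensorMor f (idW ob d)) = tensorMor f g := by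
  rw [← tensorMor_compArr fl.symm gr]
  congr 1
  · exact id_compArr fl
  · exact compArr_id gr

/-- Two rules which apply to disjoint subwords commute. -/
theorem pad_swap {f g : Arrow V} {a b c d : List E} (L N M : List E)
    (fl : f.left = tensorWord (a.map ob)) (fr : f.right = tensorWord (b.map ob))
    (gl : g.left = tensorWord (c.map ob)) (gr : g.right = tensorWord (d.map ob)) :
    compArr (pad ob L f (N ++ (c ++ M))) (pad ob (L ++ (b ++ N)) g M) =
      compArr (pad ob (L ++ (a ++ N)) g M) (pad ob L f (N ++ (d ++ M))) := by
  -- Absorbing everything between `L` and `M` into the middle factor turns both sides into paddings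
  -- of the same morphism, `f` tensored with the identity of `N` and with `g`.
  have e1 : ∀ x, pad ob L f (N ++ (x ++ M)) =
      pad ob L (tensorMor f (idW ob (N ++ x))) M := by
    intro x; simp only [pad, idW_append, tensorMor_assoc]
  have e2 : ∀ x, pad ob (L ++ (x ++ N)) g M =
      pad ob L (tensorMor (idW ob x) (tensorMor (idW ob N) g)) M := by
    intro x; simp only [pad, idW_append, tensorMor_assoc]
  have hl : (tensorMor (idW ob N) g).left = tensorWord ((N ++ c).map ob) := by
    rw [tensorMor_left, gl, List.map_append, tensorWord_append]; rfl
  have hr : (tensorMor (idW ob N) g).right = tensorWord ((N ++ d).map ob) := by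
    rw [tensorMor_right, gr, List.map_append, tensorWord_append]; rfl
  rw [e1, e1, e2, e2, ← pad_compArr, ← pad_compArr, tensor_eq_left fr hl,
    tensor_eq_right fl hr]
  · rw [tensorMor_left, tensorMor_right, hr, fl]; rfl
  · rw [tensorMor_left, tensorMor_right, hl, fr]; rfl

namespace Run

theorem left_right {w w' : List E} {l : List (Rule E V)} {f : Arrow V} (r : Run ob w l w' f) :
    f.left = tensorWord (w.map ob) ∧ f.right = tensorWord (w'.map ob) := by
  induction r with
  | nil w => exact ⟨rfl, rfl⟩
  | step L p M hl hr r ih =>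
    have := (pad_right (L := L) (M := M) hr).trans ih.1.symm
    exact ⟨(compArr_left this).trans (pad_left hl), (compArr_right this).trans ih.2⟩

theorem append {w w' w'' : List E} {l l' : List (Rule E V)} {f g : Arrow V}
    (r : Run ob w l w' f) (s : Run ob w' l' w'' g) : Run ob w (l ++ l') w'' (compArr f g) := by
  induction r with
  | nil w =>
    rw [idW, id_compArr s.left_right.1]
    exact s
  | step L p M hl hr r ih =>
    have := step L p M hl hr (ih s)
    rwa [compArr_assoc ((pad_right hr).trans r.left_right.1.symm)
      (r.left_right.2.trans s.left_right.1.symm)]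

theorem pad {w w' : List E} {l : List (Rule E V)} {f : Arrow V} (r : Run ob w l w' f)
    (L M : List E) : Run ob (L ++ (w ++ M)) l (L ++ (w' ++ M)) (pad ob L f M) := by
  induction r with
  | nil w =>
    rw [pad_idW]
    exact .nil _
  | step L' p M' hl hr r ih =>
    rw [pad_compArr _ _ ((pad_right hr).trans r.left_right.1.symm), pad_pad]
    have := step (L ++ L') p (M' ++ M) hl hr (l := _) (w := _) (f := _) (by
      simpa only [List.append_assoc] using ih)
    simpa only [List.append_assoc] using this

/-- Run the first list with the word `c` idle on the right, then the second list with the word `b`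
idle on the left; interchange turns the composite into a tensor product. -/
theorem tensor {a b c d : List E} {l l' : List (Rule E V)} {f g : Arrow V}
    (r : Run ob a l b f) (s : Run ob c l' d g) :
    Run ob (a ++ c) (l ++ l') (b ++ d) (tensorMor f g) := by
  have h := (r.pad [] c).append (by simpa using s.pad b [])
  simp only [TensorCalculus.pad, idW_nil_tensor, tensor_idW_nil, List.nil_append] at h
  rwa [tensor_eq_left r.left_right.2 s.left_right.1] at h

end Run

end

theorem idW_map {ob' : E' → V} {φ : E → E'} (hφ : ∀ e, ob' (φ e) = ob e) (w : List E) :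
    idW ob' (w.map φ) = idW ob w := by
  unfold idW
  rw [List.map_map, show ob' ∘ φ = ob from funext hφ]

/-- Only the objects of the letters enter the morphisms, so a relabelling which preserves objects
keeps the value. This carries a run from one layout to another. -/
theorem Run.map {ob' : E' → V} {φ : E → E'} (hφ : ∀ e, ob' (φ e) = ob e) {w w' : List E}
    {l : List (Rule E V)} {f : Arrow V} (r : Run ob w l w' f) :
    Run ob' (w.map φ) (l.map (Rule.map φ)) (w'.map φ) f := by
  have key : ∀ w : List E, (w.map φ).map ob' = w.map ob := fun w => by
    rw [List.map_map, show ob' ∘ φ = ob from funext hφ]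
  induction r with
  | nil w => rw [← idW_map hφ]; exact .nil _
  | step L p M hl hr r ih =>
    have := Run.step (ob := ob') (L.map φ) (p.map φ) (M.map φ) (l := _) (w := _) (f := _)
      (by rw [Rule.map, key]; exact hl) (by rw [Rule.map, key]; exact hr) (by
        simpa only [List.map_append, Rule.map] using ih)
    simpa only [List.map_append, Rule.map, TensorCalculus.pad, idW_map hφ, List.map_cons] using this

/-! #### The value does not depend on the order of the rules -/

/-- If two occurrences of `x` began at different places, the first letter of `x` would be repeated.
In a word without repetitions a rule therefore determines the place where it acts. -/
theorem append_unique_of_nodup {a b c d x : List E} (hx : x ≠ []) (n : (a ++ (x ++ b)).Nodup)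
    (e : a ++ (x ++ b) = c ++ (x ++ d)) : a = c ∧ b = d := by
  obtain ⟨y, x, rfl⟩ := List.exists_cons_of_ne_nil hx
  have key : a = c := by
    rw [List.append_eq_append_iff] at e
    rcases e with ⟨t, rfl, ht⟩ | ⟨t, rfl, ht⟩
    · rcases t with _ | ⟨z, t⟩
      · simp
      · obtain ⟨rfl, -⟩ : y = z ∧ _ := by simpa using ht
        rw [ht] at n
        simp [List.nodup_append] at n
    · rcases t with _ | ⟨z, t⟩
      · simp
      · obtain ⟨rfl, -⟩ : y = z ∧ _ := by simpa using ht
        simp [List.nodup_append] at n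
  subst key
  exact ⟨rfl, by simpa using e⟩

/-- Nonempty subwords without a common letter cannot overlap, so one of them lies to the left of the
other, with some word `N` in between. -/
theorem append_disjoint_cases {a b c d x y : List E} (hx : x ≠ []) (hy : y ≠ [])
    (dis : ∀ e ∈ x, e ∉ y) (e : a ++ (x ++ b) = c ++ (y ++ d)) :
    (∃ N, c = a ++ (x ++ N) ∧ b = N ++ (y ++ d)) ∨
      ∃ N, a = c ++ (y ++ N) ∧ d = N ++ (x ++ b) := by
  have main : ∀ {a b c d x y : List E}, y ≠ [] → (∀ e ∈ x, e ∉ y) → x ≠ [] →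
      ∀ t, c = a ++ t → x ++ b = t ++ (y ++ d) →
      ∃ N, c = a ++ (x ++ N) ∧ b = N ++ (y ++ d) := by
    intro a b c d x y hy dis hx t hc ht
    rw [List.append_eq_append_iff] at ht
    rcases ht with ⟨s, rfl, hs⟩ | ⟨s, rfl, hs⟩
    · exact ⟨s, hc, hs⟩
    · rcases s with _ | ⟨z, s⟩
      · exact ⟨[], by simpa using hc, by simpa using hs.symm⟩
      · obtain ⟨z', y, rfl⟩ := List.exists_cons_of_ne_nil hy
        obtain ⟨rfl, -⟩ : z' = z ∧ _ := by simpa using hs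
        exact absurd (List.mem_cons_self) (dis z' (by simp))
  rcases List.append_eq_append_iff.1 e with ⟨t, hc, ht⟩ | ⟨t, hc, ht⟩
  · exact Or.inl (main hy dis hx t hc ht)
  · exact Or.inr (main hx (fun e h h' => dis e h' h) hy t hc ht)

/-- The conditions under which the order of the rules does not matter. -/
structure Separated (w : List E) (l : List (Rule E V)) : Prop where
  nodup : w.Nodup
  ins_ne : ∀ p ∈ l, p.ins ≠ []
  outs_nodup : ∀ p ∈ l, p.outs.Nodup
  outs_word : ∀ p ∈ l, ∀ e ∈ p.outs, e ∉ w
  ins_ins : l.Pairwise fun p q => ∀ e ∈ p.ins, e ∉ q.ins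
  outs_outs : l.Pairwise fun p q => ∀ e ∈ p.outs, e ∉ q.outs

theorem Separated.perm {w : List E} {l l' : List (Rule E V)} (s : Separated w l) (h : l.Perm l') :
    Separated w l' where
  nodup := s.nodup
  ins_ne := fun p m => s.ins_ne p (h.mem_iff.2 m)
  outs_nodup := fun p m => s.outs_nodup p (h.mem_iff.2 m)
  outs_word := fun p m => s.outs_word p (h.mem_iff.2 m)
  ins_ins := (h.pairwise_iff fun h e m m' => h e m' m).1 s.ins_ins
  outs_outs := (h.pairwise_iff fun h e m m' => h e m' m).1 s.outs_outs

/-- The letters added by the first rule occur neither in the old word nor among the outputs of later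
rules. So the new word has no repetitions and still avoids those outputs. -/
theorem Separated.tail {L M : List E} {p : Rule E V} {l : List (Rule E V)}
    (s : Separated (L ++ (p.ins ++ M)) (p :: l)) : Separated (L ++ (p.outs ++ M)) l := by
  have hw := s.outs_word p List.mem_cons_self
  have hn := s.nodup
  have ho := s.outs_nodup p List.mem_cons_self
  refine ⟨?_, fun q m => s.ins_ne q (List.mem_cons_of_mem _ m),
    fun q m => s.outs_nodup q (List.mem_cons_of_mem _ m), fun q m e he hew => ?_,
    (List.pairwise_cons.1 s.ins_ins).2, (List.pairwise_cons.1 s.outs_outs).2⟩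
  · simp only [List.nodup_append, List.mem_append] at hn hw ⊢
    grind
  · have := s.outs_word q (List.mem_cons_of_mem _ m) e he
    have h2 := (List.pairwise_cons.1 s.outs_outs).1 q m e
    simp only [List.mem_append] at this hew
    grind

variable [StrictTensorCategory V]

/-- A rule whose input is a subword of the present word can be applied at once. By induction on the
rules that precede it: the first of them has inputs disjoint from those of `p`, hence leaves the
subword `p.ins` intact; the induction hypothesis brings `p` directly behind that rule, and
`pad_swap` exchanges the two. -/
theorem Run.move_front {p : Rule E V} (l₁ : List (Rule E V)) {l₂ : List (Rule E V)}
    {L M w : List E} {f : Arrow V} (s : Separated (L ++ (p.ins ++ M)) (l₁ ++ p :: l₂))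
    (r : Run ob (L ++ (p.ins ++ M)) (l₁ ++ p :: l₂) w f) :
    ∃ g, Run ob (L ++ (p.outs ++ M)) (l₁ ++ l₂) w g ∧ f = compArr (TensorCalculus.pad ob L p.mor M) g ∧
      p.mor.left = tensorWord (p.ins.map ob) ∧ p.mor.right = tensorWord (p.outs.map ob) := by
  induction l₁ generalizing L M f with
  | nil =>
    generalize hw : L ++ (p.ins ++ M) = w₀ at r
    rw [List.nil_append] at r
    cases r with
    | step L' p M' hl hr r =>
      -- The run applies `p` at a place of its own, which must be the prescribed one.
      obtain ⟨rfl, rfl⟩ := append_unique_of_nodup (s.ins_ne p (by simp)) s.nodup hw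
      exact ⟨_, r, rfl, hl, hr⟩
  | cons q l₁ ih =>
    generalize hw : L ++ (p.ins ++ M) = w₀ at r
    rw [List.cons_append] at r
    cases r with
    | step L' q M' hl hr r =>
      have dis : ∀ e ∈ p.ins, e ∉ q.ins := fun e he h =>
        (List.pairwise_cons.1 s.ins_ins).1 p (by simp) e h he
      have st := s
      rw [hw, List.cons_append] at st
      replace st := st.tail
      -- Either `q` acts to the right of `p`, or to the left of it; `N` is the word between the two.
      rcases append_disjoint_cases (s.ins_ne p (by simp)) (s.ins_ne q (by simp)) dis hw with
        ⟨N, rfl, rfl⟩ | ⟨N, rfl, rfl⟩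
      · have e : ∀ x y : List E, (L ++ (x ++ N)) ++ (y ++ M') = L ++ (x ++ (N ++ (y ++ M'))) := by
          simp
        rw [e] at r st
        obtain ⟨g, rg, rfl, pl, pr⟩ := ih st r
        have h1 := Run.step (L ++ (p.outs ++ N)) q M' hl hr (l := _) (w := _) (f := _)
          (by rw [e]; exact rg)
        rw [e] at h1
        have rgl := rg.left_right.1
        refine ⟨_, h1, ?_, pl, pr⟩
        rw [← compArr_assoc, ← compArr_assoc, pad_swap L N M' pl pr hl hr]
        · rw [pad_right pr, pad_left hl, e]
        · rw [pad_right hr, rgl, e]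
        · rw [pad_right hr, pad_left pl, e]
        · rw [pad_right pr, rgl]
      · have e : ∀ x y : List E, L' ++ (x ++ (N ++ (y ++ M))) = (L' ++ (x ++ N)) ++ (y ++ M) := by
          simp
        rw [e] at r st
        obtain ⟨g, rg, rfl, pl, pr⟩ := ih st r
        have h1 := Run.step L' q (N ++ (p.outs ++ M)) hl hr (l := _) (w := _) (f := _)
          (by rw [e]; exact rg)
        rw [e] at h1
        have rgl := rg.left_right.1
        refine ⟨_, h1, ?_, pl, pr⟩
        rw [← compArr_assoc, ← compArr_assoc, pad_swap L' N M hl hr pl pr]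
        · rw [pad_right pr, pad_left hl, e]
        · rw [pad_right hr, rgl, e]
        · rw [pad_right hr, pad_left pl, e]
        · rw [pad_right pr, rgl]

/-- The first rule of one run is applicable to the initial word, so it can be moved to the front of
the other run; then both runs continue from the same word with permuted lists of rules. -/
theorem Run.unique {w w' w'' : List E} {l l' : List (Rule E V)} {f g : Arrow V}
    (s : Separated w l) (h : l.Perm l') (r : Run ob w l w' f) (r' : Run ob w l' w'' g) :
    w' = w'' ∧ f = g := by
  induction r generalizing l' g with
  | nil w =>
    cases h.nil_eq
    cases r'
    exact ⟨rfl, rfl⟩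
  | step L p M hl hr r ih =>
    obtain ⟨l₁, l₂, rfl⟩ := List.append_of_mem (h.mem_iff.1 List.mem_cons_self)
    obtain ⟨g, rg, rfl, -⟩ := r'.move_front l₁ (s.perm h)
    obtain ⟨rfl, rfl⟩ := ih s.tail ((List.perm_cons p).1 (h.trans List.perm_middle)) rg
    exact ⟨rfl, rfl⟩

end Rewriting

/-! ### Sorted lists -/

section SortedLists

variable {E : Type} [LinearOrder E]

/-- Because of this, words of edges are identified below by their sets of letters alone. -/
theorem eq_of_sorted {l l' : List E} (p : l.Pairwise (· < ·)) (p' : l'.Pairwise (· < ·))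
    (m : ∀ e, e ∈ l ↔ e ∈ l') : l = l' :=
  ((List.perm_ext_iff_of_nodup (p.imp ne_of_lt) (p'.imp ne_of_lt)).2 m).eq_of_pairwise'
    (p.imp le_of_lt) (p'.imp le_of_lt)

/-- A segment of a sorted word may be replaced by another sorted word. -/
theorem exists_replace_segment {w A B : List E} (hw : w.Pairwise (· < ·))
    (hA : A.Pairwise (· < ·)) (hB : B.Pairwise (· < ·)) (A_ne : A ≠ []) (B_ne : B ≠ [])
    (Aw : ∀ a ∈ A, a ∈ w) (Bw : ∀ b ∈ B, b ∉ w) (AB : ∀ a ∈ A, ∀ b ∈ B, a < b)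
    (btw : ∀ x ∈ w, x ∉ A → ∀ a ∈ A, ∀ b ∈ B, a < x → ¬ x < b) :
    ∃ L M, w = L ++ (A ++ M) ∧ (L ++ (B ++ M)).Pairwise (· < ·) ∧
      ∀ e, e ∈ L ++ (B ++ M) ↔ (e ∈ w ∧ e ∉ A) ∨ e ∈ B := by
  classical
  obtain ⟨a₀, ha₀⟩ := List.exists_mem_of_ne_nil A A_ne
  obtain ⟨b₀, hb₀⟩ := List.exists_mem_of_ne_nil B B_ne
  -- What remains of `w` splits into the letters below all of `A` and the letters above all of `B`:
  -- by `btw`, a letter that exceeds some element of `A` is not below any element of `B`.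
  set L := w.filter fun x => ∀ a ∈ A, x < a with hL
  set M := w.filter fun x => ∀ b ∈ B, b < x with hM
  have mL : ∀ x, x ∈ L ↔ x ∈ w ∧ ∀ a ∈ A, x < a := fun x => by simp [hL]
  have mM : ∀ x, x ∈ M ↔ x ∈ w ∧ ∀ b ∈ B, b < x := fun x => by simp [hM]
  have pL : L.Pairwise (· < ·) := hw.filter _
  have pM : M.Pairwise (· < ·) := hw.filter _
  have LM : ∀ x ∈ w, x ∉ A → x ∈ L ∨ x ∈ M := by
    intro x hx hxA
    by_cases c : ∀ a ∈ A, x < a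
    · exact Or.inl ((mL x).2 ⟨hx, c⟩)
    · push Not at c
      obtain ⟨a, ha, hax⟩ := c
      have hax' : a < x := lt_of_le_of_ne hax fun e => hxA (e ▸ ha)
      refine Or.inr ((mM x).2 ⟨hx, fun b hb => ?_⟩)
      exact lt_of_le_of_ne (not_lt.1 (btw x hx hxA a ha b hb hax')) fun e => Bw b hb (e ▸ hx)
  refine ⟨L, M, eq_of_sorted hw ?_ ?_, ?_, ?_⟩
  · simp only [List.pairwise_append, List.mem_append]
    refine ⟨pL, ⟨hA, pM, fun a ha m hm => (AB a ha b₀ hb₀).trans (((mM m).1 hm).2 b₀ hb₀)⟩, ?_⟩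
    rintro x hx y (hy | hy)
    · exact ((mL x).1 hx).2 y hy
    · exact (((mL x).1 hx).2 a₀ ha₀).trans ((AB a₀ ha₀ b₀ hb₀).trans (((mM y).1 hy).2 b₀ hb₀))
  · intro e
    simp only [List.mem_append]
    constructor
    · intro he
      by_cases c : e ∈ A
      · exact Or.inr (Or.inl c)
      · exact (LM e he c).imp_right Or.inr
    · rintro (h | h | h)
      exacts [((mL e).1 h).1, Aw e h, ((mM e).1 h).1]
  · simp only [List.pairwise_append, List.mem_append]
    refine ⟨pL, ⟨hB, pM, fun b hb m hm => ((mM m).1 hm).2 b hb⟩, ?_⟩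
    rintro x hx y (hy | hy)
    · exact (((mL x).1 hx).2 a₀ ha₀).trans (AB a₀ ha₀ y hy)
    · exact (((mL x).1 hx).2 a₀ ha₀).trans ((AB a₀ ha₀ b₀ hb₀).trans (((mM y).1 hy).2 b₀ hb₀))
  · intro e
    simp only [List.mem_append]
    constructor
    · rintro (h | h | h)
      · exact Or.inl ⟨((mL e).1 h).1, fun c => lt_irrefl _ (((mL e).1 h).2 e c)⟩
      · exact Or.inr h
      · exact Or.inl ⟨((mM e).1 h).1, fun c =>
          lt_asymm (AB e c b₀ hb₀) (((mM e).1 h).2 b₀ hb₀)⟩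
    · rintro (⟨h, h'⟩ | h)
      · exact (LM e h h').imp_right Or.inr
      · exact Or.inr (Or.inl h)

/-- A total preorder is induced by a map to a linear order. -/
theorem exists_linearOrder {H : Type} (r : H → H → Prop) (total : ∀ h k, r h k ∨ r k h)
    (trans : ∀ h k l, r h k → r k l → r h l) :
    ∃ (E : Type) (_ : LinearOrder E) (θ : H → E), Function.Surjective θ ∧
      ∀ h k, r h k ↔ θ h ≤ θ k := by
  classical
  let s : Setoid H :=
    { r := fun h k => r h k ∧ r k h
      iseqv := ⟨fun h => by rcases total h h with p | p <;> exact ⟨p, p⟩, fun p => ⟨p.2, p.1⟩,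
        fun p q => ⟨trans _ _ _ p.1 q.1, trans _ _ _ q.2 p.2⟩⟩ }
  let le : Quotient s → Quotient s → Prop := Quotient.lift₂ r (by
    rintro a b c d ⟨h₁, h₂⟩ ⟨h₃, h₄⟩
    exact propext ⟨fun p => trans _ _ _ h₂ (trans _ _ _ p h₃),
      fun p => trans _ _ _ h₁ (trans _ _ _ p h₄)⟩)
  let o : LinearOrder (Quotient s) :=
    { le := le
      le_refl := by
        rintro ⟨a⟩
        rcases total a a with p | p <;> exact p
      le_trans := by
        rintro ⟨a⟩ ⟨b⟩ ⟨c⟩ p q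
        exact trans a b c p q
      le_antisymm := by
        rintro ⟨a⟩ ⟨b⟩ p q
        exact Quotient.sound ⟨p, q⟩
      le_total := by
        rintro ⟨a⟩ ⟨b⟩
        exact total a b
      toDecidableLE := Classical.decRel _ }
  exact ⟨Quotient s, o, Quotient.mk s, Quotient.mk_surjective, fun _ _ => Iff.rfl⟩

end SortedLists

/-! ### Closed sets of half-edges -/

namespace PlanarGraph

open PreGraph DirectedGraph

variable {Γ : PlanarGraph}

/-- `h` lies on an input edge if and only if its edge has no source. -/
theorem exists_inLegs_iff (h : Γ.H) : (∃ i ∈ Γ.inLegs, Γ.SameEdge h i) ↔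
    ∀ b, Γ.SameEdge h b → Γ.sgn b = false → Γ.Virt b := by
  constructor
  · rintro ⟨i, hi, e⟩ b eb sb
    rcases hi.1 with p | p
    · rcases e.symm.trans eb with q | q
      · rw [q, hi.2] at sb; simp at sb
      · rw [q, p, hi.2] at sb; simp at sb
    · exact p.sameEdge (e.symm.trans eb)
  · intro c
    obtain ⟨i, hi, p⟩ := exists_in_leads h
    rcases p with p | p
    · exact ⟨i, hi, p.symm⟩
    -- If all negative halves of the edge of `y` are virtual, a step into `y` passes through a
    -- virtual vertex. That vertex is a single edge, so the step stays on this edge.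
    · have key : ∀ {x y}, Γ.Step x y → (∀ b, Γ.SameEdge y b → Γ.sgn b = false → Γ.Virt b) →
          Γ.SameEdge x y := by
        rintro x y ⟨a, b, ea, eb, sa, sb, ab⟩ c
        exact ea.trans ((Γ.virt_deg b a (c b eb sb) (Γ.vtx.symm ab)).symm.trans eb.symm)
      suffices Γ.SameEdge i h from ⟨i, hi, this.symm⟩
      induction p with
      | single s => exact key s c
      | @tail m k s t ih =>
        have e := key t c
        exact (ih fun b eb => c b (e.symm.trans eb)).trans e

/-- `h` lies on an output edge if and only if its edge has no target. -/
theorem exists_outLegs_iff (h : Γ.H) : (∃ o ∈ Γ.outLegs, Γ.SameEdge h o) ↔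
    ∀ a, Γ.SameEdge h a → Γ.sgn a = true → Γ.Virt a := by
  constructor
  · rintro ⟨i, hi, e⟩ b eb sb
    rcases hi.1 with p | p
    · rcases e.symm.trans eb with q | q
      · rw [q, hi.2] at sb; simp at sb
      · rw [q, p, hi.2] at sb; simp at sb
    · exact p.sameEdge (e.symm.trans eb)
  · intro c
    obtain ⟨i, hi, p⟩ := exists_out_leads h
    rcases p with p | p
    · exact ⟨i, hi, p⟩
    · have key : ∀ {x y}, Γ.Step x y → (∀ a, Γ.SameEdge x a → Γ.sgn a = true → Γ.Virt a) →
          Γ.SameEdge x y := by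
        rintro x y ⟨a, b, ea, eb, sa, sb, ab⟩ c
        exact ea.trans ((Γ.virt_deg a b (c a ea sa) ab).trans eb.symm)
      suffices Γ.SameEdge h i from ⟨i, hi, this⟩
      induction p using Relation.TransGen.head_induction_on with
      | single s => exact key s c
      | head s t ih =>
        have e := key s c
        exact e.trans (ih fun b eb => c b (e.trans eb))

variable (Γ) in
/-- A set of half-edges which consists of real vertices, and which with the target of an edge
contains its source. -/
structure Closed (S : Set Γ.H) : Prop where
  not_virt : ∀ h ∈ S, ¬ Γ.Virt h
  sat : ∀ h k, Γ.vtx h k → h ∈ S → k ∈ S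
  down : ∀ a b, Γ.SameEdge a b → Γ.sgn a = true → Γ.sgn b = false → a ∈ S → b ∈ S

variable (Γ) in
/-- The real vertex of `r` may be added to the closed set `S`. -/
structure Enabled (S : Set Γ.H) (r : Γ.H) : Prop where
  not_virt : ¬ Γ.Virt r
  not_mem : r ∉ S
  down : ∀ a b, Γ.vtx r a → Γ.SameEdge a b → Γ.sgn a = true → Γ.sgn b = false → b ∈ S

variable (Γ) in
/-- The half-edges of the edges which lead out of the closed set `S`. -/
def cut (S : Set Γ.H) : Set Γ.H :=
  -- The first condition is vacuous for input edges and for virtual edges, so every cut contains the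
  -- input edges that have not yet ended in `S`, and the cut of a closed set contains all virtual
  -- edges.
  {h | (∀ b, Γ.SameEdge h b → Γ.sgn b = false → ¬ Γ.Virt b → b ∈ S) ∧
    ∀ a, Γ.SameEdge h a → Γ.sgn a = true → a ∉ S}

theorem cut_sameEdge {S : Set Γ.H} {h k : Γ.H} (e : Γ.SameEdge h k) (p : h ∈ Γ.cut S) :
    k ∈ Γ.cut S :=
  ⟨fun b eb => p.1 b (e.trans eb), fun a ea => p.2 a (e.trans ea)⟩

theorem Closed.empty : Γ.Closed ∅ := ⟨nofun, nofun, nofun⟩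

theorem Closed.insert {S : Set Γ.H} {r : Γ.H} (c : Γ.Closed S) (e : Γ.Enabled S r) :
    Γ.Closed (S ∪ {k | Γ.vtx r k}) where
  not_virt := by
    rintro h (p | p)
    exacts [c.not_virt h p, not_virt_of_vtx p e.not_virt]
  sat := by
    rintro h k v (p | p)
    exacts [Or.inl (c.sat h k v p), Or.inr (Γ.vtx.trans p v)]
  down := by
    rintro a b ab sa sb (p | p)
    exacts [Or.inl (c.down a b ab sa sb p), Or.inl (e.down a b p ab sa sb)]

theorem not_sameEdge_of_vtx {a b : Γ.H} (na : ¬ Γ.Virt a) (sa : Γ.sgn a = true)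
    (sb : Γ.sgn b = false) (ab : Γ.vtx a b) : ¬ Γ.SameEdge a b := by
  rintro (rfl | rfl)
  · rw [sa] at sb; simp at sb
  · refine na ⟨fun h => ?_, ab⟩
    rw [h, sa] at sb; simp at sb

theorem lt_of_vtx {a b : Γ.H} (na : ¬ Γ.Virt a) (sa : Γ.sgn a = true)
    (sb : Γ.sgn b = false) (ab : Γ.vtx a b) : Γ.lt a b :=
  have st : Γ.Leads a b := .single ⟨a, b, .refl _, .refl _, sa, sb, ab⟩
  fun p => Γ.P1 a b st (not_sameEdge_of_vtx na sa sb ab) p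

/-- Induction over closed sets of real vertices. -/
theorem closed_induction {P : Set Γ.H → Prop} (zero : P ∅)
    (step : ∀ S r, Γ.Closed S → Γ.Enabled S r → P S → P (S ∪ {k | Γ.vtx r k})) :
    P {h | ¬ Γ.Virt h} := by
  -- Induction on the number of half-edges of real vertices that are still outside `S`.
  suffices ∀ n, ∀ S, Γ.Closed S → P S → ({h | ¬ Γ.Virt h} \ S).ncard = n → P {h | ¬ Γ.Virt h} from
    this _ ∅ .empty zero rfl
  intro n
  induction n using Nat.strong_induction_on with
  | _ n ih =>
    intro S c p hn
    by_cases full : ∀ h, ¬ Γ.Virt h → h ∈ S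
    · have : {h | ¬ Γ.Virt h} = S := Set.ext fun h => ⟨full h, c.not_virt h⟩
      rwa [this]
    · push Not at full
      obtain ⟨h, nv, hS⟩ := full
      obtain ⟨b, hb, sb⟩ := Γ.exists_out h
      have wf : WellFounded (fun a b : Γ.H => ¬ Γ.le b a) := by
        have : IsTrans Γ.H (fun a b : Γ.H => ¬ Γ.le b a) := ⟨fun a b c p q r =>
          p (Γ.le_trans _ _ _ (le_of_not_le q) r)⟩
        have : Std.Irrefl (fun a b : Γ.H => ¬ Γ.le b a) := ⟨fun a p => p (le_refl a)⟩
        exact Finite.wellFounded_of_trans_of_irrefl _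
      -- A minimal outgoing half-edge `r` outside `S` belongs to an enabled vertex: by P1 an edge
      -- into this vertex precedes `r`, so if it starts at a half-edge of a real vertex, minimality
      -- puts that half-edge in `S`.
      let T : Set Γ.H := {b | ¬ Γ.Virt b ∧ b ∉ S ∧ Γ.sgn b = false}
      have T_ne : T.Nonempty := ⟨b, not_virt_of_vtx hb nv, fun q => hS (c.sat b h (Γ.vtx.symm hb) q), sb⟩
      obtain ⟨r, ⟨rv, rS, sr⟩, hr⟩ := wf.has_min T T_ne
      have en : Γ.Enabled S r := by
        refine ⟨rv, rS, fun a b ra ab sa sb => ?_⟩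
        have na := not_virt_of_vtx ra rv
        have lt := lt_of_vtx na sa sr (Γ.vtx.symm ra)
        by_contra q
        refine hr b ⟨fun w => na (w.sameEdge ab.symm), q, sb⟩ fun le => ?_
        exact lt (Γ.le_trans _ _ _ le (le_of_sameEdge ab.symm))
      refine ih _ ?_ _ (c.insert en) (step S r c en p) rfl
      rw [← hn]
      refine Set.ncard_lt_ncard ?_ (Set.toFinite _)
      refine (Set.ssubset_iff_of_subset fun x hx => ?_).2
        ⟨r, ⟨rv, rS⟩, fun q => q.2 (Or.inr (Γ.vtx.refl r))⟩
      exact ⟨hx.1, fun q => hx.2 (Or.inl q)⟩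

/-- An edge which leads to an edge which starts in the closed set `S` ends in `S`. -/
theorem Closed.exists_target {S : Set Γ.H} (c : Γ.Closed S) {x y : Γ.H} (l : Γ.Leads x y)
    (ne : ¬ Γ.SameEdge x y) (hy : ∀ b, Γ.SameEdge y b → Γ.sgn b = false → ¬ Γ.Virt b → b ∈ S) :
    ∃ a ∈ S, Γ.SameEdge x a ∧ Γ.sgn a = true := by
  have key : ∀ {x y}, Γ.Step x y → ¬ Γ.SameEdge x y →
      (∀ b, Γ.SameEdge y b → Γ.sgn b = false → ¬ Γ.Virt b → b ∈ S) →
      ∃ a ∈ S, Γ.SameEdge x a ∧ Γ.sgn a = true := by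
    intro x y s ne hy
    obtain ⟨a, b, ea, eb, sa, sb, ab, na, nb⟩ := step_real s ne
    exact ⟨a, c.sat b a (Γ.vtx.symm ab) (hy b eb sb nb), ea, sa⟩
  induction l with
  | single s => exact key s ne hy
  | @tail m k s t ih =>
    by_cases e : Γ.SameEdge m k
    · exact ih (fun e' => ne (e'.trans e)) fun b eb => hy b (e.symm.trans eb)
    · obtain ⟨a, aS, ea, sa⟩ := key t e hy
      by_cases e' : Γ.SameEdge x m
      · exact ⟨a, aS, e'.trans ea, sa⟩
      -- The edge of `m` ends in `S`, hence it also starts in `S` by `down`, and the argument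
      -- continues backwards along the path.
      · exact ih e' fun b eb sb _ => c.down a b (ea.symm.trans eb) sa sb aS

/-- A directed path which ends with an edge out of the vertex of `b` runs through an edge into this
vertex. -/
theorem exists_in_of_leads {x b : Γ.H} (l : Γ.Leads x b) (ne : ¬ Γ.SameEdge x b)
    (sb : Γ.sgn b = false) :
    ∃ a, Γ.vtx b a ∧ Γ.sgn a = true ∧ (Γ.SameEdge x a ∨ Γ.Leads x a) := by
  have key : ∀ {x}, Γ.Step x b → ¬ Γ.SameEdge x b →
      ∃ a, Γ.vtx b a ∧ Γ.sgn a = true ∧ Γ.SameEdge x a := by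
    intro x s ne
    obtain ⟨a, b', ea, eb, sa, sb', ab, -⟩ := step_real s ne
    have := eq_of_sameEdge eb (sb.trans sb'.symm)
    subst this
    exact ⟨a, Γ.vtx.symm ab, sa, ea⟩
  have main : ∀ y, Γ.Leads x y → Γ.SameEdge y b →
      ∃ a, Γ.vtx b a ∧ Γ.sgn a = true ∧ (Γ.SameEdge x a ∨ Γ.Leads x a) := by
    intro y l
    induction l with
    | single s =>
      intro e
      obtain ⟨a, h1, h2, h3⟩ := key (step_congr (.refl _) e s) ne
      exact ⟨a, h1, h2, Or.inl h3⟩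
    | @tail m k s t ih =>
      intro e
      by_cases d : Γ.SameEdge m b
      · exact ih d
      · obtain ⟨a, h1, h2, h3⟩ := key (step_congr (.refl _) e t) d
        exact ⟨a, h1, h2, Or.inr (leads_congr (.refl _) h3 s)⟩
  exact main b l (.refl _)

/-- Such an edge starts in `S` or has no real source, because the vertex is enabled, and it ends at
this vertex, which lies outside `S`. -/
theorem Enabled.in_mem_cut {S : Set Γ.H} {r : Γ.H} (c : Γ.Closed S) (e : Γ.Enabled S r) {a : Γ.H}
    (ra : Γ.vtx r a) (sa : Γ.sgn a = true) : a ∈ Γ.cut S := by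
  refine ⟨fun b eb sb _ => e.down a b ra eb sa sb, fun a' ea sa' m => ?_⟩
  have := eq_of_sameEdge ea (sa.trans sa'.symm)
  subst this
  exact e.not_mem (c.sat a r (Γ.vtx.symm ra) m)

theorem Enabled.out_not_mem_cut {S : Set Γ.H} {r : Γ.H} (c : Γ.Closed S) (e : Γ.Enabled S r)
    {b : Γ.H} (rb : Γ.vtx r b) (sb : Γ.sgn b = false) : b ∉ Γ.cut S := fun m =>
  e.not_mem (c.sat b r (Γ.vtx.symm rb) (m.1 b (.refl _) sb (not_virt_of_vtx rb e.not_virt)))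

/-- An edge out of `S` between an edge into and an edge out of an enabled vertex is an edge into
this vertex. -/
theorem Enabled.not_between {S : Set Γ.H} {r : Γ.H} (c : Γ.Closed S) (e : Γ.Enabled S r)
    {a b x : Γ.H} (ra : Γ.vtx r a) (sa : Γ.sgn a = true) (rb : Γ.vtx r b) (sb : Γ.sgn b = false)
    (hx : x ∈ Γ.cut S) (nx : ∀ a', Γ.vtx r a' → Γ.sgn a' = true → ¬ Γ.SameEdge x a')
    (ax : Γ.lt a x) : ¬ Γ.lt x b := by
  intro xb
  have st : Γ.Leads a b := .single ⟨a, b, .refl _, .refl _, sa, sb, Γ.vtx.trans (Γ.vtx.symm ra) rb⟩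
  have ac := e.in_mem_cut c ra sa
  have noteq : ∀ {h k : Γ.H}, Γ.lt h k → ¬ Γ.SameEdge h k := fun p q => p (le_of_sameEdge q.symm)
  -- By P2 either `x` leads to `b` or `a` leads to `x`. In the first case the path enters the vertex
  -- through some edge `a'` of the cut, so `x` already ends in `S`; in the second case `a` already
  -- ends in `S`. Neither is possible for an edge of the cut.
  rcases Γ.P2 a b x st ax xb with l | l
  · obtain ⟨a', ba', sa', q⟩ := exists_in_of_leads l (noteq xb) sb
    have ra' := Γ.vtx.trans rb ba'
    have q' := q.resolve_left (nx a' ra' sa')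
    obtain ⟨t, tS, et, st⟩ := c.exists_target q' (nx a' ra' sa') (e.in_mem_cut c ra' sa').1
    exact hx.2 t et st tS
  · obtain ⟨t, tS, et, st⟩ := c.exists_target l (noteq ax) hx.1
    exact ac.2 t et st tS

end PlanarGraph

/-! ### Layouts of diagrams -/

open PreGraph DirectedGraph PlanarGraph

variable {V : Type u} [Category.{v} V] [MonoidalCategory V]

/-- A map which identifies the edges of the diagram with elements of a linearly ordered set,
compatibly with the labels. -/
structure IsLayout {E : Type} [LinearOrder E] (D : PlanarDiagram V) (ob : E → V) (θ : D.H → E) :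
    Prop where
  le_iff : ∀ h k, D.le h k ↔ θ h ≤ θ k
  ob_eq : ∀ h, ob (θ h) = D.obj h

/-- The rule given by the real vertex of `h`. -/
noncomputable def PlanarDiagram.rule {E : Type} (D : PlanarDiagram V) (θ : D.H → E) (h : D.H)
    (p : ¬ D.Virt h) : Rule E V :=
  ⟨(D.ordList (D.inAt h)).map θ, (D.ordList (D.outAt h)).map θ, D.mor h p⟩

/-- The rules given by the real vertices in a set of half-edges. -/
def PlanarDiagram.rules {E : Type} (D : PlanarDiagram V) (θ : D.H → E) (S : Set D.H) :
    Set (Rule E V) := {p | ∃ h ∈ S, ∃ nv, p = D.rule θ h nv}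

theorem PlanarDiagram.rule_congr {E : Type} (D : PlanarDiagram V) (θ : D.H → E) {h k : D.H}
    (p : ¬ D.Virt h) (q : ¬ D.Virt k) (e : D.vtx h k) : D.rule θ h p = D.rule θ k q := by
  have : ∀ x, D.vtx h x ↔ D.vtx k x := fun x =>
    ⟨fun f => D.vtx.trans (D.vtx.symm e) f, fun f => D.vtx.trans e f⟩
  unfold rule inAt outAt
  simp only [this, D.mor_vtx h k p q e]

namespace IsLayout

variable {E : Type} [LinearOrder E] {D : PlanarDiagram V} {ob : E → V} {θ : D.H → E}

theorem eq_iff (t : IsLayout D ob θ) (h k : D.H) : θ h = θ k ↔ D.SameEdge h k := by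
  rw [← D.le_antisymm_iff, t.le_iff, t.le_iff, _root_.le_antisymm_iff]

theorem lt_iff (t : IsLayout D ob θ) (h k : D.H) : D.lt h k ↔ θ h < θ k := by
  unfold PlanarGraph.lt
  rw [t.le_iff, not_le]

theorem eq_of_sgn (t : IsLayout D ob θ) {h k : D.H} (e : θ h = θ k) (s : D.sgn h = D.sgn k) :
    h = k := eq_of_sameEdge ((t.eq_iff h k).1 e) s

theorem sorted (t : IsLayout D ob θ) {S : Set D.H} {b : Bool} (hS : ∀ h ∈ S, D.sgn h = b) :
    ((D.ordList S).map θ).Pairwise (· < ·) := by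
  rw [List.pairwise_map]
  refine ((pairwise_ordList S).and (nodup_ordList S)).imp_of_mem fun {h k} hh hk p => ?_
  refine lt_of_le_of_ne ((t.le_iff h k).1 (le_of_leH p.1)) fun e => p.2 (t.eq_of_sgn e ?_)
  rw [hS h (mem_ordList.1 hh), hS k (mem_ordList.1 hk)]

theorem mem_map {S : Set D.H} {e : E} : e ∈ (D.ordList S).map θ ↔ ∃ h ∈ S, θ h = e := by
  simp only [List.mem_map, mem_ordList]

theorem sorted_inAt (t : IsLayout D ob θ) (h : D.H) :
    ((D.ordList (D.inAt h)).map θ).Pairwise (· < ·) := t.sorted fun _ p => p.2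

theorem sorted_outAt (t : IsLayout D ob θ) (h : D.H) :
    ((D.ordList (D.outAt h)).map θ).Pairwise (· < ·) := t.sorted fun _ p => p.2

theorem sorted_ins (t : IsLayout D ob θ) : (D.ins.map θ).Pairwise (· < ·) :=
  t.sorted fun _ p => p.2

theorem sorted_outs (t : IsLayout D ob θ) : (D.outs.map θ).Pairwise (· < ·) :=
  t.sorted fun _ p => p.2

/-- A criterion in terms of the whole edge, namely that no real vertex is its source. It does not
refer to a chosen leg, and so it can be compared with a composite, where legs are removed or merged.
-/
theorem mem_ins (t : IsLayout D ob θ) (e : E) : e ∈ D.ins.map θ ↔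
    ∃ h, θ h = e ∧ ∀ b, θ b = e → D.sgn b = false → D.Virt b := by
  rw [ins, mem_map]
  constructor
  · rintro ⟨h, hh, rfl⟩
    exact ⟨h, rfl, fun b eb sb => (exists_inLegs_iff h).1 ⟨h, hh, .refl _⟩ b
      ((t.eq_iff _ _).1 eb.symm) sb⟩
  · rintro ⟨h, rfl, c⟩
    obtain ⟨i, hi, e⟩ := (exists_inLegs_iff h).2 fun b eb sb => c b ((t.eq_iff _ _).2 eb).symm sb
    exact ⟨i, hi, ((t.eq_iff _ _).2 e).symm⟩

theorem mem_outs (t : IsLayout D ob θ) (e : E) : e ∈ D.outs.map θ ↔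
    ∃ h, θ h = e ∧ ∀ a, θ a = e → D.sgn a = true → D.Virt a := by
  rw [outs, mem_map]
  constructor
  · rintro ⟨h, hh, rfl⟩
    exact ⟨h, rfl, fun b eb sb => (exists_outLegs_iff h).1 ⟨h, hh, .refl _⟩ b
      ((t.eq_iff _ _).1 eb.symm) sb⟩
  · rintro ⟨h, rfl, c⟩
    obtain ⟨i, hi, e⟩ := (exists_outLegs_iff h).2 fun b eb sb => c b ((t.eq_iff _ _).2 eb).symm sb
    exact ⟨i, hi, ((t.eq_iff _ _).2 e).symm⟩

theorem map_inAt_ne (h : D.H) : (D.ordList (D.inAt h)).map θ ≠ [] := by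
  obtain ⟨a, ha, sa⟩ := D.exists_in h
  exact List.ne_nil_of_mem (mem_map.2 ⟨a, ⟨ha, sa⟩, rfl⟩)

theorem map_outAt_ne (h : D.H) : (D.ordList (D.outAt h)).map θ ≠ [] := by
  obtain ⟨a, ha, sa⟩ := D.exists_out h
  exact List.ne_nil_of_mem (mem_map.2 ⟨a, ⟨ha, sa⟩, rfl⟩)

theorem map_ob (t : IsLayout D ob θ) (l : List D.H) : (l.map θ).map ob = l.map D.obj := by
  rw [List.map_map]
  exact List.map_congr_left fun h _ => t.ob_eq h

/-- The rules of a diagram are applied independently of each other. -/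
theorem separated (t : IsLayout D ob θ) {l : List (Rule E V)} (n : l.Nodup)
    (hl : ∀ p ∈ l, p ∈ D.rules θ Set.univ) : Separated (D.ins.map θ) l := by
  refine ⟨t.sorted_ins.imp ne_of_lt, ?_, ?_, ?_, ?_, ?_⟩
  · intro p hp
    obtain ⟨h, -, nv, rfl⟩ := hl p hp
    exact map_inAt_ne h
  · intro p hp
    obtain ⟨h, -, nv, rfl⟩ := hl p hp
    exact (t.sorted_outAt h).imp ne_of_lt
  · intro p hp e he hi
    obtain ⟨h, -, nv, rfl⟩ := hl p hp
    obtain ⟨b, ⟨hb, sb⟩, rfl⟩ := mem_map.1 he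
    obtain ⟨k, ek, c⟩ := (t.mem_ins _).1 hi
    exact not_virt_of_vtx hb nv (c b rfl sb)
  -- Rules which consume the same edge share its positive half-edge, hence its vertex, hence they
  -- are equal. The outputs are treated likewise with the negative half-edge.
  · refine n.pairwise_of_forall_ne fun p hp q hq ne e he he' => ne ?_
    obtain ⟨h, -, nv, rfl⟩ := hl p hp
    obtain ⟨k, -, nk, rfl⟩ := hl q hq
    obtain ⟨a, ⟨ha, sa⟩, rfl⟩ := mem_map.1 he
    obtain ⟨b, ⟨hb, sb⟩, eb⟩ := mem_map.1 he'
    have := t.eq_of_sgn eb (sb.trans sa.symm)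
    subst this
    exact D.rule_congr θ nv nk (D.vtx.trans ha (D.vtx.symm hb))
  · refine n.pairwise_of_forall_ne fun p hp q hq ne e he he' => ne ?_
    obtain ⟨h, -, nv, rfl⟩ := hl p hp
    obtain ⟨k, -, nk, rfl⟩ := hl q hq
    obtain ⟨a, ⟨ha, sa⟩, rfl⟩ := mem_map.1 he
    obtain ⟨b, ⟨hb, sb⟩, eb⟩ := mem_map.1 he'
    have := t.eq_of_sgn eb (sb.trans sa.symm)
    subst this
    exact D.rule_congr θ nv nk (D.vtx.trans ha (D.vtx.symm hb))

/-- A sorted word of the edges out of a closed set contains the edges into an enabled vertex as a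
segment, and it may be replaced by the edges out of this vertex. -/
theorem exists_step (t : IsLayout D ob θ) {S : Set D.H} {r : D.H} (c : D.Closed S)
    (e : D.Enabled S r) {w : List E} (hw : w.Pairwise (· < ·))
    (mw : ∀ x, x ∈ w ↔ ∃ h ∈ D.cut S, θ h = x) :
    ∃ L M, w = L ++ ((D.ordList (D.inAt r)).map θ ++ M) ∧
      (L ++ ((D.ordList (D.outAt r)).map θ ++ M)).Pairwise (· < ·) ∧
      ∀ x, x ∈ L ++ ((D.ordList (D.outAt r)).map θ ++ M) ↔
        ∃ h ∈ D.cut (S ∪ {k | D.vtx r k}), θ h = x := by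
  obtain ⟨L, M, h1, h2, h3⟩ := exists_replace_segment hw (t.sorted_inAt r) (t.sorted_outAt r)
    (map_inAt_ne r) (map_outAt_ne r) (by
      intro x hx
      obtain ⟨a, ⟨ra, sa⟩, rfl⟩ := mem_map.1 hx
      exact (mw _).2 ⟨a, e.in_mem_cut c ra sa, rfl⟩) (by
      intro x hx hw
      obtain ⟨b, ⟨rb, sb⟩, rfl⟩ := mem_map.1 hx
      obtain ⟨h, hh, eh⟩ := (mw _).1 hw
      exact e.out_not_mem_cut c rb sb (cut_sameEdge ((t.eq_iff _ _).1 eh) hh)) (by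
      intro x hx y hy
      obtain ⟨a, ⟨ra, sa⟩, rfl⟩ := mem_map.1 hx
      obtain ⟨b, ⟨rb, sb⟩, rfl⟩ := mem_map.1 hy
      exact (t.lt_iff _ _).1 (lt_of_vtx (not_virt_of_vtx ra e.not_virt) sa sb
        (D.vtx.trans (D.vtx.symm ra) rb))) (by
      intro x hx nx y hy z hz
      obtain ⟨a, ⟨ra, sa⟩, rfl⟩ := mem_map.1 hy
      obtain ⟨b, ⟨rb, sb⟩, rfl⟩ := mem_map.1 hz
      obtain ⟨h, hh, rfl⟩ := (mw _).1 hx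
      rw [← t.lt_iff, ← t.lt_iff]
      exact e.not_between c ra sa rb sb hh fun a' ra' sa' ea =>
        nx (mem_map.2 ⟨a', ⟨ra', sa'⟩, ((t.eq_iff _ _).2 ea).symm⟩))
  refine ⟨L, M, h1, h2, fun x => (h3 x).trans ?_⟩
  constructor
  · rintro (⟨hx, nx⟩ | hx)
    · obtain ⟨h, hh, rfl⟩ := (mw _).1 hx
      refine ⟨h, ⟨fun b eb sb nb => Or.inl (hh.1 b eb sb nb), ?_⟩, rfl⟩
      rintro a ea sa (q | q)
      · exact hh.2 a ea sa q
      · exact nx (mem_map.2 ⟨a, ⟨q, sa⟩, ((t.eq_iff _ _).2 ea).symm⟩)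
    · obtain ⟨b, ⟨rb, sb⟩, rfl⟩ := mem_map.1 hx
      refine ⟨b, ⟨fun b' eb sb' nb => ?_, ?_⟩, rfl⟩
      · have := eq_of_sameEdge eb (sb.trans sb'.symm)
        subst this
        exact Or.inr rb
      -- An edge out of the vertex of `r` ends neither in `S` nor at this vertex: in both cases its
      -- source `b` would lie in `S`, which contains nothing of the vertex of `r`.
      · have key : ∀ a, D.SameEdge b a → D.sgn a = true → a ∉ S ∧ ¬ D.vtx r a := by
          intro a ea sa
          have key : b ∉ S := fun q => e.not_mem (c.sat b r (D.vtx.symm rb) q)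
          exact ⟨fun q => key (c.down a b ea.symm sa sb q),
            fun q => key (e.down a b q ea.symm sa sb)⟩
        rintro a ea sa (q | q)
        exacts [(key a ea sa).1 q, (key a ea sa).2 q]
  · rintro ⟨h, ⟨h1, h2⟩, rfl⟩
    by_cases q : ∃ b, D.SameEdge h b ∧ D.sgn b = false ∧ D.vtx r b
    · obtain ⟨b, eb, sb, rb⟩ := q
      exact Or.inr (mem_map.2 ⟨b, ⟨rb, sb⟩, ((t.eq_iff _ _).2 eb).symm⟩)
    · refine Or.inl ⟨(mw _).2 ⟨h, ⟨fun b eb sb nb => ?_, fun a ea sa aS => ?_⟩, rfl⟩, ?_⟩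
      · exact (h1 b eb sb nb).resolve_right fun rb => q ⟨b, eb, sb, rb⟩
      · exact h2 a ea sa (Or.inl aS)
      · intro hx
        obtain ⟨a, ⟨ra, sa⟩, ea⟩ := mem_map.1 hx
        exact h2 a ((t.eq_iff _ _).1 ea.symm) sa (Or.inr ra)

/-- The two ends of the rewriting: the cut of the empty set consists of the input edges, and, by
`mem_outs_iff_cut`, the cut of the set of all real half-edges consists of the output edges. -/
theorem mem_ins_iff_cut (t : IsLayout D ob θ) (e : E) : e ∈ D.ins.map θ ↔
    ∃ h ∈ D.cut ∅, θ h = e := by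
  rw [t.mem_ins]
  constructor
  · rintro ⟨h, rfl, c⟩
    exact ⟨h, ⟨fun b eb sb nb => (nb (c b ((t.eq_iff _ _).2 eb).symm sb)).elim,
      fun _ _ _ q => q⟩, rfl⟩
  · rintro ⟨h, c, rfl⟩
    exact ⟨h, rfl, fun b eb sb => by_contra fun nb => c.1 b ((t.eq_iff _ _).1 eb.symm) sb nb⟩

theorem mem_outs_iff_cut (t : IsLayout D ob θ) (e : E) : e ∈ D.outs.map θ ↔
    ∃ h ∈ D.cut {h | ¬ D.Virt h}, θ h = e := by
  rw [t.mem_outs]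
  constructor
  · rintro ⟨h, rfl, c⟩
    exact ⟨h, ⟨fun b eb sb nb => nb,
      fun b eb sb q => q (c b ((t.eq_iff _ _).2 eb).symm sb)⟩, rfl⟩
  · rintro ⟨h, c, rfl⟩
    exact ⟨h, rfl, fun b eb sb => by_contra fun nb => c.2 b ((t.eq_iff _ _).1 eb.symm) sb nb⟩

variable (D) in
theorem rules_insert (θ : D.H → E) (S : Set D.H) {r : D.H} (nv : ¬ D.Virt r) (p : Rule E V) :
    p ∈ D.rules θ (S ∪ {k | D.vtx r k}) ↔ p = D.rule θ r nv ∨ p ∈ D.rules θ S := by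
  constructor
  · rintro ⟨h, q | q, nh, rfl⟩
    · exact Or.inr ⟨h, q, nh, rfl⟩
    · exact Or.inl (D.rule_congr θ nh nv (D.vtx.symm q))
  · rintro (rfl | ⟨h, q, nh, rfl⟩)
    · exact ⟨r, Or.inr (D.vtx.refl r), nv, rfl⟩
    · exact ⟨h, Or.inl q, nh, rfl⟩

theorem rule_not_mem (t : IsLayout D ob θ) {S : Set D.H} {r : D.H} (c : D.Closed S)
    (e : D.Enabled S r) : D.rule θ r e.not_virt ∉ D.rules θ S := by
  rintro ⟨h, q, nh, eq⟩
  obtain ⟨a, ra, sa⟩ := D.exists_in r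
  have : θ a ∈ (D.rule θ r e.not_virt).ins := mem_map.2 ⟨a, ⟨ra, sa⟩, rfl⟩
  rw [eq] at this
  obtain ⟨a', ⟨ha, sa'⟩, ea⟩ := mem_map.1 this
  have := t.eq_of_sgn ea (sa'.trans sa.symm)
  subst this
  exact e.not_mem (c.sat h r (D.vtx.trans ha (D.vtx.symm ra)) q)

variable [StrictTensorCategory V]

/-- The rules of a diagram rewrite the word of the inputs to the word of the outputs. -/
theorem exists_run (t : IsLayout D ob θ) : ∃ l f, l.Nodup ∧ (∀ p, p ∈ l ↔ p ∈ D.rules θ Set.univ) ∧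
    Run ob (D.ins.map θ) l (D.outs.map θ) f := by
  -- Invariant: the rules of `S`, each used once, rewrite the word of inputs to the increasing word
  -- of the cut of `S`.
  have main := closed_induction (Γ := D.toPlanarGraph) (P := fun S => ∃ w l f,
      w.Pairwise (· < ·) ∧ (∀ x, x ∈ w ↔ ∃ h ∈ D.cut S, θ h = x) ∧
      l.Nodup ∧ (∀ p, p ∈ l ↔ p ∈ D.rules θ S) ∧ Run ob (D.ins.map θ) l w f)
    ⟨D.ins.map θ, [], _, t.sorted_ins, t.mem_ins_iff_cut, List.nodup_nil, fun p =>
      ⟨nofun, fun ⟨h, q, _⟩ => q.elim⟩, .nil _⟩ (by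
    rintro S r c e ⟨w, l, f, hw, mw, nl, ml, run⟩
    obtain ⟨L, M, rfl, h2, h3⟩ := t.exists_step c e hw mw
    have r' := run.append (.step L (D.rule θ r e.not_virt) M
      ((D.mor_left r _).trans (congrArg tensorWord (t.map_ob _).symm))
      ((D.mor_right r _).trans (congrArg tensorWord (t.map_ob _).symm)) (.nil _))
    refine ⟨_, _, _, h2, h3, ?_, fun p => ?_, r'⟩
    · rw [List.nodup_append]
      refine ⟨nl, by simp, ?_⟩
      rintro p hp q hq rfl
      rw [List.mem_singleton] at hq
      subst hq
      exact t.rule_not_mem c e ((ml _).1 hp)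
    · rw [rules_insert D θ S e.not_virt, List.mem_append, List.mem_singleton, ml, or_comm])
  obtain ⟨w, l, f, hw, mw, nl, ml, run⟩ := main
  have : w = D.outs.map θ := eq_of_sorted hw t.sorted_outs fun x =>
    (mw x).trans (t.mem_outs_iff_cut x).symm
  subst this
  refine ⟨l, f, nl, fun p => (ml p).trans ⟨?_, ?_⟩, run⟩
  · rintro ⟨h, -, nv, rfl⟩
    exact ⟨h, trivial, nv, rfl⟩
  · rintro ⟨h, -, nv, rfl⟩
    exact ⟨h, nv, nv, rfl⟩

theorem run_unique (t : IsLayout D ob θ) {l l' : List (Rule E V)} {w w' : List E} {f g : Arrow V}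
    (n : l.Nodup) (n' : l'.Nodup) (m : ∀ p, p ∈ l ↔ p ∈ D.rules θ Set.univ)
    (m' : ∀ p, p ∈ l' ↔ p ∈ D.rules θ Set.univ) (r : Run ob (D.ins.map θ) l w f)
    (r' : Run ob (D.ins.map θ) l' w' g) : f = g :=
  (Run.unique (t.separated n fun p => (m p).1)
    ((List.perm_ext_iff_of_nodup n n').2 fun p => (m p).trans (m' p).symm) r r').2

end IsLayout

/-! ### The value of a diagram -/

section Value

/-- Every diagram has a layout. -/
theorem PlanarDiagram.exists_layout (D : PlanarDiagram V) :
    ∃ (E : Type) (_ : LinearOrder E) (ob : E → V) (θ : D.H → E), Function.Surjective θ ∧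
      IsLayout D ob θ := by
  obtain ⟨E, o, θ, s, h⟩ := exists_linearOrder D.le D.le_total D.le_trans
  refine ⟨E, o, fun e => D.obj (Function.surjInv s e), θ, s, h, fun x => ?_⟩
  have := Function.surjInv_eq s (θ x)
  exact D.obj_sameEdge ((D.le_antisymm_iff _ _).1 ⟨(h _ _).2 this.le, (h _ _).2 this.ge⟩)

variable [StrictTensorCategory V]

/-- `f` is the composite of the morphisms of the real vertices of the diagram. -/
def PlanarDiagram.HasValue (D : PlanarDiagram V) (f : Arrow V) : Prop :=
  -- All layouts are allowed, so that the value can be computed in whichever one is at hand, in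
  -- particular in the restriction of a layout of a larger diagram.
  ∀ (E : Type) (_ : LinearOrder E) (ob : E → V) (θ : D.H → E), IsLayout D ob θ →
    ∃ l, l.Nodup ∧ (∀ p, p ∈ l ↔ p ∈ D.rules θ Set.univ) ∧
      Run ob (D.ins.map θ) l (D.outs.map θ) f

/-- Two layouts identify the same half-edges. Hence any layout factors through a surjective one by
an injective map of labels, which preserves objects and carries rules to rules, and a run is
transported along this map. -/
theorem PlanarDiagram.exists_value (D : PlanarDiagram V) : ∃ f, D.HasValue f := by
  obtain ⟨E, o, ob, θ, s, t⟩ := D.exists_layout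
  obtain ⟨l, f, n, m, r⟩ := t.exists_run
  refine ⟨f, fun E' o' ob' θ' t' => ?_⟩
  let φ : E → E' := fun e => θ' (Function.surjInv s e)
  have hφ : ∀ h, φ (θ h) = θ' h := fun h =>
    (t'.eq_iff _ _).2 ((t.eq_iff _ _).1 (Function.surjInv_eq s (θ h)))
  have hob : ∀ e, ob' (φ e) = ob e := by
    intro e
    obtain ⟨h, rfl⟩ := s e
    rw [hφ, t'.ob_eq, t.ob_eq]
  have inj : Function.Injective φ := by
    intro x y e
    obtain ⟨h, rfl⟩ := s x
    obtain ⟨k, rfl⟩ := s y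
    rw [hφ, hφ] at e
    exact (t.eq_iff _ _).2 ((t'.eq_iff _ _).1 e)
  have injR : Function.Injective (Rule.map (V := V) φ) := by
    intro p q e
    have e1 := congrArg Rule.ins e
    have e2 := congrArg Rule.outs e
    have e3 := congrArg Rule.mor e
    exact Rule.ext (inj.list_map e1) (inj.list_map e2) e3
  have hmap : ∀ l : List D.H, (l.map θ).map φ = l.map θ' := fun l => by
    rw [List.map_map]
    exact List.map_congr_left fun h _ => hφ h
  have hrule : ∀ h nv, (D.rule θ h nv).map φ = D.rule θ' h nv := fun h nv => by
    simp only [Rule.map, PlanarDiagram.rule, hmap]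
  refine ⟨l.map (Rule.map φ), n.map injR, fun p => ?_, ?_⟩
  · rw [List.mem_map]
    constructor
    · rintro ⟨q, hq, rfl⟩
      obtain ⟨h, -, nv, rfl⟩ := (m q).1 hq
      exact ⟨h, trivial, nv, hrule h nv⟩
    · rintro ⟨h, -, nv, rfl⟩
      exact ⟨_, (m _).2 ⟨h, trivial, nv, rfl⟩, hrule h nv⟩
  · have := r.map hob
    rwa [hmap, hmap] at this

/-- The composite of the morphisms of the real vertices of the diagram. -/
noncomputable def PlanarDiagram.value (D : PlanarDiagram V) : Arrow V := D.exists_value.choose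

theorem PlanarDiagram.hasValue (D : PlanarDiagram V) : D.HasValue D.value :=
  D.exists_value.choose_spec

/-- The device by which all values are computed: it is enough to exhibit one run from the inputs
which uses each rule once. Its final word is not prescribed, since it is forced. -/
theorem IsLayout.value_eq {E : Type} [LinearOrder E] {D : PlanarDiagram V} {ob : E → V}
    {θ : D.H → E} (t : IsLayout D ob θ) {l : List (Rule E V)} {w : List E} {f : Arrow V}
    (n : l.Nodup) (m : ∀ p, p ∈ l ↔ p ∈ D.rules θ Set.univ) (r : Run ob (D.ins.map θ) l w f) :
    D.value = f := by
  obtain ⟨l', n', m', r'⟩ := D.hasValue E _ ob θ t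
  exact t.run_unique n' n m' m r' r

end Value

/-! ### Layouts of tensor products -/

section Tensor

open Juxtaposition

variable {E : Type} [LinearOrder E] {D₁ D₂ : PlanarDiagram V} {ob : E → V} {θ₁ : D₁.H → E}
  {θ₂ : D₂.H → E}

theorem IsLayout.tensor (t₁ : IsLayout D₁ ob θ₁) (t₂ : IsLayout D₂ ob θ₂)
    (lt : ∀ h k, θ₁ h < θ₂ k) : IsLayout (D₁.tensor D₂) ob (Sum.elim θ₁ θ₂) where
  le_iff := by
    rintro (h | h) (k | k)
    · exact Sum.lex_inl_inl.trans (t₁.le_iff h k)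
    · exact iff_of_true (.sep _ _) (lt h k).le
    · exact iff_of_false Sum.lex_inr_inl (lt k h).not_ge
    · exact Sum.lex_inr_inr.trans (t₂.le_iff h k)
  ob_eq := by
    rintro (h | h)
    exacts [t₁.ob_eq h, t₂.ob_eq h]

theorem rules_tensor : (D₁.tensor D₂).rules (Sum.elim θ₁ θ₂) Set.univ =
    D₁.rules θ₁ Set.univ ∪ D₂.rules θ₂ Set.univ := by
  have hinl : ∀ h nv nv', (D₁.tensor D₂).rule (Sum.elim θ₁ θ₂) (.inl h) nv = D₁.rule θ₁ h nv' :=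
    fun h nv nv' => Rule.ext (PlanarDiagram.map_tensor_inl θ₁ θ₂ true h) (PlanarDiagram.map_tensor_inl θ₁ θ₂ false h) rfl
  have hinr : ∀ h nv nv', (D₁.tensor D₂).rule (Sum.elim θ₁ θ₂) (.inr h) nv = D₂.rule θ₂ h nv' :=
    fun h nv nv' => Rule.ext (PlanarDiagram.map_tensor_inr θ₁ θ₂ true h) (PlanarDiagram.map_tensor_inr θ₁ θ₂ false h) rfl
  ext p
  constructor
  · rintro ⟨h | h, -, nv, rfl⟩
    · exact Or.inl ⟨h, trivial, fun w => nv ((virt_inl h).2 w), hinl _ _ _⟩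
    · exact Or.inr ⟨h, trivial, fun w => nv ((virt_inr h).2 w), hinr _ _ _⟩
  · rintro (⟨h, -, nv, rfl⟩ | ⟨h, -, nv, rfl⟩)
    · exact ⟨.inl h, trivial, fun w => nv ((virt_inl h).1 w), (hinl _ _ _).symm⟩
    · exact ⟨.inr h, trivial, fun w => nv ((virt_inr h).1 w), (hinr _ _ _).symm⟩

theorem leg_inl (h : D₁.H) : (D₁.tensor D₂).Leg (.inl h) ↔ D₁.Leg h :=
  or_congr Sum.inl_injective.eq_iff (virt_inl h)

theorem leg_inr (h : D₂.H) : (D₁.tensor D₂).Leg (.inr h) ↔ D₂.Leg h :=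
  or_congr Sum.inr_injective.eq_iff (virt_inr h)

theorem ins_tensor (t₁ : IsLayout D₁ ob θ₁) (t₂ : IsLayout D₂ ob θ₂) (lt : ∀ h k, θ₁ h < θ₂ k) :
    (D₁.tensor D₂).ins.map (Sum.elim θ₁ θ₂) = D₁.ins.map θ₁ ++ D₂.ins.map θ₂ := by
  refine eq_of_sorted (t₁.tensor t₂ lt).sorted_ins ?_ fun e => ?_
  · refine List.pairwise_append.2 ⟨t₁.sorted_ins, t₂.sorted_ins, fun x hx y hy => ?_⟩
    obtain ⟨h, -, rfl⟩ := List.mem_map.1 hx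
    obtain ⟨k, -, rfl⟩ := List.mem_map.1 hy
    exact lt h k
  · refine (IsLayout.mem_map (D := D₁.tensor D₂) (θ := Sum.elim θ₁ θ₂)).trans ?_
    simp only [ins, List.mem_append, IsLayout.mem_map]
    constructor
    · rintro ⟨h | h, ⟨hh, s⟩, rfl⟩
      exacts [Or.inl ⟨h, ⟨(leg_inl h).1 hh, s⟩, rfl⟩, Or.inr ⟨h, ⟨(leg_inr h).1 hh, s⟩, rfl⟩]
    · rintro (⟨h, ⟨hh, s⟩, rfl⟩ | ⟨h, ⟨hh, s⟩, rfl⟩)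
      exacts [⟨.inl h, ⟨(leg_inl h).2 hh, s⟩, rfl⟩, ⟨.inr h, ⟨(leg_inr h).2 hh, s⟩, rfl⟩]

theorem outs_tensor (t₁ : IsLayout D₁ ob θ₁) (t₂ : IsLayout D₂ ob θ₂) (lt : ∀ h k, θ₁ h < θ₂ k) :
    (D₁.tensor D₂).outs.map (Sum.elim θ₁ θ₂) = D₁.outs.map θ₁ ++ D₂.outs.map θ₂ := by
  refine eq_of_sorted (t₁.tensor t₂ lt).sorted_outs ?_ fun e => ?_
  · refine List.pairwise_append.2 ⟨t₁.sorted_outs, t₂.sorted_outs, fun x hx y hy => ?_⟩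
    obtain ⟨h, -, rfl⟩ := List.mem_map.1 hx
    obtain ⟨k, -, rfl⟩ := List.mem_map.1 hy
    exact lt h k
  · refine (IsLayout.mem_map (D := D₁.tensor D₂) (θ := Sum.elim θ₁ θ₂)).trans ?_
    simp only [outs, List.mem_append, IsLayout.mem_map]
    constructor
    · rintro ⟨h | h, ⟨hh, s⟩, rfl⟩
      exacts [Or.inl ⟨h, ⟨(leg_inl h).1 hh, s⟩, rfl⟩, Or.inr ⟨h, ⟨(leg_inr h).1 hh, s⟩, rfl⟩]
    · rintro (⟨h, ⟨hh, s⟩, rfl⟩ | ⟨h, ⟨hh, s⟩, rfl⟩)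
      exacts [⟨.inl h, ⟨(leg_inl h).2 hh, s⟩, rfl⟩, ⟨.inr h, ⟨(leg_inr h).2 hh, s⟩, rfl⟩]

variable [StrictTensorCategory V]

/-- A layout of the tensor product restricts to both factors, and the labels of `D₁` lie below those
of `D₂`. So the words are concatenated and the tensor product of runs of the factors is a run. -/
theorem PlanarDiagram.value_tensor (D₁ D₂ : PlanarDiagram V) :
    (D₁.tensor D₂).value = tensorMor D₁.value D₂.value := by
  obtain ⟨E, o, ob, θ, -, t⟩ := (D₁.tensor D₂).exists_layout
  let θ₁ : D₁.H → E := fun h => θ (.inl h)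
  let θ₂ : D₂.H → E := fun h => θ (.inr h)
  have hθ : θ = Sum.elim θ₁ θ₂ := funext (by rintro (h | h) <;> rfl)
  have t₁ : IsLayout D₁ ob θ₁ :=
    ⟨fun h k => Sum.lex_inl_inl.symm.trans (t.le_iff (.inl h) (.inl k)), fun h => t.ob_eq (.inl h)⟩
  have t₂ : IsLayout D₂ ob θ₂ :=
    ⟨fun h k => Sum.lex_inr_inr.symm.trans (t.le_iff (.inr h) (.inr k)), fun h => t.ob_eq (.inr h)⟩
  have lt : ∀ h k, θ₁ h < θ₂ k := fun h k => (t.lt_iff (.inl h) (.inr k)).1 Sum.lex_inr_inl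
  obtain ⟨l₁, n₁, m₁, r₁⟩ := D₁.hasValue E o ob θ₁ t₁
  obtain ⟨l₂, n₂, m₂, r₂⟩ := D₂.hasValue E o ob θ₂ t₂
  have r := r₁.tensor r₂
  rw [← ins_tensor t₁ t₂ lt] at r
  refine (t₁.tensor t₂ lt).value_eq (List.nodup_append.2 ⟨n₁, n₂, ?_⟩) (fun p => ?_) r
  · rintro p hp q hq rfl
    obtain ⟨h, -, nv, e⟩ := (m₁ p).1 hp
    obtain ⟨k, -, nk, e'⟩ := (m₂ p).1 hq
    obtain ⟨x, hx⟩ := List.exists_mem_of_ne_nil _ (IsLayout.map_inAt_ne (θ := θ₁) h)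
    have hx' : x ∈ (D₂.rule θ₂ k nk).ins := by rw [← e', e]; exact hx
    obtain ⟨a, -, rfl⟩ := List.mem_map.1 hx
    obtain ⟨b, -, eb⟩ := List.mem_map.1 hx'
    exact (lt a b).ne eb.symm
  · rw [List.mem_append, m₁, m₂, rules_tensor]; rfl

end Tensor

/-! ### Layouts of composites -/

section Composition

open Grafting

/-- No edge is lost in the grafting. When two virtual edges meet, the other halves survive; when a
virtual edge meets a real leg, that leg survives. -/
theorem Grafting.exists_keep {Γ₁ Γ₂ : PlanarGraph} (hl : Γ₁.outs.length = Γ₂.ins.length)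
    (x : Γ₁.H ⊕ Γ₂.H) : ∃ y, Keep Γ₁ Γ₂ y ∧ EdgeRel Γ₁ Γ₂ x y := by
  rcases x with h | h
  · by_cases v : Γ₁.Virt h
    · obtain ⟨o, ho, e⟩ : ∃ o ∈ Γ₁.outLegs, Γ₁.SameEdge h o := by
        rcases s : Γ₁.sgn h with _ | _
        · exact ⟨h, ⟨Or.inr v, s⟩, .refl _⟩
        · exact ⟨Γ₁.σ h, ⟨Or.inr v.σ, sgn_flip v s⟩, Or.inr rfl⟩
      obtain ⟨i, m⟩ := exists_matched_out hl ho
      by_cases vi : Γ₂.Virt i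
      · exact ⟨_, keep_inl_of_virt m (v.sameEdge e) vi, e.trans (Or.inr rfl)⟩
      · exact ⟨_, keep_inr_of_not_virt vi, o, i, m, e, .refl _⟩
    · exact ⟨_, keep_inl_of_not_virt v, .refl _⟩
  · by_cases v : Γ₂.Virt h
    · obtain ⟨i, hi, e⟩ : ∃ i ∈ Γ₂.inLegs, Γ₂.SameEdge h i := by
        rcases s : Γ₂.sgn h with _ | _
        · exact ⟨Γ₂.σ h, ⟨Or.inr v.σ, sgn_flip v s⟩, Or.inr rfl⟩
        · exact ⟨h, ⟨Or.inr v, s⟩, .refl _⟩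
      obtain ⟨o, m⟩ := exists_matched_in hl hi
      by_cases vo : Γ₁.Virt o
      · exact ⟨_, keep_inr_of_virt m vo (v.sameEdge e), e.trans (Or.inr rfl)⟩
      · exact ⟨_, keep_inl_of_not_virt vo, o, i, m, .refl _, e.symm⟩
    · exact ⟨_, keep_inr_of_not_virt v, .refl _⟩

variable {E : Type} [LinearOrder E]

/-- Layouts of two diagrams which fit together to a layout of the composite. -/
structure Glued (D₁ D₂ : PlanarDiagram V) (ob : E → V) (θ₁ : D₁.H → E) (θ₂ : D₂.H → E) :
    Prop where
  fst : IsLayout D₁ ob θ₁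
  snd : IsLayout D₂ ob θ₂
  word : D₁.outs.map θ₁ = D₂.ins.map θ₂
  -- This is the shuffle order of the composite: an edge of the first diagram is at most an edge of
  -- the second only if some grafted edge separates them.
  le_out : ∀ h k, θ₁ h ≤ θ₂ k → ∃ e ∈ D₁.outs.map θ₁, θ₁ h ≤ e ∧ e ≤ θ₂ k

/-- The map to the edges of a composite. -/
def PlanarDiagram.compMap {E : Type} {D₁ D₂ : PlanarDiagram V} (hc : D₁.cod = D₂.dom)
    (θ₁ : D₁.H → E) (θ₂ : D₂.H → E) : (D₂.comp D₁ hc).H → E := fun x => Sum.elim θ₁ θ₂ x.1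

namespace Glued

variable {D₁ D₂ : PlanarDiagram V} {ob : E → V} {θ₁ : D₁.H → E} {θ₂ : D₂.H → E}

theorem cod_eq_dom (g : Glued D₁ D₂ ob θ₁ θ₂) : D₁.cod = D₂.dom := by
  unfold PlanarDiagram.cod PlanarDiagram.dom
  rw [← g.fst.map_ob, ← g.snd.map_ob, g.word]

/-- The outputs and the inputs carry the same word of labels, without repetitions, so having the
same position in the lists means having the same label. -/
theorem matched_iff (g : Glued D₁ D₂ ob θ₁ θ₂) (o : D₁.H) (i : D₂.H) :
    Matched D₁.toPlanarGraph D₂.toPlanarGraph o i ↔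
      o ∈ D₁.outLegs ∧ i ∈ D₂.inLegs ∧ θ₁ o = θ₂ i := by
  have key : ∀ o i, Matched D₁.toPlanarGraph D₂.toPlanarGraph o i → θ₁ o = θ₂ i := by
    intro o i m
    obtain ⟨k, h₁, h₂, rfl, rfl⟩ := m.exists_getElem
    have e₁ : (D₁.outs.map θ₁)[k]'(by simpa using h₁) = θ₁ D₁.outs[k] := by simp
    have e₂ : (D₂.ins.map θ₂)[k]'(by simpa using h₂) = θ₂ D₂.ins[k] := by simp
    rw [← e₁, ← e₂]
    simp only [g.word]
  constructor
  · exact fun m => ⟨m.out, m.inp, key o i m⟩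
  · rintro ⟨ho, hi, e⟩
    have hl : D₁.outs.length = D₂.ins.length := by simpa using congrArg List.length g.word
    obtain ⟨i', m⟩ := exists_matched_out hl ho
    have := g.snd.eq_of_sgn (e.symm.trans (key o i' m)) (hi.2.trans m.inp.2.symm)
    rwa [this]

theorem length_eq (g : Glued D₁ D₂ ob θ₁ θ₂) : D₁.outs.length = D₂.ins.length := by
  simpa using congrArg List.length g.word

theorem le_iff (g : Glued D₁ D₂ ob θ₁ θ₂) (x y : D₁.H ⊕ D₂.H) :
    Le D₁.toPlanarGraph D₂.toPlanarGraph x y ↔ Sum.elim θ₁ θ₂ x ≤ Sum.elim θ₁ θ₂ y := by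
  have key : ∀ h k, θ₁ h ≤ θ₂ k →
      ∃ o i, Matched D₁.toPlanarGraph D₂.toPlanarGraph o i ∧ D₁.le h o ∧ D₂.le i k := by
    intro h k p
    obtain ⟨e, he, p₁, p₂⟩ := g.le_out h k p
    obtain ⟨o, ho, eo⟩ := IsLayout.mem_map.1 he
    rw [g.word] at he
    obtain ⟨i, hi, ei⟩ := IsLayout.mem_map.1 he
    refine ⟨o, i, (g.matched_iff o i).2 ⟨ho, hi, eo.trans ei.symm⟩, ?_, ?_⟩
    · rw [g.fst.le_iff, eo]; exact p₁
    · rw [g.snd.le_iff, ei]; exact p₂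
  rcases x with h | h <;> rcases y with k | k
  · exact g.fst.le_iff h k
  · constructor
    · rintro ⟨o, i, m, p, q⟩
      exact ((g.fst.le_iff _ _).1 p).trans
        (((g.matched_iff o i).1 m).2.2.le.trans ((g.snd.le_iff _ _).1 q))
    · exact key h k
  · constructor
    · intro p
      by_contra q
      obtain ⟨o, i, m, ho, ih⟩ := key k h (not_le.1 q).le
      exact q (((g.snd.le_iff _ _).1 ((p o i m).2 ho)).trans
        (((g.matched_iff o i).1 m).2.2.ge.trans ((g.fst.le_iff _ _).1 ((p o i m).1 ih))))
    · intro p o i m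
      have e := ((g.matched_iff o i).1 m).2.2
      rw [g.fst.le_iff, g.snd.le_iff, g.fst.le_iff, g.snd.le_iff, e]
      exact ⟨fun q => q.trans p, fun q => le_trans p q⟩
  · exact g.snd.le_iff h k

/-- A label which occurs in both diagrams is that of a grafted edge: in `le_out` the separating edge
is squeezed between equal labels. -/
theorem mem_word (g : Glued D₁ D₂ ob θ₁ θ₂) {h : D₁.H} {k : D₂.H} (e : θ₁ h = θ₂ k) :
    θ₁ h ∈ D₁.outs.map θ₁ := by
  obtain ⟨x, hx, p, q⟩ := g.le_out h k e.le
  rwa [le_antisymm p (q.trans e.ge)]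

theorem isLayout (g : Glued D₁ D₂ ob θ₁ θ₂) :
    IsLayout (D₂.comp D₁ g.cod_eq_dom) ob (PlanarDiagram.compMap g.cod_eq_dom θ₁ θ₂) where
  le_iff := fun x y => g.le_iff x.1 y.1
  ob_eq := by
    rintro ⟨h | h, _⟩
    exacts [g.fst.ob_eq h, g.snd.ob_eq h]

theorem exists_half (g : Glued D₁ D₂ ob θ₁ θ₂) (x : D₁.H ⊕ D₂.H) :
    ∃ y, PlanarDiagram.compMap g.cod_eq_dom θ₁ θ₂ y = Sum.elim θ₁ θ₂ x := by
  obtain ⟨y, ky, e⟩ := exists_keep g.length_eq x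
  rw [← Le.antisymm_iff, g.le_iff, g.le_iff] at e
  exact ⟨⟨y, ky⟩, le_antisymm e.2 e.1⟩

/-- Grafting removes half-edges of virtual edges only, so the real vertices of the composite are
those of the two diagrams, with their half-edges in the same order. -/
theorem rules_comp (g : Glued D₁ D₂ ob θ₁ θ₂) :
    (D₂.comp D₁ g.cod_eq_dom).rules (PlanarDiagram.compMap g.cod_eq_dom θ₁ θ₂) Set.univ =
      D₁.rules θ₁ Set.univ ∪ D₂.rules θ₂ Set.univ := by
  have hl := g.length_eq
  have hinl : ∀ h kh nv nv', (D₂.comp D₁ g.cod_eq_dom).rule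
      (PlanarDiagram.compMap g.cod_eq_dom θ₁ θ₂) ⟨.inl h, kh⟩ nv = D₁.rule θ₁ h nv' :=
    fun h kh nv nv' => Rule.ext (PlanarDiagram.map_comp_inl θ₁ θ₂ true hl h kh nv')
      (PlanarDiagram.map_comp_inl θ₁ θ₂ false hl h kh nv') rfl
  have hinr : ∀ h kh nv nv', (D₂.comp D₁ g.cod_eq_dom).rule
      (PlanarDiagram.compMap g.cod_eq_dom θ₁ θ₂) ⟨.inr h, kh⟩ nv = D₂.rule θ₂ h nv' :=
    fun h kh nv nv' => Rule.ext (PlanarDiagram.map_comp_inr θ₁ θ₂ true hl h kh nv')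
      (PlanarDiagram.map_comp_inr θ₁ θ₂ false hl h kh nv') rfl
  ext p
  constructor
  · rintro ⟨⟨h | h, kh⟩, -, nv, rfl⟩
    · exact Or.inl ⟨h, trivial, fun w => nv ((comp_virt_inl hl h kh).2 w), hinl _ _ _ _⟩
    · exact Or.inr ⟨h, trivial, fun w => nv ((comp_virt_inr hl h kh).2 w), hinr _ _ _ _⟩
  · rintro (⟨h, -, nv, rfl⟩ | ⟨h, -, nv, rfl⟩)
    · have kh : Keep D₁.toPlanarGraph D₂.toPlanarGraph (.inl h) := keep_inl_of_not_virt nv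
      exact ⟨⟨.inl h, kh⟩, trivial, fun w => nv ((comp_virt_inl hl h kh).1 w),
        (hinl _ _ _ _).symm⟩
    · have kh : Keep D₁.toPlanarGraph D₂.toPlanarGraph (.inr h) := keep_inr_of_not_virt nv
      exact ⟨⟨.inr h, kh⟩, trivial, fun w => nv ((comp_virt_inr hl h kh).1 w),
        (hinr _ _ _ _).symm⟩

/-- If an edge of the composite has no real source and comes from `D₂`, then it is an input edge of
`D₂`, so it is grafted to an output edge of `D₁` and has a label in `D₁` as well. Conversely, an
input edge of `D₁` which is also an edge of `D₂` is an input edge there and acquires no source. -/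
theorem ins_comp (g : Glued D₁ D₂ ob θ₁ θ₂) :
    (D₂.comp D₁ g.cod_eq_dom).ins.map (PlanarDiagram.compMap g.cod_eq_dom θ₁ θ₂) =
      D₁.ins.map θ₁ := by
  have hl := g.length_eq
  refine eq_of_sorted g.isLayout.sorted_ins g.fst.sorted_ins fun e => ?_
  rw [g.isLayout.mem_ins, g.fst.mem_ins]
  constructor
  · rintro ⟨y, ey, c⟩
    have c₁ : ∀ b, θ₁ b = e → D₁.sgn b = false → D₁.Virt b := by
      intro b eb sb
      by_contra nv
      have kb : Keep D₁.toPlanarGraph D₂.toPlanarGraph (.inl b) := keep_inl_of_not_virt nv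
      exact nv ((comp_virt_inl hl b kb).1 (c ⟨.inl b, kb⟩ eb sb))
    obtain ⟨h | k, kh⟩ := y
    · exact ⟨h, ey, c₁⟩
    · have : e ∈ D₂.ins.map θ₂ := (g.snd.mem_ins e).2 ⟨k, ey, fun b eb sb => by
        by_contra nv
        have kb : Keep D₁.toPlanarGraph D₂.toPlanarGraph (.inr b) := keep_inr_of_not_virt nv
        exact nv ((comp_virt_inr hl b kb).1 (c ⟨.inr b, kb⟩ eb sb))⟩
      rw [← g.word] at this
      obtain ⟨h, -, eh⟩ := List.mem_map.1 this
      exact ⟨h, eh, c₁⟩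
  · rintro ⟨h, rfl, c⟩
    obtain ⟨y, ey⟩ := g.exists_half (.inl h)
    refine ⟨y, ey, ?_⟩
    rintro ⟨b | b, kb⟩ eb sb
    · exact (comp_virt_inl hl b kb).2 (c b eb sb)
    · have eb' : θ₂ b = θ₁ h := eb
      have hm := g.mem_word eb'.symm
      rw [g.word] at hm
      obtain ⟨k, -, c'⟩ := (g.snd.mem_ins _).1 hm
      exact (comp_virt_inr hl b kb).2 (c' b eb' sb)

theorem outs_comp (g : Glued D₁ D₂ ob θ₁ θ₂) :
    (D₂.comp D₁ g.cod_eq_dom).outs.map (PlanarDiagram.compMap g.cod_eq_dom θ₁ θ₂) =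
      D₂.outs.map θ₂ := by
  have hl := g.length_eq
  refine eq_of_sorted g.isLayout.sorted_outs g.snd.sorted_outs fun e => ?_
  rw [g.isLayout.mem_outs, g.snd.mem_outs]
  constructor
  · rintro ⟨y, ey, c⟩
    have c₁ : ∀ b, θ₂ b = e → D₂.sgn b = true → D₂.Virt b := by
      intro b eb sb
      by_contra nv
      have kb : Keep D₁.toPlanarGraph D₂.toPlanarGraph (.inr b) := keep_inr_of_not_virt nv
      exact nv ((comp_virt_inr hl b kb).1 (c ⟨.inr b, kb⟩ eb sb))
    obtain ⟨k | h, kh⟩ := y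
    · have : e ∈ D₁.outs.map θ₁ := (g.fst.mem_outs e).2 ⟨k, ey, fun b eb sb => by
        by_contra nv
        have kb : Keep D₁.toPlanarGraph D₂.toPlanarGraph (.inl b) := keep_inl_of_not_virt nv
        exact nv ((comp_virt_inl hl b kb).1 (c ⟨.inl b, kb⟩ eb sb))⟩
      rw [g.word] at this
      obtain ⟨h, -, eh⟩ := List.mem_map.1 this
      exact ⟨h, eh, c₁⟩
    · exact ⟨h, ey, c₁⟩
  · rintro ⟨h, rfl, c⟩
    obtain ⟨y, ey⟩ := g.exists_half (.inr h)
    refine ⟨y, ey, ?_⟩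
    rintro ⟨b | b, kb⟩ eb sb
    · have eb' : θ₁ b = θ₂ h := eb
      obtain ⟨k, -, c'⟩ := (g.fst.mem_outs _).1 (g.mem_word eb')
      exact (comp_virt_inl hl b kb).2 (c' b rfl sb)
    · exact (comp_virt_inr hl b kb).2 (c b eb sb)

end Glued

/-- The composite of two diagrams has a layout which is glued from layouts of the diagrams. -/
theorem exists_glued (D₁ D₂ : PlanarDiagram V) (hc : D₁.cod = D₂.dom) :
    ∃ (E : Type) (_ : LinearOrder E) (ob : E → V) (θ₁ : D₁.H → E) (θ₂ : D₂.H → E),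
      Glued D₁ D₂ ob θ₁ θ₂ := by
  have hl := PlanarDiagram.length_eq hc
  -- The order is taken on all half-edges, including those that disappear in the composite; thus
  -- both diagrams are labelled completely.
  obtain ⟨E, o, θ, s, h⟩ := exists_linearOrder (Le D₁.toPlanarGraph D₂.toPlanarGraph) Le.total
    fun _ _ _ => Le.trans
  have heq : ∀ x y, θ x = θ y ↔ EdgeRel D₁.toPlanarGraph D₂.toPlanarGraph x y := fun x y => by
    rw [← Le.antisymm_iff, h, h, _root_.le_antisymm_iff]
  have hm : ∀ o i, Matched D₁.toPlanarGraph D₂.toPlanarGraph o i → θ (.inl o) = θ (.inr i) :=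
    fun o i m => (heq _ _).2 ⟨o, i, m, .refl _, .refl _⟩
  have objm : ∀ o i, Matched D₁.toPlanarGraph D₂.toPlanarGraph o i → D₁.obj o = D₂.obj i := by
    intro o i m
    obtain ⟨k, h₁, h₂, rfl, rfl⟩ := m.exists_getElem
    have e₁ : D₁.cod[k]'(by simpa [PlanarDiagram.cod] using h₁) = D₁.obj D₁.outs[k] := by
      simp [PlanarDiagram.cod]
    have e₂ : D₂.dom[k]'(by simpa [PlanarDiagram.dom] using h₂) = D₂.obj D₂.ins[k] := by
      simp [PlanarDiagram.dom]
    rw [← e₁, ← e₂]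
    simp only [hc]
  have obj : ∀ x y, EdgeRel D₁.toPlanarGraph D₂.toPlanarGraph x y →
      Sum.elim D₁.obj D₂.obj x = Sum.elim D₁.obj D₂.obj y := by
    rintro (x | x) (y | y) e
    · exact D₁.obj_sameEdge e
    · obtain ⟨o, i, m, e, f⟩ := e
      exact (D₁.obj_sameEdge e).trans ((objm o i m).trans (D₂.obj_sameEdge f))
    · obtain ⟨o, i, m, e, f⟩ := e
      exact ((D₁.obj_sameEdge e).trans ((objm o i m).trans (D₂.obj_sameEdge f))).symm
    · exact D₂.obj_sameEdge e
  have ob : ∀ x, Sum.elim D₁.obj D₂.obj (Function.surjInv s (θ x)) = Sum.elim D₁.obj D₂.obj x :=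
    fun x => obj _ _ ((heq _ _).1 (Function.surjInv_eq s (θ x)))
  refine ⟨E, o, fun e => Sum.elim D₁.obj D₂.obj (Function.surjInv s e), fun x => θ (.inl x),
    fun x => θ (.inr x), ⟨fun x y => h (.inl x) (.inl y), fun x => ob (.inl x)⟩,
    ⟨fun x y => h (.inr x) (.inr y), fun x => ob (.inr x)⟩, ?_, fun x y p => ?_⟩
  · refine List.ext_getElem (by simpa using hl) fun k h₁ h₂ => ?_
    rw [List.length_map] at h₁ h₂
    simp only [List.getElem_map]
    exact hm _ _ (List.mem_iff_getElem.2 ⟨k, by simpa using ⟨h₁, h₂⟩, by simp⟩)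
  · obtain ⟨o, i, m, p, q⟩ := (h (.inl x) (.inr y)).2 p
    refine ⟨_, IsLayout.mem_map.2 ⟨o, m.out, rfl⟩, (h (.inl x) (.inl o)).1 p, ?_⟩
    rw [hm o i m]
    exact (h (.inr i) (.inr y)).1 q

variable [StrictTensorCategory V]

theorem PlanarDiagram.value_left (D : PlanarDiagram V) : D.value.left = tensorWord D.dom := by
  obtain ⟨E, o, ob, θ, -, t⟩ := D.exists_layout
  obtain ⟨l, -, -, r⟩ := D.hasValue E o ob θ t
  exact r.left_right.1.trans (congrArg tensorWord (t.map_ob _))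

theorem PlanarDiagram.value_right (D : PlanarDiagram V) : D.value.right = tensorWord D.cod := by
  obtain ⟨E, o, ob, θ, -, t⟩ := D.exists_layout
  obtain ⟨l, -, -, r⟩ := D.hasValue E o ob θ t
  exact r.left_right.2.trans (congrArg tensorWord (t.map_ob _))

/-- In a glued layout a run of `D₁` ends with the word at which a run of `D₂` begins, and the
concatenation is a run of the composite. -/
theorem PlanarDiagram.value_comp (D₁ D₂ : PlanarDiagram V) (hc : D₁.cod = D₂.dom) :
    (D₂.comp D₁ hc).value = compArr D₁.value D₂.value := by
  obtain ⟨E, o, ob, θ₁, θ₂, g⟩ := exists_glued D₁ D₂ hc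
  obtain ⟨l₁, n₁, m₁, r₁⟩ := D₁.hasValue E o ob θ₁ g.fst
  obtain ⟨l₂, n₂, m₂, r₂⟩ := D₂.hasValue E o ob θ₂ g.snd
  rw [g.word] at r₁
  have r := r₁.append r₂
  rw [← g.ins_comp] at r
  refine g.isLayout.value_eq (List.nodup_append.2 ⟨n₁, n₂, ?_⟩) (fun p => ?_) r
  · rintro p hp q hq rfl
    obtain ⟨h, -, nv, e⟩ := (m₁ p).1 hp
    obtain ⟨k, -, nk, e'⟩ := (m₂ p).1 hq
    obtain ⟨x, hx⟩ := List.exists_mem_of_ne_nil _ (IsLayout.map_inAt_ne (θ := θ₁) h)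
    have hx' : x ∈ (D₂.rule θ₂ k nk).ins := by rw [← e', e]; exact hx
    obtain ⟨a, ⟨ha, sa⟩, rfl⟩ := IsLayout.mem_map.1 hx
    obtain ⟨b, -, eb⟩ := List.mem_map.1 hx'
    -- A rule common to both diagrams would consume a common edge. This is an output edge of `D₁`,
    -- which ends at no real vertex.
    obtain ⟨-, -, c⟩ := (g.fst.mem_outs _).1 (g.mem_word eb.symm)
    exact not_virt_of_vtx ha nv (c a rfl sa)
  · rw [List.mem_append, m₁, m₂, g.rules_comp]; rfl

end Composition

/-! ### The evaluation -/

section Evaluation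

variable {E : Type} [LinearOrder E] {D₁ D₂ : PlanarDiagram V} {ob : E → V} {θ : D₂.H → E}

open PlanarDiagram

theorem PlanarDiagram.Iso.sameEdge_iff (φ : Iso D₁ D₂) (h k : D₁.H) :
    D₂.SameEdge (φ.toEquiv h) (φ.toEquiv k) ↔ D₁.SameEdge h k := by
  unfold SameEdge
  rw [← φ.map_σ, φ.toEquiv.injective.eq_iff, φ.toEquiv.injective.eq_iff]

theorem PlanarDiagram.Iso.map_ordList (φ : Iso D₁ D₂) {S : Set D₁.H} {T : Set D₂.H}
    (hT : ∀ h, φ.toEquiv h ∈ T ↔ h ∈ S) (θ : D₂.H → E) :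
    (D₂.ordList T).map θ = (D₁.ordList S).map fun h => θ (φ.toEquiv h) := by
  refine PlanarGraph.map_ordList (fun h _ => φ.toEquiv h)
    (fun h _ k _ e => φ.toEquiv.injective e) ?_ ?_ _ _ fun _ _ => rfl
  · rintro h _ k _ (rfl | p | ⟨p, q⟩)
    · exact Or.inl rfl
    · exact Or.inr (Or.inl fun c => p ((φ.map_le _ _).1 c))
    · exact Or.inr (Or.inr ⟨(φ.sameEdge_iff _ _).2 p, (φ.map_sgn _).trans q⟩)
  · intro x
    constructor
    · rintro ⟨h, p, rfl⟩
      exact (hT h).2 p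
    · intro p
      obtain ⟨h, rfl⟩ := φ.toEquiv.surjective x
      exact ⟨h, (hT h).1 p, rfl⟩

theorem PlanarDiagram.Iso.leg_iff (φ : Iso D₁ D₂) (h : D₁.H) :
    D₂.Leg (φ.toEquiv h) ↔ D₁.Leg h := by
  unfold Leg
  rw [φ.virt_iff, ← φ.map_σ, φ.toEquiv.injective.eq_iff]

variable [StrictTensorCategory V]

/-- A layout of `D₂` pulls back along the isomorphism to a layout of `D₁` with the same words and
the same rules, so one run serves both diagrams. -/
theorem PlanarDiagram.Iso.value_eq (φ : Iso D₁ D₂) : D₁.value = D₂.value := by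
  obtain ⟨E, o, ob, θ, -, t⟩ := D₂.exists_layout
  have t' : IsLayout D₁ ob fun h => θ (φ.toEquiv h) :=
    ⟨fun h k => (φ.map_le h k).symm.trans (t.le_iff _ _), fun h => (t.ob_eq _).trans (φ.map_obj h)⟩
  obtain ⟨l, n, m, r⟩ := D₂.hasValue E o ob θ t
  have hins : D₂.ins.map θ = D₁.ins.map fun h => θ (φ.toEquiv h) :=
    φ.map_ordList (fun h => and_congr (φ.leg_iff h) (by rw [φ.map_sgn])) θ
  rw [hins] at r
  have hr : ∀ h nv nv', D₂.rule θ (φ.toEquiv h) nv = D₁.rule (fun h => θ (φ.toEquiv h)) h nv' :=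
    fun h nv nv' => Rule.ext
      (φ.map_ordList (fun k => and_congr (φ.map_vtx _ _) (by rw [φ.map_sgn])) θ)
      (φ.map_ordList (fun k => and_congr (φ.map_vtx _ _) (by rw [φ.map_sgn])) θ)
      (φ.map_mor h nv' nv)
  refine t'.value_eq n (fun p => (m p).trans ⟨?_, ?_⟩) r
  · rintro ⟨k, -, nv, rfl⟩
    obtain ⟨h, rfl⟩ := φ.toEquiv.surjective k
    exact ⟨h, trivial, fun w => nv ((φ.virt_iff h).2 w), hr _ _ _⟩
  · rintro ⟨h, -, nv, rfl⟩
    exact ⟨φ.toEquiv h, trivial, fun w => nv ((φ.virt_iff h).1 w), (hr _ _ _).symm⟩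

theorem PlanarDiagram.value_prime (D : PlanarDiagram V) (hD : D.IsPrime) (h : D.H)
    (nv : ¬ D.Virt h) : D.value = D.mor h nv := by
  obtain ⟨E, o, ob, θ, -, t⟩ := D.exists_layout
  -- With a single vertex, a two-element edge would be virtual; so all half-edges are real legs, and
  -- the inputs of the graph are the inputs of the vertex.
  have leg : ∀ k, D.Leg k := fun k => by
    by_contra c
    exact hD.not_virt k ⟨fun e => c (Or.inl e), hD.2.1 _ _⟩
  have hins : D.ins = D.ordList (D.inAt h) := congrArg D.ordList (Set.ext fun k =>
    and_congr_left fun _ => iff_of_true (leg k) (hD.2.1 h k))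
  have hl : (D.rule θ h nv).mor.left = tensorWord ((D.rule θ h nv).ins.map ob) :=
    (D.mor_left h nv).trans (congrArg tensorWord (t.map_ob _).symm)
  have hr : (D.rule θ h nv).mor.right = tensorWord ((D.rule θ h nv).outs.map ob) :=
    (D.mor_right h nv).trans (congrArg tensorWord (t.map_ob _).symm)
  have r := Run.step (ob := ob) [] (D.rule θ h nv) [] hl hr (.nil _)
  rw [pad_nil_nil, List.nil_append, List.nil_append, List.append_nil, List.append_nil, idW,
    compArr_id hr] at r
  refine t.value_eq (l := [D.rule θ h nv]) (by simp) (fun p => ?_) (by rw [hins]; exact r)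
  rw [List.mem_singleton]
  constructor
  · rintro rfl
    exact ⟨h, trivial, nv, rfl⟩
  · rintro ⟨k, -, nk, rfl⟩
    exact D.rule_congr θ nk nv (hD.2.1 _ _)

theorem PlanarDiagram.value_unitary (D : PlanarDiagram V) (hD : D.IsUnitary) (h : D.H) :
    D.value = Arrow.mk (𝟙 (D.obj h)) := by
  obtain ⟨E, o, ob, θ, -, t⟩ := D.exists_layout
  have heq : ∀ k, θ k = θ h := fun k =>
    (t.eq_iff _ _).2 (D.virt_deg k h (hD.2.2 k) (hD.2.1 k h))
  have hins : D.ins.map θ = [θ h] := eq_of_sorted t.sorted_ins (by simp) fun e => by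
    rw [t.mem_ins, List.mem_singleton]
    exact ⟨fun ⟨k, ek, _⟩ => ek ▸ heq k, fun e => ⟨h, e.symm, fun b _ _ => hD.2.2 b⟩⟩
  rw [t.value_eq List.nodup_nil (fun p => ⟨nofun, fun ⟨k, _, nv, _⟩ => (nv (hD.2.2 k)).elim⟩)
    (.nil _), hins, idW, List.map_singleton, t.ob_eq]
  change Arrow.mk (𝟙 (MonoidalCategoryStruct.tensorObj _ (MonoidalCategoryStruct.tensorUnit V))) = _
  rw [StrictTensorCategory.tensor_unit]

theorem PlanarDiagram.value_empty :
    (PlanarDiagram.empty V).value = Arrow.mk (𝟙 (MonoidalCategoryStruct.tensorUnit V)) := by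
  obtain ⟨E, o, ob, θ, -, t⟩ := (PlanarDiagram.empty V).exists_layout
  have hins : (PlanarDiagram.empty V).ins.map θ = [] := List.eq_nil_iff_forall_not_mem.2 fun e he => by
    obtain ⟨h, -⟩ := List.mem_map.1 he
    exact h.elim
  rw [t.value_eq List.nodup_nil (fun p => ⟨nofun, fun ⟨k, _⟩ => k.elim⟩) (.nil _), hins]
  rfl

variable (V) in
/-- The evaluation of planar diagrams. -/
noncomputable def evaluation : Diag V → Arrow V :=
  Quotient.lift PlanarDiagram.value fun _ _ ⟨φ⟩ => φ.value_eq

variable (V) in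
theorem isEvaluation_evaluation : IsEvaluation (evaluation V) where
  empty := value_empty
  prime := fun D hD h p => D.value_prime hD h p
  unitary := fun D hD h => D.value_unitary hD h
  comp := fun D₁ D₂ hc => isCompositeMor_iff.2
    ⟨D₁.value_right.trans ((congrArg tensorWord hc).trans D₂.value_left.symm),
      value_comp D₁ D₂ hc⟩
  elementary := fun L hL => by
    clear hL
    induction L with
    | nil => exact value_empty
    | cons D L ih => exact (value_tensor D (tensorAll L)).trans (congrArg (tensorMor D.value) ih)

end Evaluation

/-! ### Unitary and prime diagrams -/

/-- The planar graph with two half-edges, which form one virtual vertex. -/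
def PlanarGraph.unit : PlanarGraph where
  H := Bool
  finite := inferInstance
  vtx := ⊤
  σ := not
  σ_σ := Bool.not_not
  virt_deg := fun h k _ _ => by cases h <;> cases k <;> simp [SameEdge]
  sgn := id
  sgn_σ := fun h _ => by cases h <;> simp
  exists_in := fun _ => ⟨true, trivial, rfl⟩
  exists_out := fun _ => ⟨false, trivial, rfl⟩
  le := fun _ _ => True
  le_total := fun _ _ => Or.inl trivial
  le_trans := fun _ _ _ _ _ => trivial
  le_antisymm_iff := fun h k => by cases h <;> cases k <;> simp [SameEdge]
  P1 := fun h k _ n => (n (by cases h <;> cases k <;> simp [SameEdge])).elim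
  P2 := fun _ _ _ _ n => (n trivial).elim

theorem PlanarGraph.unit_virt (h : PlanarGraph.unit.H) : PlanarGraph.unit.Virt h :=
  ⟨by cases h <;> exact Bool.noConfusion, trivial⟩

/-- The unitary diagram of an object. -/
def PlanarDiagram.unit (X : V) : PlanarDiagram V where
  toPlanarGraph := PlanarGraph.unit
  obj := fun _ => X
  obj_σ := fun _ => rfl
  mor := fun h p => (p (unit_virt h)).elim
  mor_vtx := fun h _ p => (p (unit_virt h)).elim
  mor_left := fun h p => (p (unit_virt h)).elim
  mor_right := fun h p => (p (unit_virt h)).elim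

theorem PlanarDiagram.isUnitary_unit (X : V) : (PlanarDiagram.unit X).IsUnitary :=
  ⟨by change Nat.card Bool = 2; simp, fun _ _ => trivial, unit_virt⟩

section Corolla

variable {D : PlanarDiagram V} {r : D.H}

/-- Two halves of one edge at the same vertex would form a virtual edge. So the half-edges of a real
vertex lie on distinct edges, and as legs of a corolla they inherit a linear order. -/
theorem PlanarDiagram.eq_of_vtx (nv : ¬ D.Virt r) {h k : D.H} (ph : D.vtx r h) (pk : D.vtx r k)
    (e : D.SameEdge h k) : h = k := by
  rcases e with rfl | rfl
  · rfl
  · by_contra c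
    exact not_virt_of_vtx ph nv ⟨Ne.symm c, D.vtx.trans (D.vtx.symm ph) pk⟩

/-- The directed graph which consists of one real vertex of a diagram. -/
def corollaDirected (D : PlanarDiagram V) (r : D.H) : DirectedGraph where
  H := {k // D.vtx r k}
  finite := inferInstance
  vtx := ⊤
  σ := id
  σ_σ := fun _ => rfl
  virt_deg := fun h _ v _ => (v.1 rfl).elim
  sgn := fun h => D.sgn h.1
  sgn_σ := fun _ p => (p rfl).elim
  exists_in := fun _ => by
    obtain ⟨k, e, s⟩ := D.exists_in r
    exact ⟨⟨k, e⟩, trivial, s⟩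
  exists_out := fun _ => by
    obtain ⟨k, e, s⟩ := D.exists_out r
    exact ⟨⟨k, e⟩, trivial, s⟩

theorem corolla_sameEdge (h k : (corollaDirected D r).H) :
    (corollaDirected D r).SameEdge h k ↔ h = k :=
  ⟨fun e => e.elim Eq.symm Eq.symm, fun e => e ▸ .refl _⟩

theorem corolla_step (h k : (corollaDirected D r).H) :
    (corollaDirected D r).Step h k ↔ D.sgn h.1 = true ∧ D.sgn k.1 = false := by
  constructor
  · rintro ⟨a, b, ea, eb, sa, sb, -⟩
    rw [corolla_sameEdge] at ea eb
    subst ea eb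
    exact ⟨sa, sb⟩
  · rintro ⟨sa, sb⟩
    exact ⟨h, k, .refl _, .refl _, sa, sb, trivial⟩

theorem corolla_le_antisymm_iff (nv : ¬ D.Virt r) (h k : (corollaDirected D r).H) :
    (D.le h.1 k.1 ∧ D.le k.1 h.1) ↔ (corollaDirected D r).SameEdge h k := by
  rw [D.le_antisymm_iff, corolla_sameEdge]
  exact ⟨fun e => Subtype.ext (PlanarDiagram.eq_of_vtx nv h.2 k.2 e), fun e => e ▸ .refl _⟩

/-- The planar graph which consists of one real vertex of a diagram. -/
def corollaPlanar (D : PlanarDiagram V) (r : D.H) (nv : ¬ D.Virt r) : PlanarGraph where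
  toDirectedGraph := corollaDirected D r
  le := fun h k => D.le h.1 k.1
  le_total := fun h k => D.le_total h.1 k.1
  le_trans := fun h k l => D.le_trans h.1 k.1 l.1
  le_antisymm_iff := corolla_le_antisymm_iff nv
  P1 := PlanarGraph.P1_of_step (Γ := corollaDirected D r)
    (fun h k l => D.le_trans h.1 k.1 l.1) (corolla_le_antisymm_iff nv) fun h k s => by
      obtain ⟨sa, sb⟩ := (corolla_step h k).1 s
      exact le_of_not_le (lt_of_vtx (not_virt_of_vtx h.2 nv) sa sb
        (D.vtx.trans (D.vtx.symm h.2) k.2))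
  P2 := PlanarGraph.P2_of_step (Γ := corollaDirected D r) (corolla_le_antisymm_iff nv)
    fun h k l s _ _ => by
      obtain ⟨sa, sb⟩ := (corolla_step h k).1 s
      -- In a corolla every input leads to every output, so the sign of the third edge decides which
      -- alternative of P2 holds.
      rcases sl : D.sgn l.1 with _ | _
      · exact Or.inr (.single ((corolla_step h l).2 ⟨sa, sl⟩))
      · exact Or.inl (.single ((corolla_step l k).2 ⟨sl, sb⟩))

theorem map_corolla {α : Type*} (nv : ¬ D.Virt r) (f : D.H → α) (h : (corollaPlanar D r nv).H)
    (b : Bool) : ((corollaPlanar D r nv).ordList {k | (corollaPlanar D r nv).vtx h k ∧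
      (corollaPlanar D r nv).sgn k = b}).map (fun k => f k.1) =
      (D.ordList {k | D.vtx r k ∧ D.sgn k = b}).map f := by
  refine (PlanarGraph.map_ordList (Γ := corollaPlanar D r nv) (fun k _ => k.1)
    (fun _ _ _ _ e => Subtype.ext e) ?_ ?_ _ _ fun _ _ => rfl).symm
  · rintro h _ k _ (rfl | p | ⟨p, q⟩)
    · exact Or.inl rfl
    · exact Or.inr (Or.inl p)
    · exact Or.inl (congrArg Subtype.val ((corolla_sameEdge h k).1 p))
  · intro x
    constructor
    · rintro ⟨k, p, rfl⟩
      exact ⟨k.2, p.2⟩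
    · rintro ⟨p, q⟩
      exact ⟨⟨x, p⟩, ⟨trivial, q⟩, rfl⟩

/-- The prime diagram which consists of one real vertex of a diagram. -/
def PlanarDiagram.corolla (D : PlanarDiagram V) (r : D.H) (nv : ¬ D.Virt r) :
    PlanarDiagram V where
  toPlanarGraph := corollaPlanar D r nv
  obj := fun h => D.obj h.1
  obj_σ := fun _ => rfl
  mor := fun _ _ => D.mor r nv
  mor_vtx := fun _ _ _ _ _ => rfl
  mor_left := fun h _ => (D.mor_left r nv).trans
    (congrArg tensorWord (map_corolla nv D.obj h true).symm)
  mor_right := fun h _ => (D.mor_right r nv).trans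
    (congrArg tensorWord (map_corolla nv D.obj h false).symm)

theorem PlanarDiagram.isPrime_corolla (nv : ¬ D.Virt r) : (D.corolla r nv).IsPrime :=
  ⟨⟨⟨r, D.vtx.refl r⟩⟩, fun _ _ => trivial, fun u => (u.2.2 ⟨r, D.vtx.refl r⟩).1 rfl⟩

end Corolla

/-! ### Realizing parts of a diagram -/

section Realization

variable {E : Type} [LinearOrder E] {ob : E → V}

/-- The diagram `A` has a layout with inputs `a`, outputs `b`, the given set of rules and the given
set of edges. -/
def Realizes (ob : E → V) (A : PlanarDiagram V) (a : List E) (R : Set (Rule E V)) (b : List E)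
    (X : Set E) : Prop :=
  ∃ θ : A.H → E, IsLayout A ob θ ∧ A.ins.map θ = a ∧ A.outs.map θ = b ∧
    A.rules θ Set.univ = R ∧ Set.range θ = X

theorem realizes_empty : Realizes ob (PlanarDiagram.empty V) [] ∅ [] ∅ := by
  refine ⟨fun h => h.elim, ⟨fun h => h.elim, fun h => h.elim⟩, ?_, ?_, ?_, ?_⟩
  · exact List.eq_nil_iff_forall_not_mem.2 fun e he => by
      obtain ⟨h, -⟩ := List.mem_map.1 he
      exact h.elim
  · exact List.eq_nil_iff_forall_not_mem.2 fun e he => by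
      obtain ⟨h, -⟩ := List.mem_map.1 he
      exact h.elim
  · exact Set.eq_empty_of_forall_notMem fun p ⟨h, _⟩ => h.elim
  · exact Set.eq_empty_of_forall_notMem fun p ⟨h, _⟩ => h.elim

theorem realizes_unit (e : E) : Realizes ob (PlanarDiagram.unit (ob e)) [e] ∅ [e] {e} := by
  have t : IsLayout (PlanarDiagram.unit (ob e)) ob fun _ => e :=
    ⟨fun _ _ => iff_of_true trivial le_rfl, fun _ => rfl⟩
  refine ⟨fun _ => e, t, ?_, ?_, ?_, ?_⟩
  · refine eq_of_sorted t.sorted_ins (by simp) fun x => ?_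
    rw [t.mem_ins, List.mem_singleton]
    exact ⟨fun ⟨_, h, _⟩ => h.symm, fun h => ⟨(true : Bool), h.symm, fun b _ _ => unit_virt b⟩⟩
  · refine eq_of_sorted t.sorted_outs (by simp) fun x => ?_
    rw [t.mem_outs, List.mem_singleton]
    exact ⟨fun ⟨_, h, _⟩ => h.symm, fun h => ⟨(true : Bool), h.symm, fun b _ _ => unit_virt b⟩⟩
  · exact Set.eq_empty_of_forall_notMem fun p ⟨h, _, nv, _⟩ => nv (unit_virt h)
  · exact Set.ext fun x => ⟨fun ⟨_, h⟩ => h.symm, fun h => ⟨(true : Bool), h.symm⟩⟩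

theorem realizes_corolla {D : PlanarDiagram V} {θ : D.H → E} (t : IsLayout D ob θ) {r : D.H}
    (nv : ¬ D.Virt r) : Realizes ob (D.corolla r nv) ((D.ordList (D.inAt r)).map θ)
      {D.rule θ r nv} ((D.ordList (D.outAt r)).map θ)
      {x | x ∈ (D.ordList (D.inAt r)).map θ ∨ x ∈ (D.ordList (D.outAt r)).map θ} := by
  have t' : IsLayout (D.corolla r nv) ob fun h => θ h.1 :=
    ⟨fun h k => t.le_iff h.1 k.1, fun h => t.ob_eq h.1⟩
  let r' : (D.corolla r nv).H := ⟨r, D.vtx.refl r⟩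
  have hvirt : ∀ h, ¬ (D.corolla r nv).Virt h := fun h v => v.1 rfl
  have hrule : ∀ h, (D.corolla r nv).rule (fun h => θ h.1) h (hvirt h) = D.rule θ r nv :=
    fun h => Rule.ext (map_corolla nv θ h true) (map_corolla nv θ h false) rfl
  have hins : (D.corolla r nv).ins = (D.corolla r nv).ordList ((D.corolla r nv).inAt r') :=
    congrArg _ (Set.ext fun h => and_congr_left fun _ => iff_of_true (Or.inl rfl) trivial)
  have houts : (D.corolla r nv).outs = (D.corolla r nv).ordList ((D.corolla r nv).outAt r') :=
    congrArg _ (Set.ext fun h => and_congr_left fun _ => iff_of_true (Or.inl rfl) trivial)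
  refine ⟨fun h => θ h.1, t', ?_, ?_, ?_, ?_⟩
  · rw [hins]; exact map_corolla nv θ r' true
  · rw [houts]; exact map_corolla nv θ r' false
  · ext p
    constructor
    · rintro ⟨h, -, nh, rfl⟩
      exact hrule h
    · rintro rfl
      exact ⟨r', trivial, hvirt _, (hrule _).symm⟩
  · ext x
    simp only [Set.mem_ofPred_eq, IsLayout.mem_map]
    constructor
    · rintro ⟨h, rfl⟩
      rcases s : D.sgn h.1 with _ | _
      exacts [Or.inr ⟨h.1, ⟨h.2, s⟩, rfl⟩, Or.inl ⟨h.1, ⟨h.2, s⟩, rfl⟩]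
    · rintro (⟨h, ⟨hh, -⟩, rfl⟩ | ⟨h, ⟨hh, -⟩, rfl⟩) <;> exact ⟨⟨h, hh⟩, rfl⟩

theorem Realizes.tensor {A B : PlanarDiagram V} {a a' b b' : List E} {R R' : Set (Rule E V)}
    {X X' : Set E} (p : Realizes ob A a R b X) (q : Realizes ob B a' R' b' X')
    (lt : ∀ x ∈ X, ∀ y ∈ X', x < y) :
    Realizes ob (A.tensor B) (a ++ a') (R ∪ R') (b ++ b') (X ∪ X') := by
  obtain ⟨θ₁, t₁, rfl, rfl, rfl, rfl⟩ := p
  obtain ⟨θ₂, t₂, rfl, rfl, rfl, rfl⟩ := q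
  have lt' : ∀ h k, θ₁ h < θ₂ k := fun h k => lt _ ⟨h, rfl⟩ _ ⟨k, rfl⟩
  exact ⟨Sum.elim θ₁ θ₂, t₁.tensor t₂ lt', ins_tensor t₁ t₂ lt', outs_tensor t₁ t₂ lt',
    rules_tensor, Set.Sum.elim_range θ₁ θ₂⟩

/-- Both parts are labelled in the same ordered set, and `le` is the separation condition of
`Glued`; composing diagrams then amounts to taking unions of rules and of labels. -/
theorem Realizes.comp {A B : PlanarDiagram V} {a b c : List E} {R R' : Set (Rule E V)}
    {X X' : Set E} (p : Realizes ob A a R b X) (q : Realizes ob B b R' c X')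
    (le : ∀ x ∈ X, ∀ y ∈ X', x ≤ y → ∃ e ∈ b, x ≤ e ∧ e ≤ y) :
    ∃ hc : A.cod = B.dom, Realizes ob (B.comp A hc) a (R ∪ R') c (X ∪ X') := by
  obtain ⟨θ₁, t₁, rfl, hb, rfl, rfl⟩ := p
  obtain ⟨θ₂, t₂, hb', rfl, rfl, rfl⟩ := q
  have g : Glued A B ob θ₁ θ₂ := ⟨t₁, t₂, hb.trans hb'.symm, fun h k l => by
    rw [hb]; exact le _ ⟨h, rfl⟩ _ ⟨k, rfl⟩ l⟩
  refine ⟨g.cod_eq_dom, _, g.isLayout, g.ins_comp, g.outs_comp, g.rules_comp, ?_⟩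
  rw [← Set.Sum.elim_range θ₁ θ₂]
  ext x
  constructor
  · rintro ⟨y, rfl⟩
    exact ⟨y.1, rfl⟩
  · rintro ⟨y, rfl⟩
    exact g.exists_half y

/-- Some elementary diagram has a layout with the given data. -/
def ElementaryRealizes (ob : E → V) (a : List E) (R : Set (Rule E V)) (b : List E)
    (X : Set E) : Prop :=
  ∃ L : List (PlanarDiagram V), (∀ D ∈ L, D.IsPrime ∨ D.IsUnitary) ∧
    Realizes ob (PlanarDiagram.tensorAll L) a R b X

theorem ElementaryRealizes.cons {A : PlanarDiagram V} {a a' b b' : List E} {R R' : Set (Rule E V)}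
    {X X' : Set E} (p : Realizes ob A a R b X) (hA : A.IsPrime ∨ A.IsUnitary)
    (q : ElementaryRealizes ob a' R' b' X') (lt : ∀ x ∈ X, ∀ y ∈ X', x < y) :
    ElementaryRealizes ob (a ++ a') (R ∪ R') (b ++ b') (X ∪ X') := by
  obtain ⟨L, hL, q⟩ := q
  exact ⟨A :: L, List.forall_mem_cons.2 ⟨hA, hL⟩, p.tensor q lt⟩

/-- The edges which a layer does not touch are carried along by unitary diagrams, one for each
letter. -/
theorem ElementaryRealizes.units {a b : List E} {R : Set (Rule E V)} {X : Set E}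
    (q : ElementaryRealizes ob a R b X) {w : List E} (hw : w.Pairwise (· < ·))
    (lt : ∀ x ∈ w, ∀ y ∈ X, x < y) :
    ElementaryRealizes ob (w ++ a) R (w ++ b) ({x | x ∈ w} ∪ X) := by
  induction w with
  | nil => simpa using q
  | cons e w ih =>
    rw [List.pairwise_cons] at hw
    have h := ElementaryRealizes.cons (realizes_unit (ob := ob) e)
      (Or.inr (PlanarDiagram.isUnitary_unit _))
      (ih hw.2 fun x hx => lt x (List.mem_cons_of_mem _ hx)) (by
        rintro x rfl y (hy | hy)
        exacts [hw.1 y hy, lt x List.mem_cons_self y hy])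
    have e2 : {x | x ∈ e :: w} ∪ X = {e} ∪ ({x | x ∈ w} ∪ X) := by
      ext x
      simp [or_assoc]
    rw [e2]
    rwa [Set.empty_union] at h

theorem elementaryRealizes_nil : ElementaryRealizes (V := V) ob [] ∅ [] ∅ :=
  ⟨[], nofun, realizes_empty⟩

/-- Diagrams which are composites of elementary diagrams. -/
inductive Constructible : PlanarDiagram V → Prop
  | elementary (L : List (PlanarDiagram V)) (hL : ∀ D ∈ L, D.IsPrime ∨ D.IsUnitary) :
      Constructible (PlanarDiagram.tensorAll L)
  | comp (A B : PlanarDiagram V) (hc : A.cod = B.dom) : Constructible A → Constructible B →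
      Constructible (B.comp A hc)

end Realization

/-! ### Every diagram is a composite of elementary diagrams -/

namespace PlanarGraph

variable {Γ : PlanarGraph}

variable (Γ) in
/-- The half-edges of the input edges and of the edges which start in `S`. -/
def born (S : Set Γ.H) : Set Γ.H :=
  {h | ∀ b, Γ.SameEdge h b → Γ.sgn b = false → ¬ Γ.Virt b → b ∈ S}

/-- An edge which starts in `S` leads to an edge out of `S`. -/
theorem Closed.exists_cut {S : Set Γ.H} (c : Γ.Closed S) (x : Γ.H) (hx : x ∈ Γ.born S) :
    ∃ y ∈ Γ.cut S, y = x ∨ Γ.Leads x y := by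
  have wf : WellFounded (fun a b : Γ.H => ¬ Γ.le a b) := by
    have : IsTrans Γ.H (fun a b : Γ.H => ¬ Γ.le a b) := ⟨fun a b c p q r =>
      p (Γ.le_trans _ _ _ r (le_of_not_le q))⟩
    have : Std.Irrefl (fun a b : Γ.H => ¬ Γ.le a b) := ⟨fun a p => p (le_refl a)⟩
    exact Finite.wellFounded_of_trans_of_irrefl _
  induction x using wf.induction with
  | _ x ih =>
    -- An edge which ends in `S` is continued by an outgoing edge of its target. The order increases
    -- strictly, so the process stops, at an edge of the cut.
    by_cases q : ∃ a, Γ.SameEdge x a ∧ Γ.sgn a = true ∧ a ∈ S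
    · obtain ⟨a, xa, sa, aS⟩ := q
      obtain ⟨b, ab, sb⟩ := Γ.exists_out a
      have lt := lt_of_vtx (c.not_virt a aS) sa sb ab
      have st : Γ.Leads x b := .single ⟨a, b, xa, .refl _, sa, sb, ab⟩
      obtain ⟨y, hy, l⟩ := ih b (fun p => lt (Γ.le_trans _ _ _ p (le_of_sameEdge xa)))
        fun b' eb sb' _ => by
          have := eq_of_sameEdge eb (sb.trans sb'.symm)
          exact this ▸ c.sat a b ab aS
      refine ⟨y, hy, Or.inr ?_⟩
      rcases l with rfl | l
      exacts [st, Relation.TransGen.trans st l]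
    · exact ⟨x, ⟨hx, fun a xa sa aS => q ⟨a, xa, sa, aS⟩⟩, Or.inl rfl⟩

/-- Between an edge which starts in `S` and an edge out of an enabled vertex there is an edge out
of `S`. -/
theorem Enabled.exists_between {S : Set Γ.H} {r x b : Γ.H} (c : Γ.Closed S) (e : Γ.Enabled S r)
    (hx : x ∈ Γ.born S) (rb : Γ.vtx r b) (sb : Γ.sgn b = false) (xb : Γ.le x b) :
    ∃ y ∈ Γ.cut S, Γ.le x y ∧ Γ.le y b := by
  have nb := not_virt_of_vtx rb e.not_virt
  have bS : b ∉ S := fun m => e.not_mem (c.sat b r (Γ.vtx.symm rb) m)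
  have ne : ¬ Γ.SameEdge x b := fun d => bS (hx b d sb nb)
  have nle : ¬ Γ.le b x := fun d => ne ((Γ.le_antisymm_iff _ _).1 ⟨xb, d⟩)
  obtain ⟨y, hy, l⟩ := c.exists_cut x hx
  rcases l with rfl | l
  · exact ⟨y, hy, le_refl y, xb⟩
  · by_cases yb : Γ.le y b
    · exact ⟨y, hy, le_of_leads l, yb⟩
    -- Here `b` lies strictly between `x` and `y`. If `b` led to `y`, its edge would end and
    -- therefore start in `S`. So `x` leads to `b`, through an edge `a` into the vertex of `b`; this
    -- `a` is in the cut and lies between `x` and `b`.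
    · rcases Γ.P2 x y b l nle yb with p | p
      · obtain ⟨a, aS, ea, sa⟩ := c.exists_target p
          (fun d => yb (le_of_sameEdge d.symm)) hy.1
        exact absurd (c.down a b ea.symm sa sb aS) bS
      · obtain ⟨a, ba, sa, q⟩ := exists_in_of_leads p ne sb
        have ra := Γ.vtx.trans rb ba
        refine ⟨a, e.in_mem_cut c ra sa, ?_, le_of_not_le (lt_of_vtx (not_virt_of_vtx ra e.not_virt)
          sa sb (Γ.vtx.symm ba))⟩
        rcases q with q | q
        exacts [le_of_sameEdge q, le_of_leads q]

end PlanarGraph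

section Decomposition

variable {E : Type} [LinearOrder E] {D : PlanarDiagram V} {ob : E → V} {θ : D.H → E}

/-- The induction of `exists_run` with diagrams instead of morphisms. The diagram built for `S` has
the rules of `S` and the edges of `born S`; adding a vertex means composing with an elementary
layer. -/
theorem IsLayout.exists_constructible (t : IsLayout D ob θ) :
    ∃ A, Constructible A ∧
      ∃ a b, Realizes ob A a (D.rules θ Set.univ) b (Set.range θ) := by
  have main := closed_induction (Γ := D.toPlanarGraph) (P := fun S => ∃ A w,
      Constructible A ∧ w.Pairwise (· < ·) ∧ (∀ x, x ∈ w ↔ ∃ h ∈ D.cut S, θ h = x) ∧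
      Realizes ob A (D.ins.map θ) (D.rules θ S) w (θ '' D.born S)) (by
    obtain ⟨L, hL, p⟩ := (elementaryRealizes_nil (ob := ob)).units t.sorted_ins nofun
    refine ⟨_, _, .elementary L hL, t.sorted_ins, t.mem_ins_iff_cut, ?_⟩
    rw [List.append_nil, Set.union_empty] at p
    have e1 : D.rules θ ∅ = ∅ := Set.eq_empty_of_forall_notMem fun p ⟨h, q, _⟩ => q
    have e2 : θ '' D.born ∅ = {x | x ∈ D.ins.map θ} := by
      ext x
      rw [Set.mem_ofPred_eq, t.mem_ins_iff_cut]
      exact ⟨fun ⟨h, hh, e⟩ => ⟨h, ⟨hh, fun _ _ _ => id⟩, e⟩, fun ⟨h, hh, e⟩ => ⟨h, hh.1, e⟩⟩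
    rwa [e1, e2]) (by
    rintro S r c e ⟨A, w, hA, hw, mw, p⟩
    obtain ⟨L, M, rfl, h2, h3⟩ := t.exists_step c e hw mw
    have hM : M.Pairwise (· < ·) := (List.pairwise_append.1 (List.pairwise_append.1 hw).2.1).2.1
    have hLp : L.Pairwise (· < ·) := (List.pairwise_append.1 hw).1
    have inM := (List.pairwise_append.1 (List.pairwise_append.1 hw).2.1).2.2
    have outM := (List.pairwise_append.1 (List.pairwise_append.1 h2).2.1).2.2
    have Lin := (List.pairwise_append.1 hw).2.2
    have Lout := (List.pairwise_append.1 h2).2.2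
    -- The layer is assembled from right to left: units on `M`, the corolla of `r`, units on `L`.
    have q0 := (elementaryRealizes_nil (ob := ob)).units hM nofun
    rw [List.append_nil, Set.union_empty] at q0
    have q1 := ElementaryRealizes.cons (realizes_corolla t e.not_virt)
      (Or.inl (PlanarDiagram.isPrime_corolla e.not_virt)) q0 (by
        rintro x (hx | hx) y hy
        exacts [inM x hx y hy, outM x hx y hy])
    obtain ⟨Ls, hLs, q⟩ := q1.units hLp (by
      rintro x hx y ((hy | hy) | hy)
      · exact Lin x hx y (List.mem_append_left _ hy)
      · exact Lout x hx y (List.mem_append_left _ hy)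
      · exact Lin x hx y (List.mem_append_right _ hy))
    have hX : {x | x ∈ L} ∪ ({x | x ∈ (D.ordList (D.inAt r)).map θ ∨
        x ∈ (D.ordList (D.outAt r)).map θ} ∪ {x | x ∈ M}) =
        {x | x ∈ L ++ ((D.ordList (D.inAt r)).map θ ++ M)} ∪
          {x | x ∈ (D.ordList (D.outAt r)).map θ} := by
      ext x
      simp only [Set.mem_union, Set.mem_ofPred_eq, List.mem_append]
      tauto
    rw [hX, Set.union_empty] at q
    -- For the separation condition, an edge of the layer that lies in the old word separates by
    -- itself; for an edge out of `r` a separating edge of the cut is given by `exists_between`.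
    obtain ⟨hc, pq⟩ := p.comp q (by
      rintro x ⟨h, hh, rfl⟩ y (hy | hy) xy
      · exact ⟨y, hy, xy, le_rfl⟩
      · obtain ⟨b, ⟨rb, sb⟩, rfl⟩ := IsLayout.mem_map.1 hy
        obtain ⟨z, hz, p1, p2⟩ := e.exists_between c hh rb sb ((t.le_iff _ _).2 xy)
        exact ⟨θ z, (mw _).2 ⟨z, hz, rfl⟩, (t.le_iff _ _).1 p1, (t.le_iff _ _).1 p2⟩)
    refine ⟨_, _, .comp _ _ hc hA (.elementary _ hLs), h2, h3, ?_⟩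
    have e1 : D.rules θ (S ∪ {k | D.vtx r k}) = D.rules θ S ∪ {D.rule θ r e.not_virt} := by
      ext p
      rw [IsLayout.rules_insert D θ S e.not_virt, or_comm]; rfl
    have e2 : θ '' D.born (S ∪ {k | D.vtx r k}) = θ '' D.born S ∪
        ({x | x ∈ L ++ ((D.ordList (D.inAt r)).map θ ++ M)} ∪
          {x | x ∈ (D.ordList (D.outAt r)).map θ}) := by
      ext x
      simp only [Set.mem_union, Set.mem_ofPred_eq, mw, IsLayout.mem_map (S := D.outAt r)]
      constructor
      · rintro ⟨h, hh, rfl⟩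
        by_cases d : ∃ b, D.SameEdge h b ∧ D.sgn b = false ∧ D.vtx r b
        · obtain ⟨b, eb, sb, rb⟩ := d
          exact Or.inr (Or.inr ⟨b, ⟨rb, sb⟩, ((t.eq_iff _ _).2 eb).symm⟩)
        · exact Or.inl ⟨h, fun b eb sb nb => (hh b eb sb nb).resolve_right
            fun rb => d ⟨b, eb, sb, rb⟩, rfl⟩
      · rintro (⟨h, hh, rfl⟩ | ⟨h, hh, rfl⟩ | ⟨b, ⟨rb, sb⟩, rfl⟩)
        · exact ⟨h, fun b eb sb nb => Or.inl (hh b eb sb nb), rfl⟩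
        · exact ⟨h, fun b eb sb nb => Or.inl (hh.1 b eb sb nb), rfl⟩
        · refine ⟨b, fun b' eb sb' _ => ?_, rfl⟩
          have := eq_of_sameEdge eb (sb.trans sb'.symm)
          exact Or.inr (this ▸ rb)
    rwa [e1, e2])
  obtain ⟨A, w, hA, -, -, p⟩ := main
  refine ⟨A, hA, D.ins.map θ, w, ?_⟩
  have e1 : D.rules θ {h | ¬ D.Virt h} = D.rules θ Set.univ := by
    ext p
    exact ⟨fun ⟨h, _, nv, q⟩ => ⟨h, trivial, nv, q⟩, fun ⟨h, _, nv, q⟩ => ⟨h, nv, nv, q⟩⟩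
  have e2 : θ '' D.born {h | ¬ D.Virt h} = Set.range θ := by
    rw [← Set.image_univ]
    congr 1
    exact Set.eq_univ_of_forall fun h b _ _ nb => nb
  rwa [e1, e2] at p

/-! ### Diagrams with the same edges and rules are isomorphic -/

/-- A rule remembers its vertex: it has an input edge, and an edge has at most one positive
half-edge. -/
theorem IsLayout.vtx_of_rule_eq (t : IsLayout D ob θ) {h k : D.H} {p : ¬ D.Virt h}
    {q : ¬ D.Virt k} (e : D.rule θ h p = D.rule θ k q) : D.vtx h k := by
  obtain ⟨a, ha, sa⟩ := D.exists_in h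
  have : θ a ∈ (D.rule θ h p).ins := mem_map.2 ⟨a, ⟨ha, sa⟩, rfl⟩
  rw [e] at this
  obtain ⟨b, ⟨hb, sb⟩, eb⟩ := mem_map.1 this
  have := t.eq_of_sgn eb (sb.trans sa.symm)
  subst this
  exact D.vtx.trans ha (D.vtx.symm hb)

variable {A : PlanarDiagram V} {η : A.H → E}

theorem exists_real_half (sub : A.rules η Set.univ ⊆ D.rules θ Set.univ) (h : A.H)
    (nv : ¬ A.Virt h) : ∃ k, ∃ nk : ¬ D.Virt k, θ k = η h ∧ D.sgn k = A.sgn h ∧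
      A.rule η h nv = D.rule θ k nk := by
  obtain ⟨h', -, nh', e⟩ := sub ⟨h, trivial, nv, rfl⟩
  rcases s : A.sgn h with _ | _
  · have m : η h ∈ (A.rule η h nv).outs := IsLayout.mem_map.2 ⟨h, ⟨A.vtx.refl h, s⟩, rfl⟩
    rw [e] at m
    obtain ⟨k, ⟨hk, sk⟩, ek⟩ := IsLayout.mem_map.1 m
    exact ⟨k, not_virt_of_vtx hk nh', ek, sk, e.trans (D.rule_congr θ _ _ hk)⟩
  · have m : η h ∈ (A.rule η h nv).ins := IsLayout.mem_map.2 ⟨h, ⟨A.vtx.refl h, s⟩, rfl⟩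
    rw [e] at m
    obtain ⟨k, ⟨hk, sk⟩, ek⟩ := IsLayout.mem_map.1 m
    exact ⟨k, not_virt_of_vtx hk nh', ek, sk, e.trans (D.rule_congr θ _ _ hk)⟩

/-- A half-edge is determined by the label of its edge and its sign. Halves at real vertices are
found in the rules, and virtual ones by the label alone. -/
theorem exists_half_of_rules (t : IsLayout D ob θ) (t' : IsLayout A ob η)
    (rules : A.rules η Set.univ = D.rules θ Set.univ) (range : Set.range η = Set.range θ)
    (h : A.H) : ∃ k, θ k = η h ∧ D.sgn k = A.sgn h ∧ (D.Virt k ↔ A.Virt h) ∧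
      ∀ nh nk, A.rule η h nh = D.rule θ k nk := by
  by_cases v : A.Virt h
  · obtain ⟨k, ek⟩ : η h ∈ Set.range θ := range ▸ ⟨h, rfl⟩
    -- If `k` were real, its rule would provide a real half-edge of `A` on the virtual edge of `h`.
    have vk : D.Virt k := by
      by_contra vk
      obtain ⟨h', nh', e, -, -⟩ := exists_real_half rules.symm.subset k vk
      exact nh' (v.sameEdge ((t'.eq_iff _ _).1 (ek.symm.trans e.symm)))
    by_cases s : D.sgn k = A.sgn h
    · exact ⟨k, ek, s, iff_of_true vk v, fun nh => (nh v).elim⟩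
    · refine ⟨D.σ k, ((t.eq_iff _ _).2 (Or.inr rfl)).symm.trans ek, ?_, iff_of_true vk.σ v,
        fun nh => (nh v).elim⟩
      have := D.sgn_σ k vk.1
      revert s this
      cases D.sgn k <;> cases D.sgn (D.σ k) <;> cases A.sgn h <;> simp
  · obtain ⟨k, nk, e, s, r⟩ := exists_real_half rules.subset h v
    exact ⟨k, e, s, iff_of_false nk v, fun _ _ => r⟩

/-- The vertex relation expressed through virtuality, labels and rules, all of which the
correspondence of half-edges preserves. -/
theorem IsLayout.vtx_iff (t : IsLayout D ob θ) (h k : D.H) : D.vtx h k ↔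
    (D.Virt h ∧ θ h = θ k) ∨ ∃ nh nk, D.rule θ h nh = D.rule θ k nk := by
  constructor
  · intro e
    by_cases v : D.Virt h
    · exact Or.inl ⟨v, (t.eq_iff _ _).2 (D.virt_deg h k v e)⟩
    · exact Or.inr ⟨v, not_virt_of_vtx e v, D.rule_congr θ _ _ e⟩
  · rintro (⟨v, e⟩ | ⟨nh, nk, e⟩)
    · exact v.vtx ((t.eq_iff _ _).1 e)
    · exact t.vtx_of_rule_eq e

/-- A diagram is determined up to isomorphism by its edges and its rules. -/
theorem IsLayout.nonempty_iso (t : IsLayout D ob θ) (t' : IsLayout A ob η)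
    (rules : A.rules η Set.univ = D.rules θ Set.univ) (range : Set.range η = Set.range θ) :
    Nonempty (PlanarDiagram.Iso A D) := by
  choose f fθ fs fv fr using exists_half_of_rules t t' rules range
  choose g gθ gs _ _ using exists_half_of_rules t' t rules.symm range.symm
  -- Both choices keep label and sign, which determine a half-edge; hence they are inverse to each
  -- other.
  have fg : ∀ k, f (g k) = k := fun k =>
    t.eq_of_sgn ((fθ _).trans (gθ k)) ((fs _).trans (gs k))
  have gf : ∀ h, g (f h) = h := fun h =>
    t'.eq_of_sgn ((gθ _).trans (fθ h)) ((gs _).trans (fs h))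
  have same : ∀ h k, D.SameEdge (f h) (f k) ↔ A.SameEdge h k := fun h k => by
    rw [← t.eq_iff, fθ, fθ, t'.eq_iff]
  refine ⟨⟨⟨f, g, gf, fg⟩, fun h k => ?_, fun h => ?_, fs, fun h k => ?_, fun h => ?_,
    fun h p q => (congrArg Rule.mor (fr h p q)).symm⟩⟩
  · change D.vtx (f h) (f k) ↔ A.vtx h k
    rw [t.vtx_iff, t'.vtx_iff, fθ, fθ]
    refine or_congr (and_congr_left fun _ => fv h) ⟨?_, ?_⟩
    · rintro ⟨nh, nk, e⟩
      have nh' : ¬ A.Virt h := fun v => nh ((fv h).2 v)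
      have nk' : ¬ A.Virt k := fun v => nk ((fv k).2 v)
      exact ⟨nh', nk', (fr h nh' nh).trans (e.trans (fr k nk' nk).symm)⟩
    · rintro ⟨nh', nk', e⟩
      have nh : ¬ D.Virt (f h) := fun v => nh' ((fv h).1 v)
      have nk : ¬ D.Virt (f k) := fun v => nk' ((fv k).1 v)
      exact ⟨nh, nk, (fr h nh' nh).symm.trans (e.trans (fr k nk' nk))⟩
  · change f (A.σ h) = D.σ (f h)
    have e₁ : D.SameEdge (f h) (f (g (D.σ (f h)))) := by
      rw [fg]
      exact Or.inr rfl
    -- The preimage of `D.σ (f h)` lies on the edge of `h`, so it is `h` or `A.σ h`. If it is `h`,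
    -- then `D.σ` fixes `f h`, and `f (A.σ h)`, being on the same edge, equals `f h` too.
    rcases (same h _).1 e₁ with e | e
    · rcases (same h (A.σ h)).2 (Or.inr rfl) with e' | e'
      · rw [e', ← fg (D.σ (f h)), e]
      · exact e'
    · rw [← e, fg]
  · change D.le (f h) (f k) ↔ A.le h k
    rw [t.le_iff, t'.le_iff, fθ, fθ]
  · change D.obj (f h) = A.obj h
    rw [← t.ob_eq, ← t'.ob_eq, fθ]

/-- Every diagram is isomorphic to a composite of elementary diagrams. -/
theorem PlanarDiagram.exists_constructible_cls_eq (D : PlanarDiagram V) :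
    ∃ A, Constructible A ∧ A.cls = D.cls := by
  obtain ⟨E, o, ob, θ, -, t⟩ := D.exists_layout
  obtain ⟨A, hA, a, b, η, t', -, -, rules, range⟩ := t.exists_constructible
  exact ⟨A, hA, Quotient.sound (t.nonempty_iso t' rules range)⟩

end Decomposition

/-! ### Uniqueness of the evaluation. -/

theorem IsEvaluation.eq_on_constructible {ε ε' : Diag V → Arrow V} (hε : IsEvaluation ε)
    (hε' : IsEvaluation ε') {A : PlanarDiagram V} (hA : Constructible A) : ε A.cls = ε' A.cls := by
  induction hA with
  | elementary L hL =>
    rw [hε.elementary L hL, hε'.elementary L hL]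
    congr 1
    refine List.map_congr_left fun D hD => ?_
    rcases hL D hD with p | p
    · obtain ⟨h⟩ := p.1
      rw [hε.prime D p h (p.not_virt h), hε'.prime D p h (p.not_virt h)]
    · obtain ⟨h⟩ : Nonempty D.H := by
        by_contra c
        rw [not_nonempty_iff] at c
        have := p.1
        simp at this
      rw [hε.unitary D p h, hε'.unitary D p h]
  | comp A B hc _ _ hA hB =>
    have h := (isCompositeMor_iff.1 (hε.comp A B hc)).2
    have h' := (isCompositeMor_iff.1 (hε'.comp A B hc)).2
    rw [h, h', hA, hB]

/-- An evaluation is a map on isomorphism classes, so it suffices that every class contains a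
composite of elementary diagrams. -/
theorem IsEvaluation.unique {ε ε' : Diag V → Arrow V} (hε : IsEvaluation ε)
    (hε' : IsEvaluation ε') : ε = ε' := by
  funext d
  obtain ⟨D, rfl⟩ := Quotient.mk_surjective d
  obtain ⟨A, hA, e⟩ := D.exists_constructible_cls_eq
  change ε D.cls = ε' D.cls
  rw [← e]
  exact hε.eq_on_constructible hε' hA

end TensorCalculus

/-- For every strict tensor category `V` there is a unique evaluation of the isomorphism classes of
planar diagrams in `V`; it is monoidal, and the value of a diagram is a morphism from the tensor
product of its domain to the tensor product of its codomain. -/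
theorem theorem4p4p2 (V : Type u) [Category.{v} V] [MonoidalCategory V] [StrictTensorCategory V] :
    (∃! ε : Diag V → Arrow V, IsEvaluation ε) ∧
      ∀ ε : Diag V → Arrow V, IsEvaluation ε →
        (∀ D₁ D₂ : PlanarDiagram V, ε (D₁.tensor D₂).cls = tensorMor (ε D₁.cls) (ε D₂.cls)) ∧
        (∀ D : PlanarDiagram V,
          (ε D.cls).left = tensorWord D.dom ∧ (ε D.cls).right = tensorWord D.cod) := by
  have main := isEvaluation_evaluation V
  refine ⟨⟨evaluation V, main, fun ε hε => hε.unique main⟩, fun ε hε => ?_⟩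
  -- By uniqueness it is enough to treat the evaluation constructed from runs, for which the tensor
  -- product, source and target are known on all diagrams.
  obtain rfl := hε.unique main
  exact ⟨PlanarDiagram.value_tensor, fun D => ⟨D.value_left, D.value_right⟩⟩
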